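/- Fix $\beta>0$, put $q=e^{-\beta/2}$, and define \[ V(r)=\sum_{m\in\mathbb Z}\frac{1}{4\sin^2[(r+i\beta m)/2]},\qquad c_0=\frac1{12}-\sum_{m=1}^\infty\frac{1}{2\sinh^2(\beta m/2)}, \] \[ \theta(r)=\sin(r/2)\prod_{m=1}^\infty\bigl(1-2q^{2m}\cos r+q^{4m}\bigr),\qquad \check\theta(z)=(1-z)\prod_{m=1}^\infty(1-q^{2m}z)(1-q^{2m}/z). \] Let $N\ge 2$ and $\tilde N\ge 1$ be integers and $\lambda=\tilde N/(N-1)$. For $\mathbf x=(x_1,\dots,x_N)\in\mathbb R^N$ and $\tilde{\mathbf x}=(\tilde x_1,\dots,\tilde x_{\tilde N})\in\mathbb R^{\tilde N}$ consider the differential operator \[ \begin{aligned} H_{N,\tilde N}={}&-\sum_{j=1}^N\frac{\partial^2}{\partial x_j^2}+\sum_{1\le j<k\le N}2\lambda(\lambda-1)V(x_j-x_k) +\lambda\sum_{J=1}^{\tilde N}\frac{\partial^2}{\partial\tilde x_J^2}+\sum_{1\le J<K\le\tilde N}\frac{2(\lambda-1)}{\lambda}V(\tilde x_J-\tilde x_K)\\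 &+\sum_{j=1}^N\sum_{K=1}^{\tilde N}2(1-\lambda)V(x_j-\tilde x_K) \end{aligned} \] on the open set of configurations whose $N+\tilde N$ coordinates are pairwise distinct modulo $2\pi$, and the functions \[ \Psi_0^{N,\tilde N}(\mathbf x,\tilde{\mathbf x})=\frac{\prod_{1\le j<k\le N}\theta(x_j-x_k)^{\lambda}\;\prod_{1\le J<K\le\tilde N}\theta(\tilde x_J-\tilde x_K)^{1/\lambda}}{\prod_{j=1}^N\prod_{J=1}^{\tilde N}\theta(x_j-\tilde x_J)} \] (principal powers of the real numbers $\theta(x_j-x_k)$, $\theta(\tilde x_J-\tilde x_K)$) and, for $n\in\mathbb Z$ and $1<R<1/q^2$, \[ \mathcal P_n=\oint_{|\xi|=R}\frac{d\xi}{2\pi i\,\xi}\,\xi^n\prod_{j=1}^N\check\theta(e^{ix_j}/\xi)^{-\lambda}\prod_{J=1}^{\tilde N}\check\theta(e^{i\tilde x_J}/\xi), \] where $\check\theta(z)^{-\lambda}=e^{-\lambda\log\check\theta(z)}$ with the holomorphic branch of $\log\check\theta$ on $q^2<|z|<1$ that is the sum of the principal logarithms of the factors of $\check\theta$. Then $\mathcal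 P_n$ does not depend on the choice of $R\in(1,1/q^2)$, and for every integer $n$ the function $\Psi_n=\Psi_0^{N,\tilde N}\,\mathcal P_n$ is an exact eigenfunction of $H_{N,\tilde N}$: it is twice continuously differentiable on the above set of configurations, is not identically zero there, and satisfies \[ H_{N,\tilde N}\Psi_n=\Bigl(n^2+\Bigl[N-1-\frac{\tilde N^2}{N-1}\Bigr]c_0\Bigr)\Psi_n . \] -/

import Mathlib

noncomputable section

namespace EllipticCS

/-- The nome `q = exp (-β / 2)`. -/
def nome (β : ℝ) : ℝ := Real.exp (-β / 2)

/-- The constant `c₀ = 1/12 - ∑_{m ≥ 1} 1 / (2 sinh² (β m / 2))`. -/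
def c0 (β : ℝ) : ℝ :=
  1 / 12 - ∑' m : ℕ, 1 / (2 * Real.sinh (β * ((m : ℝ) + 1) / 2) ^ 2)

/-- The elliptic potential `V(r) = ∑_{m ∈ ℤ} 1 / (4 sin² ((r + i β m) / 2))`. -/
def V (β : ℝ) (r : ℂ) : ℂ :=
  ∑' m : ℤ, 1 / (4 * Complex.sin ((r + Complex.I * (β : ℂ) * (m : ℂ)) / 2) ^ 2)

/-- `θ(r) = sin (r / 2) ∏_{m ≥ 1} (1 - 2 q^{2m} cos r + q^{4m})`. -/
def theta (β : ℝ) (r : ℂ) : ℂ :=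
  Complex.sin (r / 2) *
    ∏' m : ℕ, (1 - 2 * (nome β : ℂ) ^ (2 * (m + 1)) * Complex.cos r
      + (nome β : ℂ) ^ (4 * (m + 1)))

/-- `θ̌(z) = (1 - z) ∏_{m ≥ 1} (1 - q^{2m} z) (1 - q^{2m} / z)`. -/
def thetaCheck (β : ℝ) (z : ℂ) : ℂ :=
  (1 - z) * ∏' m : ℕ, ((1 - (nome β : ℂ) ^ (2 * (m + 1)) * z) *
    (1 - (nome β : ℂ) ^ (2 * (m + 1)) / z))

/-- The single-valued holomorphic logarithm of `θ̌` on the annulus `q² < |z| < 1`: the sum of the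
principal logarithms of the factors of `θ̌`, all of which lie in the open right half-plane there.
(The principal logarithm of the product itself could jump, as its argument may exceed `π`.) -/
def logThetaCheck (β : ℝ) (z : ℂ) : ℂ :=
  Complex.log (1 - z) + ∑' m : ℕ, (Complex.log (1 - (nome β : ℂ) ^ (2 * (m + 1)) * z) +
    Complex.log (1 - (nome β : ℂ) ^ (2 * (m + 1)) / z))

/-- The holomorphic power `θ̌(z)^s` on the annulus `q² < |z| < 1`. -/
def thetaCheckPow (β : ℝ) (s z : ℂ) : ℂ := Complex.exp (s * logThetaCheck β z)

/-- The function under the contour integral, apart from `ξ^n`: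
`∏_j θ̌(e^{i x_j} / ξ)^{-λ} ∏_J θ̌(e^{i x̃_J} / ξ)`. -/
def genFun (β : ℝ) (lam : ℂ) {N Nt : ℕ} (x : Fin N → ℝ) (xt : Fin Nt → ℝ) (ξ : ℂ) : ℂ :=
  (∏ j, thetaCheckPow β (-lam) (Complex.exp (Complex.I * (x j : ℂ)) / ξ)) *
    ∏ J, thetaCheck β (Complex.exp (Complex.I * (xt J : ℂ)) / ξ)

/-- `𝓟_n = ∮_{|ξ| = R} dξ / (2 π i ξ) ξ^n ∏_j θ̌(e^{i x_j}/ξ)^{-λ} ∏_J θ̌(e^{i x̃_J}/ξ)`. -/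
def laurentCoeff (β : ℝ) (lam : ℂ) (R : ℝ) (n : ℤ) {N Nt : ℕ}
    (x : Fin N → ℝ) (xt : Fin Nt → ℝ) : ℂ :=
  (2 * (Real.pi : ℂ) * Complex.I)⁻¹ * ∮ ξ in C(0, R), ξ⁻¹ * ξ ^ n * genFun β lam x xt ξ

/-- `Ψ₀ = ∏_{j<k} θ(x_j - x_k)^λ ∏_{J<K} θ(x̃_J - x̃_K)^{1/λ} / ∏_{j,J} θ(x_j - x̃_J)`.
At real arguments `θ` is real, so on non-singular real configurations the principal branch of each
power differs from any other continuous branch by a locally constant factor only. -/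
def Psi0 (β : ℝ) (lam : ℂ) {N Nt : ℕ} (x : Fin N → ℝ) (xt : Fin Nt → ℝ) : ℂ :=
  ((∏ j, ∏ k ∈ Finset.Ioi j, theta β ((x j : ℂ) - (x k : ℂ)) ^ lam) *
    (∏ J, ∏ K ∈ Finset.Ioi J, theta β ((xt J : ℂ) - (xt K : ℂ)) ^ (1 / lam))) /
    ∏ j, ∏ J, theta β ((x j : ℂ) - (xt J : ℂ))

/-- `Ψ_n = Ψ₀ 𝓟_n`. -/
def Psi (β : ℝ) (lam : ℂ) (R : ℝ) (n : ℤ) {N Nt : ℕ} (x : Fin N → ℝ) (xt : Fin Nt → ℝ) : ℂ :=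
  Psi0 β lam x xt * laurentCoeff β lam R n x xt

/-- The deformed elliptic Calogero-Sutherland differential operator `H_{N,Ñ}`, applied to `Ψ`. -/
def H (β : ℝ) (lam : ℂ) {N Nt : ℕ} (Ψ : (Fin N → ℝ) → (Fin Nt → ℝ) → ℂ)
    (x : Fin N → ℝ) (xt : Fin Nt → ℝ) : ℂ :=
  -(∑ j, iteratedDeriv 2 (fun t : ℝ => Ψ (Function.update x j t) xt) (x j))
  + (∑ j, ∑ k ∈ Finset.Ioi j, 2 * lam * (lam - 1) * V β ((x j : ℂ) - (x k : ℂ))) * Ψ x xt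
  + lam * (∑ J, iteratedDeriv 2 (fun t : ℝ => Ψ x (Function.update xt J t)) (xt J))
  + (∑ J, ∑ K ∈ Finset.Ioi J, 2 * (lam - 1) / lam * V β ((xt J : ℂ) - (xt K : ℂ))) * Ψ x xt
  + (∑ j, ∑ K, 2 * (1 - lam) * V β ((x j : ℂ) - (xt K : ℂ))) * Ψ x xt

/-- The non-singular real configurations: the `N + Ñ` positions are pairwise distinct
modulo `2π`. -/
def regularSet (N Nt : ℕ) : Set ((Fin N → ℝ) × (Fin Nt → ℝ)) :=
  {p | (∀ j k, j ≠ k → ∀ m : ℤ, p.1 j - p.1 k ≠ 2 * Real.pi * m) ∧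
    (∀ J K, J ≠ K → ∀ m : ℤ, p.2 J - p.2 K ≠ 2 * Real.pi * m) ∧
    (∀ j J, ∀ m : ℤ, p.1 j - p.2 J ≠ 2 * Real.pi * m)}

/-- `Ψ` is an exact eigenfunction of `H_{N,Ñ}` with eigenvalue `E`: on the non-singular
configurations it is twice continuously differentiable, does not vanish identically, and
satisfies `H Ψ = E Ψ`. -/
structure IsEigenfunction (β : ℝ) (lam : ℂ) {N Nt : ℕ}
    (Ψ : (Fin N → ℝ) → (Fin Nt → ℝ) → ℂ) (E : ℂ) : Prop where
  contDiffOn : ContDiffOn ℝ 2 (fun p : (Fin N → ℝ) × (Fin Nt → ℝ) => Ψ p.1 p.2) (regularSet N Nt)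
  ne_zero : ∃ p ∈ regularSet N Nt, Ψ p.1 p.2 ≠ 0
  eigen : ∀ p ∈ regularSet N Nt, H β lam Ψ p.1 p.2 = E * Ψ p.1 p.2

/-- `logThetaCheck` is a logarithm of `θ̌` on the annulus `q² < |z| < 1`. -/
theorem exp_logThetaCheck {β : ℝ} (hβ : 0 < β) {z : ℂ} (h1 : nome β ^ 2 < ‖z‖) (h2 : ‖z‖ < 1) :
    Complex.exp (logThetaCheck β z) = thetaCheck β z := by
  have q0 : 0 < nome β := Real.exp_pos _
  have q1 : nome β < 1 := by
    unfold nome; rw [Real.exp_lt_one_iff]; linarith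
  have hz : 0 < ‖z‖ := lt_trans (by positivity) h1
  have q21 : nome β ^ 2 < 1 := by nlinarith
  have hs : Summable fun m : ℕ => nome β ^ (2 * (m + 1)) := by
    have := (summable_geometric_of_lt_one (sq_nonneg (nome β)) q21).mul_left (nome β ^ 2)
    refine this.congr fun m => ?_
    ring
  have ha : Summable fun m : ℕ => -((nome β : ℂ) ^ (2 * (m + 1)) * z) := by
    refine Summable.neg (Summable.mul_right z ?_)
    exact_mod_cast hs
  have hb : Summable fun m : ℕ => -((nome β : ℂ) ^ (2 * (m + 1)) / z) := by
    refine Summable.neg (Summable.div_const ?_ z)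
    exact_mod_cast hs
  have hle : ∀ m : ℕ, nome β ^ (2 * (m + 1)) ≤ nome β ^ 2 := fun m =>
    pow_le_pow_of_le_one q0.le q1.le (by omega)
  have nq : ∀ m : ℕ, ‖(nome β : ℂ) ^ (2 * (m + 1))‖ = nome β ^ (2 * (m + 1)) := fun m => by
    rw [norm_pow, Complex.norm_real, Real.norm_of_nonneg q0.le]
  have key : ∀ w : ℂ, ‖w‖ < 1 → 1 - w ≠ 0 := by
    intro w hw h
    rw [← sub_eq_zero.mp h] at hw
    simp at hw
  have na : ∀ m : ℕ, 1 - (nome β : ℂ) ^ (2 * (m + 1)) * z ≠ 0 := fun m => key _ <| by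
    rw [norm_mul, nq]
    nlinarith [hle m]
  have nb : ∀ m : ℕ, 1 - (nome β : ℂ) ^ (2 * (m + 1)) / z ≠ 0 := fun m => key _ <| by
    rw [norm_div, nq, div_lt_one hz]
    exact lt_of_le_of_lt (hle m) h1
  have la := Complex.summable_log_one_add_of_summable ha
  have lb := Complex.summable_log_one_add_of_summable hb
  simp only [← sub_eq_add_neg] at la lb
  have hh := (la.add lb).hasSum.cexp.tprod_eq
  unfold logThetaCheck thetaCheck
  rw [Complex.exp_add, Complex.exp_log (key z h2), ← hh]
  congr 1
  refine tprod_congr fun m => ?_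
  simp only [Function.comp, Complex.exp_add, Complex.exp_log (na m), Complex.exp_log (nb m)]

end EllipticCS

end

/-! ### Theta functions: holomorphy, quasi-periodicity, zeros, reality on the real line. -/

noncomputable section

namespace EllipticCS

open Complex Filter Topology

variable {β : ℝ}

/-! Besides the `N` particles of mass `1` and the `Ñ` particles of mass `-1/λ`, adjoin an auxiliary
particle of mass `-1` at a complex position `y`, with `ξ = e^{iy}`. Up to constants and a plane
wave, `Psi0` times `kernel` is the product over all pairs of `θ(r_a - r_b)^{λ m_a m_b}`. The total
mass is `N - Ñ/λ - 1`, and `λ = Ñ/(N-1)` is exactly the condition that it vanishes.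

Let `φ = θ'/θ`, so that `V = -φ'` (`V_eq_neg_deriv_phi`). Applying `∑ m_a⁻¹ ∂_a²` to this product
yields three-body terms `φ(r_a - r_b) φ(r_a - r_c)`. The addition formula `phi_addition`, a
consequence of Liouville's theorem, trades their cyclic sums for two-body terms; those involving
`φ²` drop out because the total mass is zero (`sum_mul_sq_sum_eq`, `sum_inv_mul_eq`). What remains
is a pair potential with coefficient `λ (m_a + m_b)(1 - λ m_a m_b)` in front of `φ'`, plus a
multiple of `c₀`. For pairs containing the auxiliary particle this coefficient is zero: either `m_a
+ m_b = 0` or `λ m_a m_b = 1`. Hence `∑ ∂_x² - λ ∑ ∂_x̃² - ∂_y²` acts on the product as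
multiplication by a constant plus the potential of `H` (`sum_secondLogDeriv`).

Multiplying by `ξ^n` and integrating over a period in `y` gives `Psi`. Two integrations by parts
turn `∂_y²` into `-n²` (`integral_secondLogDerivY`), which is the eigenvalue equation `H_Psi`.
Independence of the radius is Cauchy's theorem on an annulus.

For non-vanishing, view the integral as a function of a single `x̃_J`. It is the convolution of `θ̌`
on a horizontal line with a nowhere zero periodic function. All Fourier coefficients of `θ̌` there
are nonzero, since quasi-periodicity ties each to the next, so the convolution is not identically
zero (`exists_Psi_ne_zero`). -/

lemma nome_pos (β : ℝ) : 0 < nome β := Real.exp_pos _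

lemma nome_lt_one (hβ : 0 < β) : nome β < 1 := by
  unfold nome; rw [Real.exp_lt_one_iff]; linarith

lemma nome_sq_lt_one (hβ : 0 < β) : nome β ^ 2 < 1 := by
  have := nome_pos β
  have := nome_lt_one hβ
  nlinarith

lemma nome_sq_eq_exp (β : ℝ) : nome β ^ 2 = Real.exp (-β) := by
  rw [nome, ← Real.exp_nat_mul]; congr 1; push_cast; ring

lemma ofReal_nome_pow_eq_exp (β : ℝ) (m : ℕ) :
    (nome β : ℂ) ^ (2 * m) = cexp (-(β * m)) := by
  rw [pow_mul, ← ofReal_pow, nome_sq_eq_exp, ofReal_exp, ← Complex.exp_nat_mul]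
  congr 1; push_cast; ring

lemma norm_ofReal_nome_pow (β : ℝ) (k : ℕ) : ‖(nome β : ℂ) ^ k‖ = nome β ^ k := by
  rw [norm_pow, Complex.norm_real, Real.norm_of_nonneg (nome_pos β).le]

lemma summable_nome_pow (hβ : 0 < β) : Summable fun m : ℕ => nome β ^ (2 * (m + 1)) := by
  have := (summable_geometric_of_lt_one (sq_nonneg (nome β)) (nome_sq_lt_one hβ)).mul_left
    (nome β ^ 2)
  refine this.congr fun m => ?_
  ring

lemma nome_pow_le_sq (hβ : 0 < β) (m : ℕ) : nome β ^ (2 * (m + 1)) ≤ nome β ^ 2 :=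
  pow_le_pow_of_le_one (nome_pos β).le (nome_lt_one hβ).le (by omega)

/-- The infinite product in `theta`. -/
def thetaProd (β : ℝ) (r : ℂ) : ℂ :=
  ∏' m : ℕ, (1 - 2 * (nome β : ℂ) ^ (2 * (m + 1)) * Complex.cos r
      + (nome β : ℂ) ^ (4 * (m + 1)))

lemma theta_eq (β : ℝ) (r : ℂ) : theta β r = sin (r / 2) * thetaProd β r := rfl

/-- The deviation of the factors of `thetaProd` from `1`. -/
def thetaDev (β : ℝ) (m : ℕ) (r : ℂ) : ℂ :=
  -2 * (nome β : ℂ) ^ (2 * (m + 1)) * cos r + (nome β : ℂ) ^ (4 * (m + 1))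

lemma thetaProd_eq (β : ℝ) (r : ℂ) : thetaProd β r = ∏' m : ℕ, (1 + thetaDev β m r) := by
  unfold thetaProd thetaDev
  exact tprod_congr fun m => by ring

lemma norm_thetaDev_le (hβ : 0 < β) {M : ℝ} {r : ℂ} (h : ‖cos r‖ ≤ M) (m : ℕ) :
    ‖thetaDev β m r‖ ≤ (2 * M + 1) * nome β ^ (2 * (m + 1)) := by
  have h0 := nome_pos β
  have h1 : nome β ^ (4 * (m + 1)) ≤ nome β ^ (2 * (m + 1)) :=
    pow_le_pow_of_le_one h0.le (nome_lt_one hβ).le (by omega)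
  have hp : 0 < nome β ^ (2 * (m + 1)) := by positivity
  unfold thetaDev
  refine (norm_add_le _ _).trans ?_
  rw [norm_mul, norm_mul, norm_ofReal_nome_pow, norm_ofReal_nome_pow]
  simp only [norm_neg, Complex.norm_ofNat]
  nlinarith

lemma differentiable_thetaDev (β : ℝ) (m : ℕ) : Differentiable ℂ (thetaDev β m) := by
  unfold thetaDev; fun_prop

lemma isOpen_norm_cos_lt (M : ℝ) : IsOpen {r : ℂ | ‖cos r‖ < M} :=
  isOpen_lt (by fun_prop) continuous_const

/-- The factors depend on `r` only through `cos r`, so on a set where `cos r` is bounded one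
geometric series dominates all deviations. -/
lemma hasProdLocallyUniformlyOn_thetaProd (hβ : 0 < β) (M : ℝ) :
    HasProdLocallyUniformlyOn (fun m r => 1 + thetaDev β m r) (fun r => ∏' m, (1 + thetaDev β m r))
      {r : ℂ | ‖cos r‖ < M} :=
  Summable.hasProdLocallyUniformlyOn_nat_one_add (isOpen_norm_cos_lt M)
    ((summable_nome_pow hβ).mul_left (2 * M + 1))
    (Eventually.of_forall fun m _ hr => norm_thetaDev_le hβ (le_of_lt hr) m)
    fun m => (differentiable_thetaDev β m).continuous.continuousOn

lemma differentiable_thetaProd (hβ : 0 < β) : Differentiable ℂ (thetaProd β) := by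
  intro r
  have h : DifferentiableOn ℂ (thetaProd β) {w : ℂ | ‖cos w‖ < ‖cos r‖ + 1} := by
    rw [funext (thetaProd_eq β)]
    refine (hasProdLocallyUniformlyOn_thetaProd hβ _).differentiableOn
      (Eventually.of_forall fun s => ?_) (isOpen_norm_cos_lt _)
    have := fun m => (differentiable_thetaDev β m).differentiableOn (s := {w | ‖cos w‖ < ‖cos r‖ + 1})
    fun_prop
  exact h.differentiableAt ((isOpen_norm_cos_lt _).mem_nhds (by simp))

lemma differentiable_theta (hβ : 0 < β) : Differentiable ℂ (theta β) := by
  have := differentiable_thetaProd hβ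
  rw [funext (theta_eq β)]
  fun_prop

lemma summable_norm_thetaDev (hβ : 0 < β) (r : ℂ) : Summable fun m => ‖thetaDev β m r‖ :=
  Summable.of_nonneg_of_le (fun _ => norm_nonneg _) (norm_thetaDev_le hβ le_rfl)
    ((summable_nome_pow hβ).mul_left _)

lemma one_add_thetaDev_eq (β : ℝ) (m : ℕ) (r : ℂ) :
    1 + thetaDev β m r = (1 - (nome β : ℂ) ^ (2 * (m + 1)) * cexp (I * r)) *
      (1 - (nome β : ℂ) ^ (2 * (m + 1)) / cexp (I * r)) := by
  have h : cexp (I * r) ≠ 0 := Complex.exp_ne_zero _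
  have e : cexp (-r * I) = (cexp (I * r))⁻¹ := by rw [← Complex.exp_neg]; congr 1; ring
  rw [thetaDev, Complex.cos, e, show r * I = I * r by ring]
  field_simp
  ring

/-- This is the bridge between the two theta functions. The factor `e^{ir/2}` is the source of every
later `I / 2`. -/
lemma thetaCheck_exp (β : ℝ) (r : ℂ) :
    thetaCheck β (cexp (I * r)) = -2 * I * cexp (I * r / 2) * theta β r := by
  rw [thetaCheck, theta_eq, thetaProd_eq, tprod_congr fun m => one_add_thetaDev_eq β m r,
    ← mul_assoc]
  congr 1
  rw [Complex.sin, show -(r / 2) * I = -(I * r / 2) by ring, show r / 2 * I = I * r / 2 by ring,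
    show cexp (I * r) = cexp (I * r / 2) * cexp (I * r / 2) by rw [← Complex.exp_add]; congr 1; ring,
    Complex.exp_neg]
  have h : cexp (I * r / 2) ≠ 0 := Complex.exp_ne_zero _
  field_simp
  rw [I_sq]
  ring

lemma summable_nome_pow_mul (hβ : 0 < β) (z : ℂ) :
    Summable fun m : ℕ => ‖-((nome β : ℂ) ^ (2 * (m + 1)) * z)‖ := by
  simp only [norm_neg, norm_mul, norm_ofReal_nome_pow]
  exact (summable_nome_pow hβ).mul_right _

lemma multipliable_one_sub_nome_pow_mul (hβ : 0 < β) (z : ℂ) :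
    Multipliable fun m : ℕ => 1 - (nome β : ℂ) ^ (2 * (m + 1)) * z := by
  simpa [sub_eq_add_neg] using multipliable_one_add_of_summable (summable_nome_pow_mul hβ z)

lemma tprod_one_sub_nome_pow_mul (hβ : 0 < β) (z : ℂ) :
    ∏' m : ℕ, (1 - (nome β : ℂ) ^ (2 * (m + 1)) * z) = (1 - (nome β : ℂ) ^ 2 * z) *
      ∏' m : ℕ, (1 - (nome β : ℂ) ^ (2 * (m + 1)) * ((nome β : ℂ) ^ 2 * z)) := by
  have h : ∀ m : ℕ, 1 - (nome β : ℂ) ^ (2 * (m + 1)) * ((nome β : ℂ) ^ 2 * z) =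
      1 - (nome β : ℂ) ^ (2 * (m + 1 + 1)) * z := fun m => by ring
  have hm := multipliable_one_sub_nome_pow_mul hβ ((nome β : ℂ) ^ 2 * z)
  have e := tprod_eq_zero_mul' (f := fun m : ℕ => 1 - (nome β : ℂ) ^ (2 * (m + 1)) * z)
    (hm.congr h)
  rw [e, tprod_congr h]

lemma thetaCheck_eq (hβ : 0 < β) (z : ℂ) :
    thetaCheck β z = (1 - z) * ((∏' m : ℕ, (1 - (nome β : ℂ) ^ (2 * (m + 1)) * z)) *
      ∏' m : ℕ, (1 - (nome β : ℂ) ^ (2 * (m + 1)) * z⁻¹)) := by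
  rw [thetaCheck, ← (multipliable_one_sub_nome_pow_mul hβ z).tprod_mul
    (multipliable_one_sub_nome_pow_mul hβ z⁻¹)]
  simp only [div_eq_mul_inv]

/-- Multiplying `z` by `q²` shifts the index in both products: one loses its first factor and the
other gains one. -/
lemma thetaCheck_nome_sq_mul (hβ : 0 < β) {z : ℂ} (hz : z ≠ 0) :
    thetaCheck β ((nome β : ℂ) ^ 2 * z) = -thetaCheck β z / z := by
  have hq : (nome β : ℂ) ≠ 0 := by exact_mod_cast (nome_pos β).ne'
  rw [thetaCheck_eq hβ, thetaCheck_eq hβ z, tprod_one_sub_nome_pow_mul hβ z,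
    tprod_one_sub_nome_pow_mul hβ ((nome β : ℂ) ^ 2 * z)⁻¹,
    show (nome β : ℂ) ^ 2 * ((nome β : ℂ) ^ 2 * z)⁻¹ = z⁻¹ by field_simp]
  field_simp
  ring

lemma theta_neg (β : ℝ) (r : ℂ) : theta β (-r) = -theta β r := by
  simp [theta, neg_div]

lemma theta_zero (β : ℝ) : theta β 0 = 0 := by simp [theta]

lemma theta_add_two_pi (β : ℝ) (r : ℂ) : theta β (r + 2 * Real.pi) = -theta β r := by
  have : (r + 2 * Real.pi) / 2 = r / 2 + Real.pi := by ring
  rw [theta, theta, this, Complex.sin_add_pi, Complex.cos_add_two_pi]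
  ring

lemma theta_add_I_mul (hβ : 0 < β) (r : ℂ) :
    theta β (r + I * β) = -(cexp (β / 2) * cexp (-(I * r))) * theta β r := by
  have h1 : cexp (I * (r + I * β)) = (nome β : ℂ) ^ 2 * cexp (I * r) := by
    have := ofReal_nome_pow_eq_exp β 1
    rw [mul_one] at this
    rw [this, ← Complex.exp_add]
    congr 1
    linear_combination (β : ℂ) * I_mul_I
  have h2 := thetaCheck_nome_sq_mul hβ (Complex.exp_ne_zero (I * r))
  rw [← h1, thetaCheck_exp, thetaCheck_exp] at h2
  have h3 : cexp (I * (r + I * β) / 2) = cexp (I * r / 2) * (cexp (β / 2))⁻¹ := by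
    rw [← Complex.exp_neg, ← Complex.exp_add]
    congr 1
    linear_combination (β / 2 : ℂ) * I_mul_I
  rw [h3] at h2
  rw [Complex.exp_neg]
  have e1 : cexp (I * r / 2) ≠ 0 := Complex.exp_ne_zero _
  have e2 : cexp (I * r) ≠ 0 := Complex.exp_ne_zero _
  have e3 : cexp (β / 2 : ℂ) ≠ 0 := Complex.exp_ne_zero _
  have e4 : I ≠ 0 := I_ne_zero
  field_simp at h2 ⊢
  linear_combination -h2

lemma thetaProd_ne_zero (hβ : 0 < β) {r : ℂ} (h : ∀ m, 1 + thetaDev β m r ≠ 0) :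
    thetaProd β r ≠ 0 := by
  rw [thetaProd_eq]
  exact tprod_one_add_ne_zero_of_summable h (summable_norm_thetaDev hβ r)

/-- A convergent product vanishes only if some factor does. The sine gives the real lattice points,
and the factors with `e^{ir}` and `e^{-ir}` give the rows below and above the real axis. -/
lemma exists_int_of_theta_eq_zero (hβ : 0 < β) {r : ℂ} (h : theta β r = 0) :
    ∃ n m : ℤ, r = 2 * Real.pi * n + I * β * m := by
  rcases mul_eq_zero.mp ((theta_eq β r).symm.trans h) with h | h
  · obtain ⟨k, hk⟩ := Complex.sin_eq_zero_iff.mp h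
    exact ⟨k, 0, by push_cast; linear_combination 2 * hk⟩
  · have : ∃ m, 1 + thetaDev β m r = 0 := by
      by_contra! hc
      exact thetaProd_ne_zero hβ hc h
    obtain ⟨m, hm⟩ := this
    rw [one_add_thetaDev_eq, ofReal_nome_pow_eq_exp] at hm
    rcases mul_eq_zero.mp hm with hm | hm
    · rw [← Complex.exp_add, sub_eq_zero, eq_comm, Complex.exp_eq_one_iff] at hm
      obtain ⟨n, hn⟩ := hm
      refine ⟨n, -(m + 1 : ℤ), ?_⟩
      push_cast at hn ⊢
      linear_combination (-I) * hn + (r - 2 * Real.pi * n) * I_mul_I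
    · rw [← Complex.exp_sub, sub_eq_zero, eq_comm, Complex.exp_eq_one_iff] at hm
      obtain ⟨n, hn⟩ := hm
      refine ⟨-n, (m + 1 : ℤ), ?_⟩
      push_cast at hn ⊢
      linear_combination (I) * hn + (2 * Real.pi * n + r) * I_mul_I

lemma theta_eq_zero_of_abs_im_lt (hβ : 0 < β) {r : ℂ} (hr : |r.im| < β) (h : theta β r = 0) :
    ∃ n : ℤ, r = 2 * Real.pi * n := by
  obtain ⟨n, m, rfl⟩ := exists_int_of_theta_eq_zero hβ h
  have him : (2 * Real.pi * n + I * β * m : ℂ).im = β * m := by simp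
  rw [him, abs_mul, abs_of_pos hβ] at hr
  have : |(m : ℝ)| < 1 := by
    by_contra! hc
    nlinarith
  have hm : m = 0 := by
    have : |m| < 1 := by exact_mod_cast this
    exact Int.abs_lt_one_iff.mp this
  exact ⟨n, by simp [hm]⟩

lemma theta_ne_zero_of_im_mem (hβ : 0 < β) {r : ℂ} (h0 : 0 < r.im) (h1 : r.im < β) :
    theta β r ≠ 0 := fun h => by
  obtain ⟨n, rfl⟩ := theta_eq_zero_of_abs_im_lt hβ (by rwa [abs_of_pos h0]) h
  simp at h0

lemma theta_ofReal_ne_zero (hβ : 0 < β) {r : ℝ} (h : ∀ m : ℤ, r ≠ 2 * Real.pi * m) :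
    theta β r ≠ 0 := fun h0 => by
  obtain ⟨n, hn⟩ := theta_eq_zero_of_abs_im_lt hβ (by simpa using hβ) h0
  exact h n (by exact_mod_cast hn)

/-- The restriction of `theta` to the real line, as a real function. -/
def thetaReal (β : ℝ) (r : ℝ) : ℝ := (theta β r).re

/-- Conjugation fixes every factor and passes through the product by continuity. Thus the powers in
`Psi0` have real bases, which makes them smooth off the zeros despite the branch cut. -/
lemma ofReal_thetaReal (hβ : 0 < β) (r : ℝ) : (thetaReal β r : ℂ) = theta β r := by
  rw [thetaReal, ← Complex.conj_eq_iff_re, theta_eq, map_mul, ← Complex.sin_conj, thetaProd_eq]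
  have hm : Multipliable fun m => 1 + thetaDev β m r :=
    multipliable_one_add_of_summable (summable_norm_thetaDev hβ r)
  rw [hm.map_tprod (starRingEnd ℂ) Complex.continuous_conj]
  congr 1
  · congr 1
    simp [map_ofNat]
  · refine tprod_congr fun m => ?_
    simp [thetaDev, ← Complex.cos_conj, map_ofNat]

end EllipticCS
end

/-! ### The logarithmic derivative of theta, its relation to `V`, and its Laurent expansion. -/

noncomputable section

namespace EllipticCS

open Complex Filter Topology

variable {β : ℝ}

/-- The logarithmic derivative of `theta`. -/
def phi (β : ℝ) : ℂ → ℂ := logDeriv (theta β)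

lemma phi_apply (β : ℝ) (r : ℂ) : phi β r = deriv (theta β) r / theta β r := rfl

lemma hasDerivAt_theta (hβ : 0 < β) {r : ℂ} (h : theta β r ≠ 0) :
    HasDerivAt (theta β) (phi β r * theta β r) r := by
  rw [phi_apply, div_mul_cancel₀ _ h]
  exact (differentiable_theta hβ r).hasDerivAt

lemma analyticAt_phi (hβ : 0 < β) {r : ℂ} (h : theta β r ≠ 0) : AnalyticAt ℂ (phi β) r := by
  have := (differentiable_theta hβ).analyticAt r
  exact this.deriv.div this h

lemma hasDerivAt_phi (hβ : 0 < β) {r : ℂ} (h : theta β r ≠ 0) :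
    HasDerivAt (phi β) (deriv (phi β) r) r :=
  (analyticAt_phi hβ h).differentiableAt.hasDerivAt

lemma phi_neg (β : ℝ) (r : ℂ) : phi β (-r) = -phi β r := by
  have h : deriv (theta β) (-r) = deriv (theta β) r := by
    have h1 : deriv (fun x => theta β (-x)) r = deriv (fun x => -theta β x) r := by
      simp only [theta_neg]
    rw [deriv_comp_neg, deriv.fun_neg] at h1
    exact neg_injective h1
  rw [phi_apply, phi_apply, h, theta_neg, div_neg]

lemma deriv_phi_neg (β : ℝ) (r : ℂ) : deriv (phi β) (-r) = deriv (phi β) r := by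
  have h1 : deriv (fun x => phi β (-x)) r = deriv (fun x => -phi β x) r := by
    simp only [phi_neg]
  rw [deriv_comp_neg, deriv.fun_neg] at h1
  exact neg_injective h1

/-- Division by `theta β 0 = 0` returns zero at the pole; sums over all particles may therefore
include the self-interaction term. -/
lemma phi_zero (β : ℝ) : phi β 0 = 0 := by simp [phi_apply, theta_zero]

lemma phi_add_two_pi (β : ℝ) (r : ℂ) : phi β (r + 2 * Real.pi) = phi β r := by
  have h : deriv (theta β) (r + 2 * Real.pi) = -deriv (theta β) r := by
    rw [← deriv_comp_add_const, ← deriv.fun_neg]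
    simp only [theta_add_two_pi]
  rw [phi_apply, phi_apply, h, theta_add_two_pi, neg_div_neg_eq]

/-- The `-I` is the logarithmic derivative of the multiplier `e^{-ir}` of `theta`. -/
lemma phi_add_I_mul (hβ : 0 < β) {r : ℂ} (h : theta β r ≠ 0) :
    phi β (r + I * β) = phi β r - I := by
  have h1 : phi β (r + I * β) = logDeriv (fun x => theta β (x + I * β)) r := by
    rw [phi_apply, logDeriv_apply, deriv_comp_add_const]
  have h2 : (fun x => theta β (x + I * β)) =
      fun x => -(cexp (β / 2) * cexp (-(I * x))) * theta β x :=
    funext fun x => theta_add_I_mul hβ x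
  have h3 : HasDerivAt (fun x : ℂ => cexp (-(I * x))) (cexp (-(I * r)) * (-(I * 1))) r :=
    (((hasDerivAt_id r).const_mul I).neg).cexp
  have h4 := ((h3.const_mul (cexp (β / 2))).neg).mul (hasDerivAt_theta hβ h)
  rw [h1, h2, logDeriv_apply]
  erw [h4.deriv]
  have e1 : cexp (-(I * r)) ≠ 0 := Complex.exp_ne_zero _
  have e2 : cexp (β / 2 : ℂ) ≠ 0 := Complex.exp_ne_zero _
  simp only [Pi.neg_apply]
  field_simp
  ring

lemma eventually_theta_ne_zero (hβ : 0 < β) {r : ℂ} (h : theta β r ≠ 0) :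
    ∀ᶠ w in 𝓝 r, theta β w ≠ 0 :=
  (differentiable_theta hβ).continuous.continuousAt.eventually_ne h

lemma deriv_phi_add_two_pi (β : ℝ) (r : ℂ) :
    deriv (phi β) (r + 2 * Real.pi) = deriv (phi β) r := by
  rw [← deriv_comp_add_const]
  simp only [phi_add_two_pi]

lemma deriv_phi_add_I_mul (hβ : 0 < β) {r : ℂ} (h : theta β r ≠ 0) :
    deriv (phi β) (r + I * β) = deriv (phi β) r := by
  rw [← deriv_comp_add_const]
  have : (fun x => phi β (x + I * β)) =ᶠ[𝓝 r] fun x => phi β x - I := by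
    filter_upwards [eventually_theta_ne_zero hβ h] with w hw using phi_add_I_mul hβ hw
  rw [this.deriv_eq, deriv_sub_const]

/-- The strip around the real line on which the logarithmic derivatives of the factors of
`thetaProd` are summable uniformly. -/
def strip (β : ℝ) : Set ℂ := {r | |r.im| < β / 2}

lemma isOpen_strip (β : ℝ) : IsOpen (strip β) :=
  isOpen_lt (by fun_prop) continuous_const

lemma neg_mem_strip {r : ℂ} (hr : r ∈ strip β) : -r ∈ strip β := by
  simpa [strip] using hr

lemma ofReal_mem_strip (hβ : 0 < β) (r : ℝ) : (r : ℂ) ∈ strip β := by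
  simpa [strip] using hβ

/-- In the strip `|Im r| < β/2` the exponential costs at most one factor `1/q`. -/
lemma norm_nome_pow_mul_exp_le {r : ℂ} (hr : r ∈ strip β) (m : ℕ) :
    ‖(nome β : ℂ) ^ (2 * (m + 1)) * cexp (I * r)‖ ≤ nome β ^ (2 * m + 1) := by
  have h : ‖cexp (I * r)‖ ≤ (nome β)⁻¹ := by
    rw [Complex.norm_exp, nome, ← Real.exp_neg, Real.exp_le_exp]
    have hr' : |r.im| < β / 2 := hr
    have := (abs_lt.mp hr').1
    simp
    linarith
  rw [norm_mul, norm_ofReal_nome_pow]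
  have h0 := nome_pos β
  calc nome β ^ (2 * (m + 1)) * ‖cexp (I * r)‖
      ≤ nome β ^ (2 * (m + 1)) * (nome β)⁻¹ := by gcongr
    _ = nome β ^ (2 * m + 1) := by field_simp; ring

lemma nome_pow_odd_le (hβ : 0 < β) (m : ℕ) : nome β ^ (2 * m + 1) ≤ nome β := by
  simpa using pow_le_pow_of_le_one (nome_pos β).le (nome_lt_one hβ).le (show 1 ≤ 2 * m + 1 by omega)

lemma one_sub_nome_le_norm (hβ : 0 < β) {r : ℂ} (hr : r ∈ strip β) (m : ℕ) :
    1 - nome β ≤ ‖1 - (nome β : ℂ) ^ (2 * (m + 1)) * cexp (I * r)‖ := by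
  have h1 := norm_sub_norm_le (1 : ℂ) ((nome β : ℂ) ^ (2 * (m + 1)) * cexp (I * r))
  rw [norm_one] at h1
  have h2 := norm_nome_pow_mul_exp_le hr m
  have h3 := nome_pow_odd_le hβ m
  linarith

lemma one_sub_nome_pow_mul_exp_ne_zero (hβ : 0 < β) {r : ℂ} (hr : r ∈ strip β) (m : ℕ) :
    1 - (nome β : ℂ) ^ (2 * (m + 1)) * cexp (I * r) ≠ 0 := by
  rw [← norm_pos_iff]
  have := one_sub_nome_le_norm hβ hr m
  have := nome_lt_one hβ
  linarith

/-- The logarithmic derivative of `1 - q ^ (2 (m + 1)) exp (i r)`. -/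
def lambertTerm (β : ℝ) (m : ℕ) (r : ℂ) : ℂ :=
  -I * ((nome β : ℂ) ^ (2 * (m + 1)) * cexp (I * r)) /
    (1 - (nome β : ℂ) ^ (2 * (m + 1)) * cexp (I * r))

lemma hasDerivAt_nome_pow_mul_exp (β : ℝ) (m : ℕ) (r : ℂ) :
    HasDerivAt (fun r => (nome β : ℂ) ^ (2 * (m + 1)) * cexp (I * r))
      ((nome β : ℂ) ^ (2 * (m + 1)) * (cexp (I * r) * (I * 1))) r :=
  (((hasDerivAt_id r).const_mul I).cexp).const_mul _

/-- With `w = (r + iβ(m+1))/2` one has `q^{2(m+1)} e^{ir} = e^{2iw}`, and the derivative `e^{2iw}/(1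
- e^{2iw})²` is `-1/(4 sin² w)`: one term of the series for `V`. -/
lemma hasDerivAt_lambertTerm (hβ : 0 < β) {r : ℂ} (hr : r ∈ strip β) (m : ℕ) :
    HasDerivAt (lambertTerm β m)
      (-(1 / (4 * sin ((r + I * β * (m + 1 : ℕ)) / 2) ^ 2))) r := by
  have h0 := one_sub_nome_pow_mul_exp_ne_zero hβ hr m
  have h := ((hasDerivAt_nome_pow_mul_exp β m r).const_mul (-I)).div
    ((hasDerivAt_nome_pow_mul_exp β m r).const_sub 1) h0
  refine h.congr_deriv ?_
  rw [ofReal_nome_pow_eq_exp, ← Complex.exp_add] at h0 ⊢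
  have e : cexp (-(β * (m + 1 : ℕ)) + I * r) =
      cexp (I * ((r + I * β * (m + 1 : ℕ)) / 2)) ^ 2 := by
    rw [← Complex.exp_nat_mul]
    congr 1
    push_cast
    linear_combination (-β * (m + 1) : ℂ) * I_mul_I
  have e' : cexp (-(β * (m + 1 : ℕ))) * (cexp (I * r) * (I * 1)) =
      I * cexp (I * ((r + I * β * (m + 1 : ℕ)) / 2)) ^ 2 := by
    rw [← e, Complex.exp_add]; ring
  rw [e', e]
  rw [e] at h0
  set w := (r + I * β * (m + 1 : ℕ)) / 2
  rw [Complex.sin, show -w * I = -(I * w) by ring, show w * I = I * w by ring, Complex.exp_neg]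
  have hw : cexp (I * w) ≠ 0 := Complex.exp_ne_zero _
  have h1 : cexp (I * w) ^ 2 - 1 ≠ 0 := fun h => h0 (by linear_combination -h)
  have h2 : (cexp (I * w))⁻¹ - cexp (I * w) ≠ 0 := fun h => h0 (by field_simp at h; simpa using h)
  have h3 : 1 - cexp (I * w) ^ 2 ≠ 0 := h0
  field_simp
  rw [I_pow_four]
  ring

lemma summable_nome_pow_odd (hβ : 0 < β) : Summable fun m : ℕ => nome β ^ (2 * m + 1) := by
  have := (summable_geometric_of_lt_one (sq_nonneg (nome β)) (nome_sq_lt_one hβ)).mul_left (nome β)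
  exact this.congr fun m => by ring

lemma norm_lambertTerm_le (hβ : 0 < β) {r : ℂ} (hr : r ∈ strip β) (m : ℕ) :
    ‖lambertTerm β m r‖ ≤ nome β ^ (2 * m + 1) / (1 - nome β) := by
  rw [lambertTerm, norm_div, norm_mul, norm_neg, norm_I, one_mul]
  have := nome_lt_one hβ
  have := nome_pos β
  exact div_le_div₀ (by positivity) (norm_nome_pow_mul_exp_le hr m) (by linarith)
    (one_sub_nome_le_norm hβ hr m)

/-- The sum of the logarithmic derivatives of `1 - q ^ (2 (m + 1)) exp (i r)` for `m ≥ 0`. -/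
def lambertSum (β : ℝ) (r : ℂ) : ℂ := ∑' m, lambertTerm β m r

lemma differentiableOn_lambertTerm (hβ : 0 < β) (m : ℕ) :
    DifferentiableOn ℂ (lambertTerm β m) (strip β) := fun _ hr =>
  (hasDerivAt_lambertTerm hβ hr m).differentiableAt.differentiableWithinAt

lemma differentiableOn_lambertSum (hβ : 0 < β) :
    DifferentiableOn ℂ (lambertSum β) (strip β) :=
  differentiableOn_tsum_of_summable_norm ((summable_nome_pow_odd hβ).div_const _)
    (differentiableOn_lambertTerm hβ) (isOpen_strip β)
    fun m _ hr => norm_lambertTerm_le hβ hr m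

lemma hasSum_deriv_lambertSum (hβ : 0 < β) {r : ℂ} (hr : r ∈ strip β) :
    HasSum (fun m : ℕ => -(1 / (4 * sin ((r + I * β * (m + 1 : ℕ)) / 2) ^ 2)))
      (deriv (lambertSum β) r) := by
  have := hasSum_deriv_of_summable_norm ((summable_nome_pow_odd hβ).div_const _)
    (differentiableOn_lambertTerm hβ) (isOpen_strip β)
    (fun m _ hr => norm_lambertTerm_le hβ hr m) hr
  exact this.congr_fun fun m => ((hasDerivAt_lambertTerm hβ hr m).deriv).symm

lemma one_add_thetaDev_eq' (β : ℝ) (m : ℕ) (r : ℂ) :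
    1 + thetaDev β m r = (1 - (nome β : ℂ) ^ (2 * (m + 1)) * cexp (I * r)) *
      (1 - (nome β : ℂ) ^ (2 * (m + 1)) * cexp (I * -r)) := by
  rw [one_add_thetaDev_eq, mul_neg, Complex.exp_neg, div_eq_mul_inv]

lemma one_add_thetaDev_ne_zero (hβ : 0 < β) {r : ℂ} (hr : r ∈ strip β) (m : ℕ) :
    1 + thetaDev β m r ≠ 0 := by
  rw [one_add_thetaDev_eq']
  exact mul_ne_zero (one_sub_nome_pow_mul_exp_ne_zero hβ hr m)
    (one_sub_nome_pow_mul_exp_ne_zero hβ (neg_mem_strip hr) m)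

lemma logDeriv_one_add_thetaDev (hβ : 0 < β) {r : ℂ} (hr : r ∈ strip β) (m : ℕ) :
    logDeriv (fun r => 1 + thetaDev β m r) r = lambertTerm β m r - lambertTerm β m (-r) := by
  have h1 := one_sub_nome_pow_mul_exp_ne_zero hβ hr m
  have h2 := one_sub_nome_pow_mul_exp_ne_zero hβ (neg_mem_strip hr) m
  have d1 := (hasDerivAt_nome_pow_mul_exp β m r).const_sub 1
  have d2 : HasDerivAt (fun r => 1 - (nome β : ℂ) ^ (2 * (m + 1)) * cexp (I * -r)) _ r :=
    ((((hasDerivAt_neg r).const_mul I).cexp).const_mul _).const_sub 1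
  simp only [one_add_thetaDev_eq']
  rw [logDeriv_apply]
  erw [(d1.mul d2).deriv]
  simp only [lambertTerm]
  generalize cexp (I * -r) = E at h2 ⊢
  field_simp
  ring

lemma logDeriv_thetaProd (hβ : 0 < β) {r : ℂ} (hr : r ∈ strip β) :
    logDeriv (thetaProd β) r = lambertSum β r - lambertSum β (-r) := by
  have s1 : Summable fun m => lambertTerm β m r := Summable.of_norm_bounded
    ((summable_nome_pow_odd hβ).div_const _) fun m => norm_lambertTerm_le hβ hr m
  have s2 : Summable fun m => lambertTerm β m (-r) := Summable.of_norm_bounded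
    ((summable_nome_pow_odd hβ).div_const _) fun m => norm_lambertTerm_le hβ (neg_mem_strip hr) m
  have hl := fun m => logDeriv_one_add_thetaDev hβ hr m
  rw [funext (thetaProd_eq β), lambertSum, lambertSum, ← s1.tsum_sub s2,
    ← tsum_congr hl]
  refine logDeriv_tprod_eq_tsum (isOpen_norm_cos_lt (‖cos r‖ + 1)) (by simp)
    (one_add_thetaDev_ne_zero hβ hr)
    (fun m => ((differentiable_const _).add (differentiable_thetaDev β m)).differentiableOn)
    ((s1.sub s2).congr fun m => (hl m).symm) (hasProdLocallyUniformlyOn_thetaProd hβ _).multipliableLocallyUniformlyOn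
    (tprod_one_add_ne_zero_of_summable (one_add_thetaDev_ne_zero hβ hr) (summable_norm_thetaDev hβ r))

lemma thetaProd_ne_zero_of_mem_strip (hβ : 0 < β) {r : ℂ} (hr : r ∈ strip β) :
    thetaProd β r ≠ 0 := thetaProd_ne_zero hβ (one_add_thetaDev_ne_zero hβ hr)

lemma hasDerivAt_logDeriv_thetaProd (hβ : 0 < β) {r : ℂ} (hr : r ∈ strip β) :
    HasDerivAt (logDeriv (thetaProd β)) (deriv (lambertSum β) r + deriv (lambertSum β) (-r)) r := by
  have hs := (isOpen_strip β).mem_nhds hr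
  have hs' := (isOpen_strip β).mem_nhds (neg_mem_strip hr)
  have d1 := ((differentiableOn_lambertSum hβ).differentiableAt hs).hasDerivAt
  have d2 := ((differentiableOn_lambertSum hβ).differentiableAt hs').hasDerivAt
  have d3 := d1.sub (d2.scomp r (hasDerivAt_neg r))
  have : logDeriv (thetaProd β) =ᶠ[𝓝 r] fun r => lambertSum β r - lambertSum β (-r) := by
    filter_upwards [hs] with w hw using logDeriv_thetaProd hβ hw
  refine (d3.congr_of_eventuallyEq this).congr_deriv ?_
  simp

lemma logDeriv_sin_half (r : ℂ) :
    logDeriv (fun r => sin (r / 2)) r = cos (r / 2) / (2 * sin (r / 2)) := by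
  have := ((hasDerivAt_id r).div_const 2).csin
  rw [logDeriv_apply]
  erw [this.deriv]
  simp only [id]
  ring

lemma phi_eq (hβ : 0 < β) {r : ℂ} (hr : r ∈ strip β) (h : sin (r / 2) ≠ 0) :
    phi β r = cos (r / 2) / (2 * sin (r / 2)) + logDeriv (thetaProd β) r := by
  rw [phi, funext (theta_eq β), logDeriv_mul r h (thetaProd_ne_zero_of_mem_strip hβ hr)
    (by fun_prop) (differentiable_thetaProd hβ r), logDeriv_sin_half]

/-- The series for `V` splits by the sign of its index: the cotangent from `sin (r/2)` accounts for
`m = 0`, `lambertSum` at `r` for `m > 0`, and `lambertSum` at `-r` for `m < 0`. -/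
lemma V_eq_neg_deriv_phi (hβ : 0 < β) {r : ℂ} (hr : r ∈ strip β) (h : sin (r / 2) ≠ 0) :
    V β r = -deriv (phi β) r := by
  have c1 : HasDerivAt (fun r : ℂ => cos (r / 2) / (2 * sin (r / 2)))
      (-(1 / (4 * sin (r / 2) ^ 2))) r := by
    have h1 := ((hasDerivAt_id r).div_const 2).csin
    have h2 := ((hasDerivAt_id r).div_const 2).ccos
    refine (h2.div (h1.const_mul 2) (by simpa using h)).congr_deriv ?_
    simp only [id]
    field_simp
    linear_combination (-4 : ℂ) * Complex.sin_sq_add_cos_sq (r / 2)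
  have hev : phi β =ᶠ[𝓝 r]
      fun r => cos (r / 2) / (2 * sin (r / 2)) + logDeriv (thetaProd β) r := by
    have hc : Continuous fun r : ℂ => sin (r / 2) := by fun_prop
    filter_upwards [(isOpen_strip β).mem_nhds hr, hc.continuousAt.eventually_ne h] with w hw hw'
      using phi_eq hβ hw hw'
  rw [hev.deriv_eq, (c1.fun_add (hasDerivAt_logDeriv_thetaProd hβ hr)).deriv]
  have s1 := (hasSum_deriv_lambertSum hβ hr).neg
  have s2 := (hasSum_deriv_lambertSum hβ (neg_mem_strip hr)).neg
  have s3 : HasSum (fun m : ℤ => 1 / (4 * sin ((r + I * β * m) / 2) ^ 2))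
      (-deriv (lambertSum β) r + 1 / (4 * sin ((r + I * β * (0 : ℤ)) / 2) ^ 2) +
        -deriv (lambertSum β) (-r)) := by
    refine HasSum.of_add_one_of_neg_add_one ?_ ?_
    · refine s1.congr_fun fun m => ?_
      push_cast
      ring
    · refine s2.congr_fun fun m => ?_
      rw [neg_neg]
      push_cast
      rw [show (r + I * β * -((m : ℂ) + 1)) / 2 = -((-r + I * β * (m + 1)) / 2) by ring,
        Complex.sin_neg, neg_sq]
  rw [V, s3.tsum_eq]
  simp
  ring

lemma ofReal_c0 (hβ : 0 < β) : (c0 β : ℂ) = 1 / 12 - 2 * deriv (lambertSum β) 0 := by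
  have h := hasSum_deriv_lambertSum hβ (r := 0) (by simpa using ofReal_mem_strip hβ 0)
  rw [c0, ← h.tsum_eq, ← tsum_mul_left]
  push_cast
  congr 1
  refine tsum_congr fun m => ?_
  rw [show (0 + I * β * ((m : ℂ) + 1)) / 2 = (β * (m + 1) / 2) * I by ring, Complex.sin_mul_I,
    mul_pow, I_sq]
  ring

/-- The entire function `sin (r / 2) / r`. -/
def sinQuot : ℂ → ℂ := dslope (fun r => sin (r / 2)) 0

lemma mul_sinQuot (r : ℂ) : r * sinQuot r = sin (r / 2) := by
  have := sub_smul_dslope (fun r : ℂ => sin (r / 2)) 0 r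
  simpa [sinQuot] using this

lemma differentiable_sinQuot : Differentiable ℂ sinQuot := by
  rw [← differentiableOn_univ]
  refine (Complex.differentiableOn_dslope Filter.univ_mem).mpr ?_
  fun_prop

/-- Differentiating `r * sinQuot r = sin (r/2)` up to three times and setting `r = 0` isolates each
Taylor coefficient. -/
lemma sinQuot_taylor : sinQuot 0 = 1 / 2 ∧ deriv sinQuot 0 = 0 ∧
    deriv (deriv sinQuot) 0 = -1 / 24 := by
  have d0 := differentiable_sinQuot
  have d1 : Differentiable ℂ (deriv sinQuot) := d0.deriv
  have d2 : Differentiable ℂ (deriv (deriv sinQuot)) := d1.deriv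
  have e1 : ∀ r : ℂ, sinQuot r + r * deriv sinQuot r = cos (r / 2) / 2 := fun r => by
    have h1 := (hasDerivAt_id r).mul (d0 r).hasDerivAt
    have h2 := ((hasDerivAt_id r).div_const 2).csin
    have : (id * sinQuot : ℂ → ℂ) = fun r => sin (id r / 2) := funext fun r => mul_sinQuot r
    rw [this] at h1
    have := h1.unique h2
    simp only [id] at this
    linear_combination this
  have e2 : ∀ r : ℂ, 2 * deriv sinQuot r + r * deriv (deriv sinQuot) r = -sin (r / 2) / 4 :=
    fun r => by
    have h1 := (d0 r).hasDerivAt.add ((hasDerivAt_id r).mul (d1 r).hasDerivAt)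
    have h2 := (((hasDerivAt_id r).div_const 2).ccos).div_const 2
    have : (sinQuot + id * deriv sinQuot : ℂ → ℂ) = fun r => cos (id r / 2) / 2 :=
      funext fun r => e1 r
    rw [this] at h1
    have := h1.unique h2
    simp only [id] at this
    linear_combination this
  have e3 : ∀ r : ℂ, 3 * deriv (deriv sinQuot) r + r * deriv (deriv (deriv sinQuot)) r =
      -cos (r / 2) / 8 := fun r => by
    have h1 := ((d1 r).hasDerivAt.const_mul 2).add ((hasDerivAt_id r).mul (d2 r).hasDerivAt)
    have h2 := (((hasDerivAt_id r).div_const 2).csin).neg.div_const 4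
    have : ((fun r => 2 * deriv sinQuot r) + id * deriv (deriv sinQuot) : ℂ → ℂ) =
        fun r => -sin (id r / 2) / 4 := funext fun r => e2 r
    rw [this] at h1
    have := h1.unique h2
    simp only [id] at this
    linear_combination this
  refine ⟨by simpa using e1 0, by simpa using e2 0, ?_⟩
  have := e3 0
  simp only [zero_mul, add_zero, zero_div, Complex.cos_zero] at this
  linear_combination this / 3

/-- The Laurent expansion of `phi` at the origin. -/
lemma exists_phi_eq_inv_add (hβ : 0 < β) : ∃ h : ℂ → ℂ, AnalyticAt ℂ h 0 ∧ h 0 = 0 ∧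
    deriv h 0 = -c0 β ∧ ∀ᶠ r in 𝓝[≠] 0, phi β r = r⁻¹ + h r := by
  obtain ⟨t0, t1, t2⟩ := sinQuot_taylor
  have m0 : (0 : ℂ) ∈ strip β := by simpa using ofReal_mem_strip hβ 0
  have a1 : AnalyticAt ℂ (logDeriv sinQuot) 0 := by
    have := differentiable_sinQuot.analyticAt 0
    exact this.deriv.div this (by rw [t0]; norm_num)
  have a2 : AnalyticAt ℂ (logDeriv (thetaProd β)) 0 := by
    have := (differentiable_thetaProd hβ).analyticAt 0
    exact this.deriv.div this (thetaProd_ne_zero_of_mem_strip hβ m0)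
  -- Writing `θ = r · sinQuot · thetaProd` splits off the pole. The derivative at the origin is
  -- `-1/12` from the sine plus `2 lambertSum'(0)` from the product, that is `-c₀`.
  refine ⟨fun r => logDeriv sinQuot r + logDeriv (thetaProd β) r, a1.add a2, ?_, ?_, ?_⟩
  · simp [logDeriv_thetaProd hβ m0, logDeriv_apply, t1]
  · have d1 : HasDerivAt (logDeriv sinQuot) _ 0 :=
      (differentiable_sinQuot.deriv 0).hasDerivAt.div (differentiable_sinQuot 0).hasDerivAt
        (by rw [t0]; norm_num)
    rw [(d1.fun_add (hasDerivAt_logDeriv_thetaProd hβ m0)).deriv, t0, t1, t2, ofReal_c0 hβ, neg_zero]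
    ring
  · have hs : ∀ᶠ r : ℂ in 𝓝[≠] 0, r ∈ strip β :=
      nhdsWithin_le_nhds ((isOpen_strip β).mem_nhds m0)
    have hq : ∀ᶠ r : ℂ in 𝓝[≠] 0, sinQuot r ≠ 0 := nhdsWithin_le_nhds
      (differentiable_sinQuot.continuous.continuousAt.eventually_ne (by rw [t0]; norm_num))
    filter_upwards [hs, hq, self_mem_nhdsWithin] with r h1 h2 h3
    have h3 : r ≠ 0 := h3
    have : phi β r = logDeriv (fun r => (r * sinQuot r) * thetaProd β r) r := by
      rw [phi, funext (theta_eq β)]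
      simp only [mul_sinQuot]
    rw [this, logDeriv_mul (f := fun r => r * sinQuot r) r (mul_ne_zero h3 h2)
      (thetaProd_ne_zero_of_mem_strip hβ h1)
      (differentiableAt_fun_id.fun_mul (differentiable_sinQuot r)) (differentiable_thetaProd hβ r),
      logDeriv_mul (f := fun r => r) r h3 h2 differentiableAt_fun_id (differentiable_sinQuot r),
      logDeriv_apply (fun r => r)]
    simp [add_assoc]

end EllipticCS
end

/-! ### The addition formula for `phi`, by Liouville's theorem. -/

noncomputable section

namespace EllipticCS

open Complex Filter Topology

variable {β : ℝ}

/-- The difference of the two sides of the addition formula for `phi`. -/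
def additionDefect (β : ℝ) (y x : ℂ) : ℂ :=
  (phi β x + phi β y - phi β (x + y)) ^ 2 + deriv (phi β) x + deriv (phi β) y +
    deriv (phi β) (x + y) + 3 * c0 β

/-- The bracket is `1/x + k(x)` with `k(0) = 0`, so its square cancels the double pole of `φ'` and
contributes `2k'(0) = -2c₀ - 2φ'(y)`. With `h'(0) = -c₀` everything else cancels too. -/
lemma tendsto_additionDefect (hβ : 0 < β) {y : ℂ} (hy : theta β y ≠ 0) :
    Tendsto (additionDefect β y) (𝓝[≠] 0) (𝓝 0) := by
  obtain ⟨h, ha, h0, h1, he⟩ := exists_phi_eq_inv_add hβ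
  have hadd : AnalyticAt ℂ (fun x => phi β (x + y)) 0 := by
    refine AnalyticAt.fun_comp (g := phi β) ?_ (by fun_prop)
    simpa using analyticAt_phi hβ hy
  have hadd' : ContinuousAt (fun x => deriv (phi β) (x + y)) 0 := by
    refine ContinuousAt.comp' (g := deriv (phi β)) ?_ (by fun_prop)
    simpa using (analyticAt_phi hβ hy).deriv.continuousAt
  set k : ℂ → ℂ := fun x => h x + phi β y - phi β (x + y) with hk
  have k0 : k 0 = 0 := by simp [hk, h0]
  have k1 : HasDerivAt k (-c0 β - deriv (phi β) y) 0 := by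
    have d := ((ha.differentiableAt.hasDerivAt).add_const (phi β y)).sub
      hadd.differentiableAt.hasDerivAt
    rw [h1, deriv_comp_add_const, zero_add] at d
    exact d
  have kc : ContinuousAt (dslope k 0) 0 := continuousAt_dslope_same.mpr k1.differentiableAt
  have hF : (additionDefect β y) =ᶠ[𝓝[≠] 0] fun x => 2 * dslope k 0 x + x ^ 2 * dslope k 0 x ^ 2 +
      deriv h x + deriv (phi β) y + deriv (phi β) (x + y) + 3 * c0 β := by
    have han : ∀ᶠ x in 𝓝[≠] (0 : ℂ), AnalyticAt ℂ h x :=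
      nhdsWithin_le_nhds ha.eventually_analyticAt
    filter_upwards [he, eventually_eventually_nhdsWithin.mpr he, han, self_mem_nhdsWithin]
      with x e1 e2 e3 hx
    have hx : x ≠ 0 := hx
    have e2' : phi β =ᶠ[𝓝 x] fun r => r⁻¹ + h r := by
      rwa [isOpen_compl_singleton.nhdsWithin_eq hx] at e2
    have ed : deriv (phi β) x = -(x ^ 2)⁻¹ + deriv h x := by
      rw [e2'.deriv_eq, ((hasDerivAt_inv hx).fun_add e3.differentiableAt.hasDerivAt).deriv]
    have ek : x * dslope k 0 x = h x + phi β y - phi β (x + y) := by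
      have := sub_smul_dslope k 0 x
      simpa [k0] using this
    have e : phi β x + phi β y - phi β (x + y) = x⁻¹ + x * dslope k 0 x := by
      rw [ek, e1]; ring
    rw [additionDefect, e, ed]
    field_simp
    ring
  refine Tendsto.congr' hF.symm ?_
  have hlim : ContinuousAt (fun x => 2 * dslope k 0 x + x ^ 2 * dslope k 0 x ^ 2 +
      deriv h x + deriv (phi β) y + deriv (phi β) (x + y) + 3 * c0 β) 0 := by
    have := ha.deriv.continuousAt
    fun_prop
  have := hlim.tendsto
  simp only [dslope_same, k1.deriv, h1] at this
  convert this.mono_left nhdsWithin_le_nhds using 2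
  simp
  ring

open Classical in
/-- The entire extension of `additionDefect`. -/
def additionDefectExt (β : ℝ) (y x : ℂ) : ℂ :=
  if theta β x = 0 ∨ theta β (x + y) = 0 then 0 else additionDefect β y x

lemma theta_add_I_mul_eq_zero_iff (hβ : 0 < β) (r : ℂ) :
    theta β (r + I * β) = 0 ↔ theta β r = 0 := by
  rw [theta_add_I_mul hβ, mul_eq_zero, or_iff_right]
  simp [Complex.exp_ne_zero]

lemma theta_add_two_pi_eq_zero_iff (β : ℝ) (r : ℂ) :
    theta β (r + 2 * Real.pi) = 0 ↔ theta β r = 0 := by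
  rw [theta_add_two_pi, neg_eq_zero]

lemma additionDefectExt_add_two_pi (β : ℝ) (y : ℂ) :
    Function.Periodic (additionDefectExt β y) (2 * Real.pi) := fun x => by
  have e : x + 2 * Real.pi + y = x + y + 2 * Real.pi := by ring
  simp only [additionDefectExt, additionDefect, e, theta_add_two_pi_eq_zero_iff, phi_add_two_pi,
    deriv_phi_add_two_pi]

/-- The shifts by `-I` of `φ(x)` and `φ(x + y)` enter with opposite signs. -/
lemma additionDefectExt_add_I_mul (hβ : 0 < β) (y : ℂ) :
    Function.Periodic (additionDefectExt β y) (I * β) := fun x => by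
  have e : x + I * β + y = x + y + I * β := by ring
  unfold additionDefectExt
  simp only [e, theta_add_I_mul_eq_zero_iff hβ]
  split_ifs with h
  · rfl
  · push Not at h
    simp only [additionDefect, e, phi_add_I_mul hβ h.1, phi_add_I_mul hβ h.2,
      deriv_phi_add_I_mul hβ h.1, deriv_phi_add_I_mul hβ h.2]
    ring

/-- This reflection exchanges the poles at `x` in the lattice with those at `x + y` in the lattice,
so only the former need analysis. -/
lemma additionDefectExt_symm (β : ℝ) (y x : ℂ) :
    additionDefectExt β y (-(x + y)) = additionDefectExt β y x := by
  have e : -(x + y) + y = -x := by ring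
  simp only [additionDefectExt, additionDefect, e, theta_neg, phi_neg, deriv_phi_neg, neg_eq_zero,
    or_comm]
  congr 1
  ring

lemma theta_ne_zero_near_zero (hβ : 0 < β) : ∀ᶠ x in 𝓝[≠] (0 : ℂ), theta β x ≠ 0 := by
  have h1 : ∀ᶠ x in 𝓝[≠] (0 : ℂ), ‖x‖ < min β 1 :=
    nhdsWithin_le_nhds (continuous_norm.continuousAt.eventually_lt_const (by simpa using hβ))
  filter_upwards [h1, self_mem_nhdsWithin] with x hx hx0 h
  rw [lt_min_iff] at hx
  obtain ⟨n, rfl⟩ := theta_eq_zero_of_abs_im_lt hβ ((Complex.abs_im_le_norm x).trans_lt hx.1) h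
  have hn : n ≠ 0 := by rintro rfl; simp at hx0
  have h2 := hx.2
  rw [norm_mul, norm_mul, Complex.norm_ofNat, Complex.norm_real, Real.norm_of_nonneg Real.pi_pos.le,
    Complex.norm_intCast] at h2
  have h3 : (1 : ℝ) ≤ |(n : ℝ)| := by exact_mod_cast Int.one_le_abs hn
  nlinarith [Real.pi_gt_three]

lemma differentiableAt_additionDefect (hβ : 0 < β) {y x : ℂ} (hx : theta β x ≠ 0)
    (hxy : theta β (x + y) ≠ 0) : DifferentiableAt ℂ (additionDefect β y) x := by
  have a1 := (analyticAt_phi hβ hx).differentiableAt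
  have a2 := (analyticAt_phi hβ hx).deriv.differentiableAt
  have a3 : DifferentiableAt ℂ (fun x => phi β (x + y)) x :=
    (analyticAt_phi hβ hxy).differentiableAt.fun_comp' x (by fun_prop)
  have a4 : DifferentiableAt ℂ (fun x => deriv (phi β) (x + y)) x :=
    (analyticAt_phi hβ hxy).deriv.differentiableAt.fun_comp' x (by fun_prop)
  unfold additionDefect
  fun_prop

lemma additionDefectExt_eventuallyEq (hβ : 0 < β) {y x : ℂ} (hx : theta β x ≠ 0)
    (hxy : theta β (x + y) ≠ 0) : additionDefectExt β y =ᶠ[𝓝 x] additionDefect β y := by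
  have h := (eventually_theta_ne_zero hβ hxy)
  have h' : ∀ᶠ w in 𝓝 x, theta β (w + y) ≠ 0 :=
    (show ContinuousAt (fun w => w + y) x by fun_prop).eventually h
  filter_upwards [eventually_theta_ne_zero hβ hx, h'] with w h1 h2
  simp [additionDefectExt, h1, h2]

/-- The value `0` assigned at the pole is the limit there, so the singularity is removable. -/
lemma differentiableAt_additionDefectExt_zero (hβ : 0 < β) {y : ℂ} (hy : theta β y ≠ 0) :
    DifferentiableAt ℂ (additionDefectExt β y) 0 := by
  have h1 : ∀ᶠ x in 𝓝[≠] (0 : ℂ), theta β (x + y) ≠ 0 := by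
    have h := eventually_theta_ne_zero hβ hy
    rw [← zero_add y] at h
    exact nhdsWithin_le_nhds
      ((show ContinuousAt (fun w : ℂ => w + y) 0 by fun_prop).eventually h)
  have h0 : additionDefectExt β y 0 = 0 := by simp [additionDefectExt, theta_zero]
  have hev := (theta_ne_zero_near_zero hβ).and h1
  have hd : ∀ᶠ x in 𝓝[≠] (0 : ℂ), DifferentiableAt ℂ (additionDefectExt β y) x := by
    filter_upwards [hev] with x hx
    exact (differentiableAt_additionDefect hβ hx.1 hx.2).congr_of_eventuallyEq
      (additionDefectExt_eventuallyEq hβ hx.1 hx.2)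
  have hc : ContinuousAt (additionDefectExt β y) 0 := by
    rw [continuousAt_iff_punctured_nhds, h0]
    refine (tendsto_additionDefect hβ hy).congr' ?_
    filter_upwards [hev] with x hx
    simp [additionDefectExt, hx.1, hx.2]
  exact (Complex.analyticAt_of_differentiable_on_punctured_nhds_of_continuousAt hd
    hc).differentiableAt

lemma differentiableAt_additionDefectExt_of_theta_eq_zero (hβ : 0 < β) {y x : ℂ}
    (hy : theta β y ≠ 0) (hx : theta β x = 0) : DifferentiableAt ℂ (additionDefectExt β y) x := by
  obtain ⟨n, m, rfl⟩ := exists_int_of_theta_eq_zero hβ hx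
  have hp := ((additionDefectExt_add_two_pi β y).int_mul n).add_period
    ((additionDefectExt_add_I_mul hβ y).int_mul m)
  have e : additionDefectExt β y =
      fun x => additionDefectExt β y (x - (n * (2 * Real.pi) + m * (I * β))) :=
    funext fun x => (hp.sub_eq x).symm
  rw [e]
  refine DifferentiableAt.fun_comp' (f := fun x => x - (n * (2 * Real.pi) + m * (I * β))) _ ?_
    (by fun_prop)
  rw [show (2 * Real.pi * n + I * β * m : ℂ) - (n * (2 * Real.pi) + m * (I * β)) = 0 by ring]
  exact differentiableAt_additionDefectExt_zero hβ hy

lemma differentiable_additionDefectExt (hβ : 0 < β) {y : ℂ} (hy : theta β y ≠ 0) :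
    Differentiable ℂ (additionDefectExt β y) := fun x => by
  by_cases hx : theta β x = 0
  · exact differentiableAt_additionDefectExt_of_theta_eq_zero hβ hy hx
  by_cases hxy : theta β (x + y) = 0
  · have e : additionDefectExt β y = fun x => additionDefectExt β y (-(x + y)) :=
      funext fun x => (additionDefectExt_symm β y x).symm
    rw [e]
    refine DifferentiableAt.fun_comp' (f := fun x => -(x + y)) x ?_ (by fun_prop)
    exact differentiableAt_additionDefectExt_of_theta_eq_zero hβ hy (by rw [theta_neg, hxy, neg_zero])
  · exact (differentiableAt_additionDefect hβ hx hxy).congr_of_eventuallyEq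
      (additionDefectExt_eventuallyEq hβ hx hxy)

/-- A doubly periodic entire function with periods `2 π` and `i β` is constant. -/
lemma eq_of_doubly_periodic (hβ : 0 < β) {f : ℂ → ℂ} (hf : Differentiable ℂ f)
    (h1 : Function.Periodic f (2 * Real.pi)) (h2 : Function.Periodic f (I * β)) (z w : ℂ) :
    f z = f w := by
  refine hf.apply_eq_apply_of_bounded ?_ z w
  have hK : IsCompact (Set.Icc 0 (2 * Real.pi) ×ℂ Set.Icc 0 β) := isCompact_Icc.reProdIm isCompact_Icc
  refine (hK.image hf.continuous).isBounded.subset ?_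
  rintro _ ⟨z, rfl⟩
  set n := ⌊z.re / (2 * Real.pi)⌋
  set m := ⌊z.im / β⌋
  refine ⟨z - (n * (2 * Real.pi) + m * (I * β)), ?_, ((h1.int_mul n).add_period (h2.int_mul m)).sub_eq z⟩
  have hp : 0 < 2 * Real.pi := Real.two_pi_pos
  have a1 := Int.floor_le (z.re / (2 * Real.pi))
  have a2 := (Int.lt_floor_add_one (z.re / (2 * Real.pi))).le
  have b1 := Int.floor_le (z.im / β)
  have b2 := (Int.lt_floor_add_one (z.im / β)).le
  rw [le_div_iff₀ hp] at a1
  rw [div_le_iff₀ hp] at a2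
  rw [le_div_iff₀ hβ] at b1
  rw [div_le_iff₀ hβ] at b2
  rw [Complex.mem_reProdIm]
  constructor <;> simp <;> constructor <;> linarith

/-- The addition formula for `phi`. -/
lemma phi_addition (hβ : 0 < β) {x y : ℂ} (hx : theta β x ≠ 0) (hy : theta β y ≠ 0)
    (hxy : theta β (x + y) ≠ 0) :
    (phi β x + phi β y - phi β (x + y)) ^ 2 + deriv (phi β) x + deriv (phi β) y +
      deriv (phi β) (x + y) + 3 * c0 β = 0 := by
  -- The constant is read off at the origin, where the extension is `0` by definition.
  have h := eq_of_doubly_periodic hβ (differentiable_additionDefectExt hβ hy)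
    (additionDefectExt_add_two_pi β y) (additionDefectExt_add_I_mul hβ y) x 0
  simpa [additionDefectExt, hx, hxy, theta_zero, additionDefect] using h

end EllipticCS
end

/-! ### Holomorphic logarithm and powers of `θ̌` on the annulus. -/

noncomputable section

namespace EllipticCS

open Complex Filter Topology

variable {β : ℝ}

lemma norm_log_one_sub_le {w : ℂ} {ρ : ℝ} (hw : ‖w‖ ≤ ρ) (hρ : ρ < 1) :
    ‖log (1 - w)‖ ≤ ‖w‖ * ((1 - ρ)⁻¹ + 1) := by
  have h := norm_log_one_add_le (z := -w) (by rw [norm_neg]; linarith)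
  rw [norm_neg, ← sub_eq_add_neg] at h
  refine h.trans ?_
  have h1 : (1 - ‖w‖)⁻¹ ≤ (1 - ρ)⁻¹ := by
    apply inv_anti₀ <;> linarith
  have h2 : 0 < (1 - ‖w‖)⁻¹ := by
    apply inv_pos.mpr; linarith
  have h3 := norm_nonneg w
  have h4 : ‖w‖ ^ 2 * (1 - ‖w‖)⁻¹ ≤ ‖w‖ * (1 - ρ)⁻¹ := by
    apply mul_le_mul _ h1 h2.le h3
    nlinarith
  nlinarith [mul_nonneg h3 (h2.le.trans h1)]

lemma one_sub_mem_slitPlane {w : ℂ} (hw : ‖w‖ < 1) : 1 - w ∈ slitPlane := by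
  left
  have := (Complex.re_le_norm w).trans_lt hw
  simp
  linarith

/-- Each summand is a principal logarithm of a point `1 - w` with `|w| < 1`, and the series is
dominated geometrically on compactly smaller annuli. -/
lemma differentiableAt_logThetaCheck (hβ : 0 < β) {z : ℂ} (h1 : nome β ^ 2 < ‖z‖) (h2 : ‖z‖ < 1) :
    DifferentiableAt ℂ (logThetaCheck β) z := by
  -- An inner radius `a > q²` keeps `q^{2(m+1)}/|w|` below the fixed ratio `ρ = q²/a < 1`.
  obtain ⟨a, ha1, ha2⟩ := exists_between h1
  have q0 := nome_pos β
  have a0 : 0 < a := lt_trans (by positivity) ha1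
  set U : Set ℂ := {w | a < ‖w‖ ∧ ‖w‖ < 1} with hUdef
  have hU : IsOpen U :=
    (isOpen_lt continuous_const continuous_norm).inter (isOpen_lt continuous_norm continuous_const)
  have hzU : z ∈ U := ⟨ha2, h2⟩
  set ρ := nome β ^ 2 / a with hρdef
  have hρ : ρ < 1 := (div_lt_one a0).mpr ha1
  have b1 : ∀ m : ℕ, ∀ w ∈ U, ‖(nome β : ℂ) ^ (2 * (m + 1)) * w‖ ≤ nome β ^ (2 * (m + 1)) / a := by
    intro m w hw
    rw [norm_mul, norm_ofReal_nome_pow, le_div_iff₀ a0, mul_assoc]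
    have : ‖w‖ * a ≤ 1 := by nlinarith [hw.1, hw.2]
    have hp : 0 < nome β ^ (2 * (m + 1)) := by positivity
    nlinarith
  have b2 : ∀ m : ℕ, ∀ w ∈ U, ‖(nome β : ℂ) ^ (2 * (m + 1)) / w‖ ≤ nome β ^ (2 * (m + 1)) / a := by
    intro m w hw
    rw [norm_div, norm_ofReal_nome_pow]
    have := hw.1.le
    gcongr
  have b3 : ∀ m : ℕ, nome β ^ (2 * (m + 1)) / a ≤ ρ := fun m => by
    have := nome_pow_le_sq hβ m
    rw [hρdef]
    gcongr
  have hd : DifferentiableOn ℂ (fun w => ∑' m : ℕ, (log (1 - (nome β : ℂ) ^ (2 * (m + 1)) * w) +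
      log (1 - (nome β : ℂ) ^ (2 * (m + 1)) / w))) U := by
    refine differentiableOn_tsum_of_summable_norm
      (u := fun m => 2 * (nome β ^ (2 * (m + 1)) / a * ((1 - ρ)⁻¹ + 1)))
      ((((summable_nome_pow hβ).div_const a).mul_right _).mul_left 2) ?_ hU ?_
    · intro m w hw
      have hw0 : w ≠ 0 := norm_pos_iff.mp (a0.trans hw.1)
      have s1 := one_sub_mem_slitPlane (((b1 m w hw).trans (b3 m)).trans_lt hρ)
      have s2 := one_sub_mem_slitPlane (((b2 m w hw).trans (b3 m)).trans_lt hρ)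
      refine DifferentiableAt.differentiableWithinAt ?_
      refine DifferentiableAt.fun_add (DifferentiableAt.clog (by fun_prop) s1)
        (DifferentiableAt.clog ?_ s2)
      fun_prop (disch := assumption)
    · intro m w hw
      have hc : 0 ≤ (1 - ρ)⁻¹ + 1 := by
        have : 0 ≤ (1 - ρ)⁻¹ := inv_nonneg.mpr (by linarith)
        linarith
      have l1 := norm_log_one_sub_le ((b1 m w hw).trans (b3 m)) hρ
      have l2 := norm_log_one_sub_le ((b2 m w hw).trans (b3 m)) hρ
      have l3 := mul_le_mul_of_nonneg_right (b1 m w hw) hc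
      have l4 := mul_le_mul_of_nonneg_right (b2 m w hw) hc
      refine (norm_add_le _ _).trans ?_
      linarith
  unfold logThetaCheck
  exact (DifferentiableAt.clog (by fun_prop) (one_sub_mem_slitPlane h2)).fun_add
    (hd.differentiableAt (hU.mem_nhds hzU))

lemma norm_exp_I_mul_mem {r : ℂ} (hr : 0 < r.im ∧ r.im < β) :
    nome β ^ 2 < ‖cexp (I * r)‖ ∧ ‖cexp (I * r)‖ < 1 := by
  rw [Complex.norm_exp, nome_sq_eq_exp, Real.exp_lt_exp, Real.exp_lt_one_iff]
  simpa using hr.symm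

lemma isOpen_upper_strip (β : ℝ) : IsOpen {r : ℂ | 0 < r.im ∧ r.im < β} :=
  (isOpen_lt continuous_const Complex.continuous_im).inter
    (isOpen_lt Complex.continuous_im continuous_const)

lemma hasDerivAt_thetaCheck_exp (hβ : 0 < β) {r : ℂ} (hr : theta β r ≠ 0) :
    HasDerivAt (fun r => thetaCheck β (cexp (I * r)))
      ((phi β r + I / 2) * thetaCheck β (cexp (I * r))) r := by
  simp only [thetaCheck_exp]
  have h := (((((hasDerivAt_id r).const_mul I).div_const 2).cexp).const_mul (-2 * I)).mul
    (hasDerivAt_theta hβ hr)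
  refine h.congr_deriv ?_
  simp only [id]
  ring

/-- Once differentiability is known, the value follows by differentiating `exp (logThetaCheck) =
θ̌`; the logarithmic series need not be differentiated term by term. -/
lemma hasDerivAt_logThetaCheck_exp (hβ : 0 < β) {r : ℂ} (hr : 0 < r.im ∧ r.im < β) :
    HasDerivAt (fun r => logThetaCheck β (cexp (I * r))) (phi β r + I / 2) r := by
  have hn := norm_exp_I_mul_mem hr
  have hd : DifferentiableAt ℂ (fun r => logThetaCheck β (cexp (I * r))) r :=
    (differentiableAt_logThetaCheck hβ hn.1 hn.2).fun_comp' r (by fun_prop)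
  have h1 := hd.hasDerivAt.cexp
  have h2 := hasDerivAt_thetaCheck_exp hβ (theta_ne_zero_of_im_mem hβ hr.1 hr.2)
  have he : (fun r => thetaCheck β (cexp (I * r))) =ᶠ[𝓝 r]
      fun r => cexp (logThetaCheck β (cexp (I * r))) := by
    filter_upwards [(isOpen_upper_strip β).mem_nhds hr] with w hw
    have := norm_exp_I_mul_mem hw
    rw [exp_logThetaCheck hβ this.1 this.2]
  have h3 := (h1.congr_of_eventuallyEq he).unique h2
  rw [← exp_logThetaCheck hβ hn.1 hn.2, mul_comm] at h3
  exact hd.hasDerivAt.congr_deriv (mul_right_cancel₀ (Complex.exp_ne_zero _) h3)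

lemma hasDerivAt_thetaCheckPow_exp (hβ : 0 < β) (s : ℂ) {r : ℂ} (hr : 0 < r.im ∧ r.im < β) :
    HasDerivAt (fun r => thetaCheckPow β s (cexp (I * r)))
      (s * (phi β r + I / 2) * thetaCheckPow β s (cexp (I * r))) r :=
  (((hasDerivAt_logThetaCheck_exp hβ hr).const_mul s).cexp).congr_deriv (mul_comm _ _)

end EllipticCS
end

/-! ### Algebra of three-body sums for particles of total mass zero. -/

noncomputable section

namespace EllipticCS

open Finset

section Algebra

variable {ι : Type*} [Fintype ι]

/-- The weight `m a * m b * m c` is symmetric, so a triple sum may be replaced by that of its cyclic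
permutations. -/
lemma sum_cyclic (m : ι → ℂ) (f : ι → ι → ι → ℂ) :
    ∑ a, ∑ b, ∑ c, m a * m b * m c * f b c a = ∑ a, ∑ b, ∑ c, m a * m b * m c * f a b c := by
  rw [sum_comm]
  refine sum_congr rfl fun b _ => ?_
  rw [sum_comm]
  exact sum_congr rfl fun c _ => sum_congr rfl fun a _ => by ring

variable [DecidableEq ι]

/-- Reduction of a weighted double sum over pairs interacting through a function that satisfies an
addition formula, when the total weight vanishes. -/
lemma sum_mul_sq_sum_eq (m : ι → ℂ) (hm : ∑ a, m a = 0) (p p' : ι → ι → ℂ) (C : ℂ)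
    (hp : ∀ a b, p b a = -p a b) (hp' : ∀ a b, p' b a = p' a b)
    (h : ∀ a b c, a ≠ b → b ≠ c → c ≠ a →
      (p a b + p b c + p c a) ^ 2 = 3 * C - (p' a b + p' b c + p' c a)) :
    ∑ a, m a * (∑ b, m b * p a b) ^ 2 =
      ∑ a, ∑ b, if a = b then 0 else m a ^ 2 * m b * (C - p' a b) := by
  have hpa : ∀ a, p a a = 0 := fun a => by
    have := hp a a
    linear_combination this / 2
  -- Expanding the square in `h` gives `∑ p² - 2 (Q + cyclic) = ∑ e` for distinct indices. Thus `Q +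
  -- G` has cyclic sum zero there, and `D` records what survives when indices coincide.
  let e : ι → ι → ℂ := fun a b => if a = b then 0 else C - p' a b
  let g : ι → ι → ℂ := fun a b => (e a b - p a b ^ 2) / 2
  let Q : ι → ι → ι → ℂ := fun a b c => p a b * p a c
  let D : ι → ι → ι → ℂ := fun a b c => if a = b then e b c else 0
  let G : ι → ι → ι → ℂ := fun a b _ => g a b
  have he : ∀ a b, e b a = e a b := fun a b => by
    simp only [e, hp' a b, eq_comm]
  have hea : ∀ a, e a a = 0 := fun a => by simp [e]
  have key : ∀ a b c, (Q a b c + Q b c a + Q c a b) + (G a b c + G b c a + G c a b) =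
      D a b c + D b c a + D c a b := by
    intro a b c
    simp only [Q, D, G, g]
    by_cases hab : a = b
    · subst hab
      by_cases hac : a = c
      · subst hac
        simp [hea, hpa]
      · have hca : c ≠ a := Ne.symm hac
        simp only [hac, hca, if_true, if_false, hpa, hea, hp a c, he a c]
        ring
    · by_cases hbc : b = c
      · subst hbc
        have hba : b ≠ a := Ne.symm hab
        simp only [hab, hba, if_true, if_false, hpa, hea, hp a b, he a b]
        ring
      · by_cases hca : c = a
        · subst hca
          simp only [hab, hbc, if_true, if_false, hpa, hea, hp b c, he b c]
          ring
        · have := h a b c hab hbc hca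
          simp only [hab, hbc, hca, if_false, e]
          rw [hp a b, hp b c, hp c a]
          linear_combination (-1 / 2 : ℂ) * this
  have hS : ∑ a, ∑ b, ∑ c, m a * m b * m c * ((Q a b c + Q b c a + Q c a b) +
      (G a b c + G b c a + G c a b)) =
      ∑ a, ∑ b, ∑ c, m a * m b * m c * (D a b c + D b c a + D c a b) := by
    simp only [key]
  have cyc2 : ∀ f : ι → ι → ι → ℂ, ∑ a, ∑ b, ∑ c, m a * m b * m c * f c a b =
      ∑ a, ∑ b, ∑ c, m a * m b * m c * f a b c := fun f => by
    rw [← sum_cyclic m f, ← sum_cyclic m fun a b c => f b c a]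
  simp only [mul_add, sum_add_distrib] at hS
  rw [sum_cyclic m Q, cyc2 Q, sum_cyclic m G, cyc2 G, sum_cyclic m D, cyc2 D] at hS
  -- `G` ignores its third index, so summing over `c` produces the total mass.
  have hG : ∑ a, ∑ b, ∑ c, m a * m b * m c * G a b c = 0 := by
    refine sum_eq_zero fun a _ => sum_eq_zero fun b _ => ?_
    simp only [G]
    rw [← sum_mul, ← mul_sum, hm]
    ring
  have hQ : ∑ a, ∑ b, ∑ c, m a * m b * m c * Q a b c = ∑ a, m a * (∑ b, m b * p a b) ^ 2 := by
    refine sum_congr rfl fun a _ => ?_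
    rw [sq, sum_mul_sum, mul_sum]
    refine sum_congr rfl fun b _ => ?_
    rw [mul_sum]
    exact sum_congr rfl fun c _ => by simp only [Q]; ring
  have hD : ∑ a, ∑ b, ∑ c, m a * m b * m c * D a b c =
      ∑ a, ∑ b, if a = b then 0 else m a ^ 2 * m b * (C - p' a b) := by
    refine sum_congr rfl fun a _ => ?_
    rw [sum_comm]
    refine sum_congr rfl fun c _ => ?_
    simp only [D, mul_ite, mul_zero, sum_ite_eq, mem_univ, if_true, e]
    split_ifs <;> ring
  rw [hG, hQ, hD] at hS
  linear_combination hS / 3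

/-- The sum over all particles of `(1 / m) (∂ A + A ^ 2)`, where `A` is the logarithmic derivative
of a product of pair functions times a plane wave, reduces to pair terms when the total mass
vanishes. -/
lemma sum_inv_mul_eq (m : ι → ℂ) (hm0 : ∀ a, m a ≠ 0) (hm : ∑ a, m a = 0) (lam κ : ℂ)
    (p p' : ι → ι → ℂ) (C : ℂ)
    (hp : ∀ a b, p b a = -p a b) (hp' : ∀ a b, p' b a = p' a b)
    (h : ∀ a b c, a ≠ b → b ≠ c → c ≠ a →
      (p a b + p b c + p c a) ^ 2 = 3 * C - (p' a b + p' b c + p' c a)) :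
    ∑ a, (m a)⁻¹ * ((lam * m a * ∑ b, if a = b then 0 else m b * p' a b) +
        (lam * m a * ((∑ b, m b * p a b) + κ)) ^ 2) =
      ∑ a, ∑ b, if a = b then 0 else
        (lam * m b * p' a b + lam ^ 2 * m a ^ 2 * m b * (C - p' a b)) := by
  -- Action equals reaction: the antisymmetric double sum vanishes, which removes the term linear in
  -- `κ` below.
  have h1 : ∑ a, m a * (∑ b, m b * p a b) = 0 := by
    have e : ∑ a, ∑ b, m a * m b * p a b = -∑ a, ∑ b, m a * m b * p a b := by
      conv_lhs => rw [sum_comm]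
      rw [← sum_neg_distrib]
      refine sum_congr rfl fun a _ => ?_
      rw [← sum_neg_distrib]
      exact sum_congr rfl fun b _ => by rw [hp a b]; ring
    simp only [mul_sum, ← mul_assoc]
    linear_combination e / 2
  have h2 := sum_mul_sq_sum_eq m hm p p' C hp hp' h
  have h3 : ∀ a, (m a)⁻¹ * ((lam * m a * ∑ b, if a = b then 0 else m b * p' a b) +
        (lam * m a * ((∑ b, m b * p a b) + κ)) ^ 2) =
      (lam * ∑ b, if a = b then 0 else m b * p' a b) + (lam ^ 2 * (m a * (∑ b, m b * p a b) ^ 2) +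
        (2 * lam ^ 2 * κ) * (m a * ∑ b, m b * p a b) + lam ^ 2 * κ ^ 2 * m a) := fun a => by
    have := hm0 a
    field_simp
    ring
  simp only [h3, sum_add_distrib, ← mul_sum]
  rw [h1, h2, hm, mul_zero, mul_zero, add_zero, add_zero]
  simp only [mul_sum, ← sum_add_distrib]
  refine sum_congr rfl fun a _ => sum_congr rfl fun b _ => ?_
  split_ifs <;> ring

end Algebra

end EllipticCS
end

/-! ### Differentiation under the integral and integration by parts. -/

noncomputable section

namespace EllipticCS

open MeasureTheory Filter Topology

section Parametric

universe u

variable {E : Type u} [NormedAddCommGroup E] [NormedSpace ℝ E] [ProperSpace E]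

/-- Compactness of a closed ball times the interval gives a constant bound for the partial
derivative, enough for dominated convergence. -/
lemma hasFDerivAt_intervalIntegral_of_contDiff {F : Type u} [NormedAddCommGroup F]
    [NormedSpace ℝ F] {f : E × ℝ → F} (hf : ContDiff ℝ 1 f) (a b : ℝ) (x : E) :
    HasFDerivAt (fun x => ∫ s in a..b, f (x, s))
      (∫ s in a..b, (fderiv ℝ f (x, s)).comp (ContinuousLinearMap.inl ℝ E ℝ)) x := by
  have hf' : Continuous fun z : E × ℝ => (fderiv ℝ f z).comp (ContinuousLinearMap.inl ℝ E ℝ) :=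
    (hf.continuous_fderiv one_ne_zero).clm_comp continuous_const
  obtain ⟨M, hM⟩ := ((isCompact_closedBall x 1).prod (isCompact_uIcc (a := a) (b := b))).exists_bound_of_continuousOn
    hf'.continuousOn
  refine intervalIntegral.hasFDerivAt_integral_of_dominated_of_fderiv_le (𝕜 := ℝ)
    (F' := fun x s => (fderiv ℝ f (x, s)).comp (ContinuousLinearMap.inl ℝ E ℝ))
    (bound := fun _ => M) (Metric.closedBall_mem_nhds x one_pos) ?_ ?_ ?_ ?_ ?_ ?_
  · refine Eventually.of_forall fun y => ?_
    exact (hf.continuous.comp (by fun_prop : Continuous fun s : ℝ => (y, s))).aestronglyMeasurable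
  · exact (hf.continuous.comp (by fun_prop : Continuous fun s : ℝ => (x, s))).intervalIntegrable _ _
  · exact (hf'.comp (by fun_prop : Continuous fun s : ℝ => (x, s))).aestronglyMeasurable
  · exact Eventually.of_forall fun s hs y hy => hM (y, s) ⟨hy, Set.uIoc_subset_uIcc hs⟩
  · exact intervalIntegrable_const
  · refine Eventually.of_forall fun s _ y _ => ?_
    exact ((hf.differentiable one_ne_zero) (y, s)).hasFDerivAt.comp y (hasFDerivAt_prodMk_left y s)

/-- An interval integral of a `C^n` function depends in a `C^n` way on parameters. -/
lemma contDiff_intervalIntegral (n : ℕ) : ∀ {F : Type u} [NormedAddCommGroup F]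
    [NormedSpace ℝ F] {f : E × ℝ → F}, ContDiff ℝ n f → ∀ a b : ℝ,
    ContDiff ℝ n fun x => ∫ s in a..b, f (x, s) := by
  induction n with
  | zero =>
    intro F _ _ f hf a b
    rw [Nat.cast_zero, contDiff_zero] at hf ⊢
    exact intervalIntegral.continuous_parametric_intervalIntegral_of_continuous'
      (f := fun x s => f (x, s)) hf a b
  -- The derivative is again such an integral, but with values in `E →L[ℝ] F`; hence `F` varies in
  -- the induction and shares the universe of `E`.
  | succ n ih =>
    intro F _ _ f hf a b
    have h1 : ContDiff ℝ 1 f := hf.of_le (by exact_mod_cast Nat.le_add_left 1 n)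
    have hd := hasFDerivAt_intervalIntegral_of_contDiff h1 a b
    rw [show ((n + 1 : ℕ) : WithTop ℕ∞) = (n : WithTop ℕ∞) + 1 by norm_cast] at hf ⊢
    rw [contDiff_succ_iff_fderiv] at hf ⊢
    refine ⟨fun x => (hd x).differentiableAt, by simp, ?_⟩
    rw [funext fun x => (hd x).fderiv]
    exact ih (hf.2.2.clm_comp contDiff_const) a b

end Parametric

lemma deriv_eq_fderiv_apply {f : ℝ × ℝ → ℂ} (hf : ContDiff ℝ 1 f) (t s : ℝ) :
    HasDerivAt (fun t => f (t, s)) (fderiv ℝ f (t, s) (1, 0)) t := by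
  have := ((hf.differentiable one_ne_zero) (t, s)).hasFDerivAt.comp_hasDerivAt t
    ((hasDerivAt_id t).prodMk (hasDerivAt_const t s))
  exact this

lemma hasDerivAt_intervalIntegral_of_contDiff {f : ℝ × ℝ → ℂ} (hf : ContDiff ℝ 1 f) (a b t : ℝ) :
    HasDerivAt (fun t => ∫ s in a..b, f (t, s)) (∫ s in a..b, fderiv ℝ f (t, s) (1, 0)) t := by
  have h := (hasFDerivAt_intervalIntegral_of_contDiff hf a b t).hasDerivAt
  rwa [ContinuousLinearMap.intervalIntegral_apply] at h
  refine Continuous.intervalIntegrable ?_ _ _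
  exact ((hf.continuous_fderiv one_ne_zero).comp (by fun_prop : Continuous fun s : ℝ => (t, s))).clm_comp
    continuous_const

lemma contDiff_fderiv_apply {f : ℝ × ℝ → ℂ} (hf : ContDiff ℝ 2 f) :
    ContDiff ℝ 1 fun z => fderiv ℝ f z (1, 0) :=
  (hf.fderiv_right (by norm_num)).clm_apply contDiff_const

/-- Second derivative of the product of a function and a parametric integral, when the
logarithmic derivatives of the factors are known. -/
lemma iteratedDeriv_two_mul_intervalIntegral {u A : ℝ → ℂ} {A' : ℂ} {f B : ℝ → ℝ → ℂ} {B' : ℝ → ℂ}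
    {a b t : ℝ} (hf : ContDiff ℝ 2 fun z : ℝ × ℝ => f z.1 z.2)
    (hu : ∀ᶠ w in 𝓝 t, HasDerivAt u (A w * u w) w) (hA : HasDerivAt A A' t)
    (hfB : ∀ w s, HasDerivAt (fun w => f w s) (B w s * f w s) w)
    (hB : ∀ s, HasDerivAt (fun w => B w s) (B' s) t) :
    iteratedDeriv 2 (fun w => u w * ∫ s in a..b, f w s) t =
      ∫ s in a..b, (A' + B' s + (A t + B t s) ^ 2) * (u t * f t s) := by
  have hf1 : ContDiff ℝ 1 fun z : ℝ × ℝ => f z.1 z.2 := hf.of_le (by norm_num)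
  have hd1 := hasDerivAt_intervalIntegral_of_contDiff hf1 a b
  have hd2 := hasDerivAt_intervalIntegral_of_contDiff (contDiff_fderiv_apply hf) a b t
  have e1 : ∀ w s, fderiv ℝ (fun z : ℝ × ℝ => f z.1 z.2) (w, s) (1, 0) = B w s * f w s :=
    fun w s => (deriv_eq_fderiv_apply hf1 w s).unique (hfB w s)
  have e2 : ∀ s, fderiv ℝ (fun z => fderiv ℝ (fun z : ℝ × ℝ => f z.1 z.2) z (1, 0)) (t, s) (1, 0) =
      (B' s + B t s ^ 2) * f t s := fun s => by
    refine (deriv_eq_fderiv_apply (contDiff_fderiv_apply hf) t s).unique ?_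
    simp only [e1]
    exact ((hB s).mul (hfB t s)).congr_deriv (by ring)
  have cf : Continuous fun s => f t s :=
    hf.continuous.comp (by fun_prop : Continuous fun s : ℝ => (t, s))
  have c1 : Continuous fun s => B t s * f t s := by
    simp only [← e1]
    exact (contDiff_fderiv_apply hf).continuous.comp (by fun_prop : Continuous fun s : ℝ => (t, s))
  have c2 : Continuous fun s => (B' s + B t s ^ 2) * f t s := by
    simp only [← e2]
    exact ((contDiff_fderiv_apply hf).continuous_fderiv one_ne_zero |>.clm_apply
      continuous_const).comp (by fun_prop : Continuous fun s : ℝ => (t, s))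
  simp only [e1] at hd1
  simp only [e2] at hd2
  simp only [e1] at hd2
  have hfirst : deriv (fun w => u w * ∫ s in a..b, f w s) =ᶠ[𝓝 t]
      fun w => A w * u w * (∫ s in a..b, f w s) + u w * ∫ s in a..b, B w s * f w s := by
    filter_upwards [hu] with w hw
    exact (hw.mul (hd1 w)).deriv
  have hut := hu.self_of_nhds
  have hsecond := ((hA.mul hut).mul (hd1 t)).add (hut.mul hd2)
  rw [iteratedDeriv_succ, iteratedDeriv_one, hfirst.deriv_eq]
  erw [hsecond.deriv]
  have i0 : IntervalIntegrable (fun s => f t s) volume a b := cf.intervalIntegrable _ _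
  have i1 : IntervalIntegrable (fun s => B t s * f t s) volume a b := c1.intervalIntegrable _ _
  have i2 : IntervalIntegrable (fun s => (B' s + B t s ^ 2) * f t s) volume a b :=
    c2.intervalIntegrable _ _
  have e : ∀ s, (A' + B' s + (A t + B t s) ^ 2) * (u t * f t s) =
      ((A' + A t ^ 2) * u t) * f t s + (2 * A t * u t) * (B t s * f t s) +
        u t * ((B' s + B t s ^ 2) * f t s) := fun s => by ring
  simp only [e]
  rw [intervalIntegral.integral_add ((i0.const_mul _).add (i1.const_mul _)) (i2.const_mul _),
    intervalIntegral.integral_add (i0.const_mul _) (i1.const_mul _),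
    intervalIntegral.integral_const_mul, intervalIntegral.integral_const_mul,
    intervalIntegral.integral_const_mul]
  simp only [Pi.mul_apply]
  ring

/-- Integrating by parts twice over a period. -/
lemma integral_exp_mul_deriv_two {f B : ℝ → ℂ} {B' : ℝ → ℂ} {T : ℝ} {c : ℂ}
    (hf : ∀ s, HasDerivAt f (B s * f s) s) (hB : ∀ s, HasDerivAt B (B' s) s)
    (hB' : Continuous B')
    (hfT : f T * Complex.exp (c * T) = f 0) (hBT : B T = B 0) :
    ∫ s in (0 : ℝ)..T, Complex.exp (c * s) * ((B' s + B s ^ 2) * f s) =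
      c ^ 2 * ∫ s in (0 : ℝ)..T, Complex.exp (c * s) * f s := by
  have cf : Continuous f := continuous_iff_continuousAt.mpr fun s => (hf s).continuousAt
  have cB : Continuous B := continuous_iff_continuousAt.mpr fun s => (hB s).continuousAt
  -- The function `e^{cs} (B - c) f` is an explicit primitive of the difference of the integrands,
  -- since `c (B - c) + B' + (B - c) B = B' + B² - c²`. Its boundary values agree by `hfT` and
  -- `hBT`.
  have h : ∀ s : ℝ, HasDerivAt (fun s : ℝ => Complex.exp (c * s) * ((B s - c) * f s))
      (Complex.exp (c * s) * ((B' s + B s ^ 2) * f s) - c ^ 2 * (Complex.exp (c * s) * f s)) s :=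
    fun s => by
    have h1 : HasDerivAt (fun s : ℝ => Complex.exp (c * s)) _ s :=
      ((Complex.ofRealCLM.hasDerivAt (x := s)).const_mul c).cexp
    refine (h1.mul (((hB s).sub_const c).mul (hf s))).congr_deriv ?_
    simp
    ring
  have hi := intervalIntegral.integral_eq_sub_of_hasDerivAt (a := 0) (b := T) (fun s _ => h s)
    (Continuous.intervalIntegrable (by fun_prop) _ _)
  rw [intervalIntegral.integral_sub (Continuous.intervalIntegrable (by fun_prop) _ _)
    (Continuous.intervalIntegrable (by fun_prop) _ _), intervalIntegral.integral_const_mul] at hi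
  rw [← sub_eq_zero, hi, hBT]
  simp
  linear_combination (B 0 - c) * hfT

end EllipticCS
end

/-! ### Smoothness and logarithmic derivatives of `Psi0`. -/

noncomputable section

namespace EllipticCS

open Complex Filter Topology

variable {β : ℝ}

/-- Logarithmic derivatives are carried as multipliers `c i`, without division, so no factor has to
be nonzero. -/
lemma hasDerivAt_prod_of_logDeriv {ι : Type*} {s : Finset ι} {f : ι → ℝ → ℂ} {c : ι → ℂ} {t : ℝ}
    (h : ∀ i ∈ s, HasDerivAt (f i) (c i * f i t) t) :
    HasDerivAt (fun t => ∏ i ∈ s, f i t) ((∑ i ∈ s, c i) * ∏ i ∈ s, f i t) t := by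
  classical
  induction s using Finset.induction_on with
  | empty => simpa using hasDerivAt_const t (1 : ℂ)
  | insert a s ha ih =>
    have h1 := (h a (Finset.mem_insert_self a s)).mul
      (ih fun i hi => h i (Finset.mem_insert_of_mem hi))
    simp only [Finset.prod_insert ha, Finset.sum_insert ha]
    exact h1.congr_deriv (by ring)

lemma hasDerivAt_theta_ofReal_cpow (hβ : 0 < β) {c : ℂ} (hc : c ≠ 0) {u : ℝ → ℝ} {u' t : ℝ}
    (hu : HasDerivAt u u' t) (h : theta β (u t) ≠ 0) :
    HasDerivAt (fun t => theta β (u t) ^ c) (c * phi β (u t) * u' * theta β (u t) ^ c) t := by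
  have hne : thetaReal β (u t) ≠ 0 := by
    rwa [← ofReal_thetaReal hβ, ofReal_ne_zero] at h
  have h1 : HasDerivAt (thetaReal β) (phi β (u t) * theta β (u t)).re (u t) :=
    (hasDerivAt_theta hβ h).real_of_complex
  have h1' : ((phi β (u t) * theta β (u t)).re : ℂ) = phi β (u t) * theta β (u t) := by
    refine h1.ofReal_comp.unique ?_
    simp only [ofReal_thetaReal hβ]
    exact (hasDerivAt_theta hβ h).comp_ofReal
  have h2 := (hasDerivAt_ofReal_cpow_const hne hc).scomp t (h1.comp t hu)
  simp only [Function.comp_def, ofReal_thetaReal hβ] at h2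
  refine h2.congr_deriv ?_
  rw [Complex.real_smul, ofReal_mul, h1', cpow_sub _ _ h, cpow_one]
  field_simp

/-- Negative reals lie on the branch cut, but along the real axis the principal power there is the
constant `e^{πic}` times `(-x)^c`. -/
lemma contDiffAt_ofReal_cpow_const {x : ℝ} (hx : x ≠ 0) (c : ℂ) :
    ContDiffAt ℝ 2 (fun x : ℝ => (x : ℂ) ^ c) x := by
  have hpos : ∀ y : ℝ, 0 < y → ContDiffAt ℝ 2 (fun x : ℝ => (x : ℂ) ^ c) y := fun y hy => by
    have h1 : ContDiffAt ℝ 2 (fun x : ℝ => cexp (c * (Real.log x : ℂ))) y := by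
      have hl : ContDiffAt ℝ 2 Real.log y := Real.contDiffAt_log.mpr hy.ne'
      exact (contDiffAt_const.mul (ofRealCLM.contDiff.contDiffAt.comp y hl)).cexp
    refine h1.congr_of_eventuallyEq ?_
    filter_upwards [lt_mem_nhds hy] with z hz
    rw [cpow_def_of_ne_zero (by exact_mod_cast hz.ne'), ofReal_log hz.le, mul_comm]
  rcases hx.lt_or_gt with hx | hx
  · have h1 : ContDiffAt ℝ 2 (fun x : ℝ => ((-x : ℝ) : ℂ) ^ c * cexp (Real.pi * I * c)) x :=
      ((hpos (-x) (by linarith)).comp x contDiffAt_id.neg).mul contDiffAt_const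
    refine h1.congr_of_eventuallyEq ?_
    filter_upwards [gt_mem_nhds hx] with z hz
    rw [ofReal_cpow_of_nonpos hz.le, ofReal_neg]
  · exact hpos x hx

lemma contDiff_comp_ofReal {f : ℂ → ℂ} (hf : Differentiable ℂ f) :
    ContDiff ℝ 2 fun t : ℝ => f t :=
  (hf.contDiff (n := 2)).restrict_scalars ℝ |>.comp ofRealCLM.contDiff

lemma contDiffAt_theta_ofReal_cpow (hβ : 0 < β) (c : ℂ) {r : ℝ} (h : theta β r ≠ 0) :
    ContDiffAt ℝ 2 (fun r : ℝ => theta β r ^ c) r := by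
  have hne : thetaReal β r ≠ 0 := by
    rwa [← ofReal_thetaReal hβ, ofReal_ne_zero] at h
  have h1 : ContDiff ℝ 2 (thetaReal β) :=
    reCLM.contDiff.comp (contDiff_comp_ofReal (differentiable_theta hβ))
  have := (contDiffAt_ofReal_cpow_const hne c).comp r h1.contDiffAt
  simpa only [Function.comp_def, ofReal_thetaReal hβ] using this

/-- `theta` does not vanish at any difference of coordinates. -/
def NonSingular (β : ℝ) {N Nt : ℕ} (x : Fin N → ℝ) (xt : Fin Nt → ℝ) : Prop :=
  (∀ j k, j ≠ k → theta β ((x j : ℂ) - x k) ≠ 0) ∧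
    (∀ J K, J ≠ K → theta β ((xt J : ℂ) - xt K) ≠ 0) ∧
    ∀ j J, theta β ((x j : ℂ) - xt J) ≠ 0

lemma nonSingular_of_mem_regularSet (hβ : 0 < β) {N Nt : ℕ} {p : (Fin N → ℝ) × (Fin Nt → ℝ)}
    (hp : p ∈ regularSet N Nt) : NonSingular β p.1 p.2 := by
  obtain ⟨h1, h2, h3⟩ := hp
  refine ⟨fun j k hjk => ?_, fun J K hJK => ?_, fun j J => ?_⟩ <;> rw [← ofReal_sub]
  · exact theta_ofReal_ne_zero hβ (h1 j k hjk)
  · exact theta_ofReal_ne_zero hβ (h2 J K hJK)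
  · exact theta_ofReal_ne_zero hβ (h3 j J)

lemma eventually_nonSingular (hβ : 0 < β) {N Nt : ℕ} {x : ℝ → Fin N → ℝ} {xt : ℝ → Fin Nt → ℝ}
    {t : ℝ} (hx : ContinuousAt x t) (hxt : ContinuousAt xt t) (h : NonSingular β (x t) (xt t)) :
    ∀ᶠ w in 𝓝 t, NonSingular β (x w) (xt w) := by
  have hc := (differentiable_theta hβ).continuous
  obtain ⟨h1, h2, h3⟩ := h
  have hx' : ∀ j, ContinuousAt (fun w => (x w j : ℂ)) t := fun j =>
    continuous_ofReal.continuousAt.comp' (continuousAt_pi.mp hx j)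
  have hxt' : ∀ j, ContinuousAt (fun w => (xt w j : ℂ)) t := fun j =>
    continuous_ofReal.continuousAt.comp' (continuousAt_pi.mp hxt j)
  refine Eventually.and ?_ (Eventually.and ?_ ?_)
  · simp only [eventually_all]
    intro j k hjk
    exact (hc.continuousAt.comp' ((hx' j).sub (hx' k))).eventually_ne (h1 j k hjk)
  · simp only [eventually_all]
    intro j k hjk
    exact (hc.continuousAt.comp' ((hxt' j).sub (hxt' k))).eventually_ne (h2 j k hjk)
  · simp only [eventually_all]
    intro j k
    exact (hc.continuousAt.comp' ((hx' j).sub (hxt' k))).eventually_ne (h3 j k)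

/-- This passes from a sum over pairs to a sum over particles, each velocity multiplying the total
force on its particle. -/
lemma sum_sum_Ioi_mul_sub {n : ℕ} (F : Fin n → Fin n → ℂ) (hF : ∀ j k, F k j = -F j k)
    (v : Fin n → ℂ) :
    ∑ j, ∑ k ∈ Finset.Ioi j, F j k * (v j - v k) = ∑ j, v j * ∑ k, F j k := by
  have h := Finset.sum_sum_Ioi_add_eq_sum_sum_off_diag fun j k => F k j * v k
  have hF0 : ∀ j, F j j = 0 := fun j => by linear_combination hF j j / 2
  have e1 : ∑ j, ∑ k ∈ Finset.Ioi j, F j k * (v j - v k) =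
      ∑ j, ∑ k ∈ Finset.Ioi j, (F j k * v j + F k j * v k) :=
    Finset.sum_congr rfl fun j _ => Finset.sum_congr rfl fun k _ => by rw [hF j k]; ring
  rw [e1]
  refine h.trans ?_
  refine Finset.sum_congr rfl fun j _ => ?_
  rw [Finset.mul_sum, ← Finset.sum_compl_add_sum {j}, Finset.sum_singleton, hF0, mul_zero, add_zero]
  exact Finset.sum_congr rfl fun k _ => mul_comm _ _

/-- The logarithmic derivative of `Psi0` along a curve. -/
lemma hasDerivAt_Psi0 (hβ : 0 < β) {lam : ℂ} (hlam : lam ≠ 0) {N Nt : ℕ} {x : ℝ → Fin N → ℝ}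
    {xt : ℝ → Fin Nt → ℝ} {v : Fin N → ℝ} {vt : Fin Nt → ℝ} {t : ℝ} (hx : HasDerivAt x v t)
    (hxt : HasDerivAt xt vt t) (h : NonSingular β (x t) (xt t)) :
    HasDerivAt (fun t => Psi0 β lam (x t) (xt t))
      ((∑ j, (v j : ℂ) * (lam * ∑ k, phi β (x t j - x t k) - ∑ J, phi β (x t j - xt t J)) +
        ∑ J, (vt J : ℂ) * (1 / lam * ∑ K, phi β (xt t J - xt t K) -
          ∑ j, phi β (xt t J - x t j))) * Psi0 β lam (x t) (xt t)) t := by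
  have hx' := hasDerivAt_pi.mp hx
  have hxt' := hasDerivAt_pi.mp hxt
  obtain ⟨h1, h2, h3⟩ := h
  have f1 : ∀ j, ∀ k ∈ Finset.Ioi j, HasDerivAt
      (fun t => theta β ((x t j : ℂ) - (x t k : ℂ)) ^ lam)
      (lam * phi β (x t j - x t k) * (v j - v k) * theta β ((x t j : ℂ) - (x t k : ℂ)) ^ lam) t :=
    fun j k hk => by
    have := hasDerivAt_theta_ofReal_cpow hβ hlam ((hx' j).fun_sub (hx' k))
      (by rw [ofReal_sub]; exact h1 j k (Finset.mem_Ioi.mp hk).ne)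
    simpa only [ofReal_sub] using this
  have f2 : ∀ j, ∀ k ∈ Finset.Ioi j, HasDerivAt
      (fun t => theta β ((xt t j : ℂ) - (xt t k : ℂ)) ^ (1 / lam))
      (1 / lam * phi β (xt t j - xt t k) * (vt j - vt k) *
        theta β ((xt t j : ℂ) - (xt t k : ℂ)) ^ (1 / lam)) t :=
    fun j k hk => by
    have := hasDerivAt_theta_ofReal_cpow hβ (one_div_ne_zero hlam) ((hxt' j).fun_sub (hxt' k))
      (by rw [ofReal_sub]; exact h2 j k (Finset.mem_Ioi.mp hk).ne)
    simpa only [ofReal_sub] using this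
  have f3 : ∀ j J, HasDerivAt (fun t => theta β ((x t j : ℂ) - (xt t J : ℂ)))
      (phi β (x t j - xt t J) * (v j - vt J) * theta β ((x t j : ℂ) - (xt t J : ℂ))) t :=
    fun j J => by
    have := (hasDerivAt_theta hβ (h3 j J)).scomp t
      (((hx' j).ofReal_comp).fun_sub ((hxt' J).ofReal_comp))
    exact this.congr_deriv (by rw [smul_eq_mul]; ring)
  have g1 := hasDerivAt_prod_of_logDeriv (s := Finset.univ)
    fun j _ => hasDerivAt_prod_of_logDeriv (f1 j)
  have g2 := hasDerivAt_prod_of_logDeriv (s := Finset.univ)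
    fun j _ => hasDerivAt_prod_of_logDeriv (f2 j)
  have g3 := hasDerivAt_prod_of_logDeriv (s := Finset.univ)
    fun j _ => hasDerivAt_prod_of_logDeriv (s := Finset.univ) fun J _ => f3 j J
  have hne : ∏ j, ∏ J, theta β ((x t j : ℂ) - (xt t J : ℂ)) ≠ 0 :=
    Finset.prod_ne_zero_iff.mpr fun j _ => Finset.prod_ne_zero_iff.mpr fun J _ => h3 j J
  have g := (g1.fun_mul g2).fun_div g3 hne
  unfold Psi0
  refine g.congr_deriv ?_
  have e1 := sum_sum_Ioi_mul_sub (fun j k => lam * phi β (x t j - x t k))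
    (fun j k => by rw [← neg_sub, phi_neg]; ring) fun j => v j
  have e2 := sum_sum_Ioi_mul_sub (fun j k => 1 / lam * phi β (xt t j - xt t k))
    (fun j k => by rw [← neg_sub, phi_neg]; ring) fun j => vt j
  have e3 : ∑ j, ∑ J, phi β (x t j - xt t J) * (v j - vt J) =
      ∑ j, v j * ∑ J, phi β (x t j - xt t J) + ∑ J, vt J * ∑ j, phi β (xt t J - x t j) := by
    have : ∀ j J, phi β (x t j - xt t J) * (v j - vt J) =
        v j * phi β (x t j - xt t J) + vt J * phi β (xt t J - x t j) := fun j J => by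
      rw [← neg_sub (x t j : ℂ), phi_neg]; ring
    simp only [this, Finset.sum_add_distrib, Finset.mul_sum]
    congr 1
    exact Finset.sum_comm
  have e4 : ∑ j, (v j : ℂ) * (lam * ∑ k, phi β (x t j - x t k) - ∑ J, phi β (x t j - xt t J)) =
      ∑ j, v j * ∑ k, lam * phi β (x t j - x t k) - ∑ j, v j * ∑ J, phi β (x t j - xt t J) := by
    simp only [mul_sub, Finset.sum_sub_distrib, Finset.mul_sum]
  have e5 : ∑ J, (vt J : ℂ) * (1 / lam * ∑ K, phi β (xt t J - xt t K) -
        ∑ j, phi β (xt t J - x t j)) =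
      ∑ J, vt J * ∑ K, 1 / lam * phi β (xt t J - xt t K) -
        ∑ J, vt J * ∑ j, phi β (xt t J - x t j) := by
    simp only [mul_sub, Finset.sum_sub_distrib, Finset.mul_sum]
  rw [e1, e2, e3, e4, e5]
  generalize (∏ j, ∏ J, theta β ((x t j : ℂ) - (xt t J : ℂ))) = D at *
  generalize ∑ j, (v j : ℂ) * ∑ k, lam * phi β (x t j - x t k) = S1
  generalize ∑ j, (v j : ℂ) * ∑ J, phi β (x t j - xt t J) = S2
  generalize ∑ J, (vt J : ℂ) * ∑ K, 1 / lam * phi β (xt t J - xt t K) = S3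
  generalize ∑ J, (vt J : ℂ) * ∑ j, phi β (xt t J - x t j) = S4
  field_simp
  ring

lemma contDiffAt_Psi0 (hβ : 0 < β) (lam : ℂ) {N Nt : ℕ} {p : (Fin N → ℝ) × (Fin Nt → ℝ)}
    (h : NonSingular β p.1 p.2) :
    ContDiffAt ℝ 2 (fun p : (Fin N → ℝ) × (Fin Nt → ℝ) => Psi0 β lam p.1 p.2) p := by
  obtain ⟨h1, h2, h3⟩ := h
  have c1 : ∀ j, ContDiff ℝ 2 fun p : (Fin N → ℝ) × (Fin Nt → ℝ) => p.1 j := fun j => by fun_prop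
  have c2 : ∀ j, ContDiff ℝ 2 fun p : (Fin N → ℝ) × (Fin Nt → ℝ) => p.2 j := fun j => by fun_prop
  simp only [Psi0, div_eq_mul_inv _ (∏ j, ∏ J, _)]
  refine ContDiffAt.mul (ContDiffAt.mul ?_ ?_) (ContDiffAt.inv ?_ ?_)
  · refine contDiffAt_prod fun j _ => contDiffAt_prod fun k hk => ?_
    have := (contDiffAt_theta_ofReal_cpow hβ lam (r := p.1 j - p.1 k)
      (by rw [ofReal_sub]; exact h1 j k (Finset.mem_Ioi.mp hk).ne)).comp p
      ((c1 j).sub (c1 k)).contDiffAt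
    simpa only [Function.comp_def, ofReal_sub] using this
  · refine contDiffAt_prod fun j _ => contDiffAt_prod fun k hk => ?_
    have := (contDiffAt_theta_ofReal_cpow hβ (1 / lam) (r := p.2 j - p.2 k)
      (by rw [ofReal_sub]; exact h2 j k (Finset.mem_Ioi.mp hk).ne)).comp p
      ((c2 j).sub (c2 k)).contDiffAt
    simpa only [Function.comp_def, ofReal_sub] using this
  · refine contDiffAt_prod fun j _ => contDiffAt_prod fun J _ => ?_
    have := (contDiff_comp_ofReal (differentiable_theta hβ)).comp ((c1 j).sub (c2 J))
    simpa only [Function.comp_def, ofReal_sub] using this.contDiffAt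
  · exact Finset.prod_ne_zero_iff.mpr fun j _ => Finset.prod_ne_zero_iff.mpr fun J _ => h3 j J

lemma Psi0_ne_zero {lam : ℂ} {N Nt : ℕ} {x : Fin N → ℝ} {xt : Fin Nt → ℝ}
    (h : NonSingular β x xt) : Psi0 β lam x xt ≠ 0 := by
  obtain ⟨h1, h2, h3⟩ := h
  unfold Psi0
  refine div_ne_zero (mul_ne_zero ?_ ?_) ?_
  · refine Finset.prod_ne_zero_iff.mpr fun j _ => Finset.prod_ne_zero_iff.mpr fun k hk => ?_
    exact cpow_ne_zero_iff.mpr (Or.inl <| h1 j k (Finset.mem_Ioi.mp hk).ne)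
  · refine Finset.prod_ne_zero_iff.mpr fun j _ => Finset.prod_ne_zero_iff.mpr fun k hk => ?_
    exact cpow_ne_zero_iff.mpr (Or.inl <| h2 j k (Finset.mem_Ioi.mp hk).ne)
  · exact Finset.prod_ne_zero_iff.mpr fun j _ => Finset.prod_ne_zero_iff.mpr fun J _ => h3 j J

end EllipticCS
end

/-! ### The generating function in the variable `y`, and second derivatives of `Psi`. -/

noncomputable section

namespace EllipticCS

open Complex Filter Topology

variable {β : ℝ}

/-- The generating function at `ξ = exp (i y)`. -/
def kernel (β : ℝ) (lam : ℂ) {N Nt : ℕ} (x : Fin N → ℝ) (xt : Fin Nt → ℝ) (y : ℂ) : ℂ :=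
  genFun β lam x xt (cexp (I * y))

lemma kernel_eq (β : ℝ) (lam : ℂ) {N Nt : ℕ} (x : Fin N → ℝ) (xt : Fin Nt → ℝ) (y : ℂ) :
    kernel β lam x xt y = (∏ j, thetaCheckPow β (-lam) (cexp (I * (x j - y)))) *
      ∏ J, thetaCheck β (cexp (I * (xt J - y))) := by
  simp only [kernel, genFun, ← Complex.exp_sub, mul_sub]

lemma kernel_add_two_pi (β : ℝ) (lam : ℂ) {N Nt : ℕ} (x : Fin N → ℝ) (xt : Fin Nt → ℝ) (y : ℂ) :
    kernel β lam x xt (y + 2 * Real.pi) = kernel β lam x xt y := by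
  unfold kernel
  rw [mul_add, show I * (2 * Real.pi : ℂ) = 2 * Real.pi * I by ring, Complex.exp_periodic]

/-- The logarithmic derivative of the generating function along a curve. -/
lemma hasDerivAt_kernel (hβ : 0 < β) (lam : ℂ) {N Nt : ℕ} {x : ℝ → Fin N → ℝ}
    {xt : ℝ → Fin Nt → ℝ} {y : ℝ → ℂ} {v : Fin N → ℝ} {vt : Fin Nt → ℝ} {vy : ℂ} {t : ℝ}
    (hx : HasDerivAt x v t) (hxt : HasDerivAt xt vt t) (hy : HasDerivAt y vy t)
    (him : 0 < -(y t).im ∧ -(y t).im < β) :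
    HasDerivAt (fun t => kernel β lam (x t) (xt t) (y t))
      ((∑ j, (-lam * (phi β (x t j - y t) + I / 2)) * (v j - vy) +
        ∑ J, (phi β (xt t J - y t) + I / 2) * (vt J - vy)) * kernel β lam (x t) (xt t) (y t)) t := by
  have hx' := hasDerivAt_pi.mp hx
  have hxt' := hasDerivAt_pi.mp hxt
  have im : ∀ r : ℝ, 0 < ((r : ℂ) - y t).im ∧ ((r : ℂ) - y t).im < β := fun r => by
    simpa using him
  have f1 : ∀ j, HasDerivAt (fun t => thetaCheckPow β (-lam) (cexp (I * (x t j - y t))))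
      ((-lam * (phi β (x t j - y t) + I / 2)) * (v j - vy) *
        thetaCheckPow β (-lam) (cexp (I * (x t j - y t)))) t := fun j => by
    have := (hasDerivAt_thetaCheckPow_exp hβ (-lam) (im (x t j))).scomp t
      ((hx' j).ofReal_comp.fun_sub hy)
    exact this.congr_deriv (by rw [smul_eq_mul]; ring)
  have f2 : ∀ J, HasDerivAt (fun t => thetaCheck β (cexp (I * (xt t J - y t))))
      ((phi β (xt t J - y t) + I / 2) * (vt J - vy) *
        thetaCheck β (cexp (I * (xt t J - y t)))) t := fun J => by
    have := (hasDerivAt_thetaCheck_exp hβ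
      (theta_ne_zero_of_im_mem hβ (im (xt t J)).1 (im (xt t J)).2)).scomp t
      ((hxt' J).ofReal_comp.fun_sub hy)
    exact this.congr_deriv (by rw [smul_eq_mul]; ring)
  have g1 := hasDerivAt_prod_of_logDeriv (s := Finset.univ) fun j _ => f1 j
  have g2 := hasDerivAt_prod_of_logDeriv (s := Finset.univ) fun j _ => f2 j
  simp only [kernel_eq]
  exact (g1.fun_mul g2).congr_deriv (by ring)

lemma contDiff_comp_add_I_mul {f : ℂ → ℂ} {η : ℝ}
    (hf : DifferentiableOn ℂ f {r | 0 < r.im ∧ r.im < β}) (h0 : 0 < η) (h1 : η < β) :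
    ContDiff ℝ 2 fun t : ℝ => f (t + I * η) := by
  have h := (hf.contDiffOn (n := 2) (isOpen_upper_strip β)).restrict_scalars ℝ
  refine h.comp_contDiff (f := fun t : ℝ => (t + I * η : ℂ))
    (ofRealCLM.contDiff.add contDiff_const) fun t => ?_
  simpa using ⟨h0, h1⟩

/-- For real positions, every difference `x_j - y` with `y = s - iη` has height `η`, inside the
strip where the factors are holomorphic. -/
lemma contDiff_kernel (hβ : 0 < β) (lam : ℂ) (N Nt : ℕ) {η : ℝ} (h0 : 0 < η) (h1 : η < β) :
    ContDiff ℝ 2 fun z : ((Fin N → ℝ) × (Fin Nt → ℝ)) × ℝ =>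
      kernel β lam z.1.1 z.1.2 (z.2 - I * η) := by
  have d1 : DifferentiableOn ℂ (fun r => thetaCheckPow β (-lam) (cexp (I * r)))
      {r | 0 < r.im ∧ r.im < β} := fun r hr =>
    (hasDerivAt_thetaCheckPow_exp hβ (-lam) hr).differentiableAt.differentiableWithinAt
  have d2 : DifferentiableOn ℂ (fun r => thetaCheck β (cexp (I * r)))
      {r | 0 < r.im ∧ r.im < β} := fun r hr => (hasDerivAt_thetaCheck_exp hβ
    (theta_ne_zero_of_im_mem hβ hr.1 hr.2)).differentiableAt.differentiableWithinAt
  have e : ∀ u s : ℝ, (u : ℂ) - (s - I * η) = ((u - s : ℝ) : ℂ) + I * η := fun u s => by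
    push_cast; ring
  simp only [kernel_eq, e]
  refine ContDiff.mul (contDiff_prod fun j _ => ?_) (contDiff_prod fun J _ => ?_)
  · exact (contDiff_comp_add_I_mul d1 h0 h1).comp
      (g := fun t : ℝ => thetaCheckPow β (-lam) (cexp (I * (t + I * η))))
      (f := fun z : ((Fin N → ℝ) × (Fin Nt → ℝ)) × ℝ => z.1.1 j - z.2) (by fun_prop)
  · exact (contDiff_comp_add_I_mul d2 h0 h1).comp
      (g := fun t : ℝ => thetaCheck β (cexp (I * (t + I * η))))
      (f := fun z : ((Fin N → ℝ) × (Fin Nt → ℝ)) × ℝ => z.1.2 J - z.2) (by fun_prop)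

/-- The circle `|ξ| = R` is the segment `y = s - i log R` of one period; the condition `1 < R < q⁻²`
becomes `0 < log R < β`. -/
lemma circleMap_eq_exp {R : ℝ} (hR : 0 < R) (s : ℝ) :
    circleMap 0 R s = cexp (I * (s - I * Real.log R)) := by
  rw [circleMap, zero_add, mul_sub, ← mul_assoc, I_mul_I, sub_eq_add_neg, Complex.exp_add, neg_mul,
    one_mul, neg_neg, ← ofReal_exp, Real.exp_log hR, mul_comm I]
  ring

lemma laurentCoeff_eq {R : ℝ} (hR : 0 < R) (lam : ℂ) (n : ℤ) {N Nt : ℕ} (x : Fin N → ℝ)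
    (xt : Fin Nt → ℝ) :
    laurentCoeff β lam R n x xt = (2 * Real.pi : ℂ)⁻¹ * R ^ n * ∫ s in (0 : ℝ)..2 * Real.pi,
      cexp (I * n * s) * kernel β lam x xt (s - I * Real.log R) := by
  have hR' : (R : ℂ) ≠ 0 := by exact_mod_cast hR.ne'
  have e : ∀ s : ℝ, deriv (circleMap 0 R) s • ((circleMap 0 R s)⁻¹ * circleMap 0 R s ^ n *
      genFun β lam x xt (circleMap 0 R s)) =
      I * R ^ n * (cexp (I * n * s) * kernel β lam x xt (s - I * Real.log R)) := fun s => by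
    have h1 : circleMap 0 R s ≠ 0 := circleMap_ne_center hR.ne'
    have h2 : circleMap 0 R s ^ n = R ^ n * cexp (I * n * s) := by
      rw [circleMap, zero_add, mul_zpow, ← Complex.exp_int_mul]
      congr 2
      ring
    rw [h2, kernel, ← circleMap_eq_exp hR, deriv_circleMap, smul_eq_mul]
    field_simp
  rw [laurentCoeff, circleIntegral]
  simp only [e]
  rw [intervalIntegral.integral_const_mul]
  have : (Real.pi : ℂ) ≠ 0 := by exact_mod_cast Real.pi_ne_zero
  field_simp [I_ne_zero]

section SecondDerivatives

variable {lam : ℂ} {N Nt : ℕ}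

lemma hasDerivAt_sum_phi_sub_update (hβ : 0 < β) {n : ℕ} (x : Fin n → ℝ) (j : Fin n)
    (h : ∀ k, j ≠ k → theta β ((x j : ℂ) - x k) ≠ 0) :
    HasDerivAt (fun w : ℝ => ∑ k, phi β ((w : ℂ) - (Function.update x j w k : ℝ)))
      (∑ k, if j = k then 0 else deriv (phi β) ((x j : ℂ) - x k)) (x j) := by
  refine HasDerivAt.fun_sum fun k _ => ?_
  split_ifs with hjk
  · subst hjk
    simpa using hasDerivAt_const (x j) (phi β 0)
  · simp only [Function.update_of_ne (Ne.symm hjk)]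
    have := (hasDerivAt_phi hβ (h k hjk)).scomp (x j)
      ((hasDerivAt_id (x j)).ofReal_comp.sub_const (x k : ℂ))
    simpa using! this

lemma hasDerivAt_sum_phi_sub (hβ : 0 < β) {n : ℕ} (x : Fin n → ℝ) (t : ℝ)
    (h : ∀ k, theta β ((t : ℂ) - x k) ≠ 0) :
    HasDerivAt (fun w : ℝ => ∑ k, phi β ((w : ℂ) - x k))
      (∑ k, deriv (phi β) ((t : ℂ) - x k)) t := by
  refine HasDerivAt.fun_sum fun k _ => ?_
  have := (hasDerivAt_phi hβ (h k)).scomp t ((hasDerivAt_id t).ofReal_comp.sub_const (x k : ℂ))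
  simpa using! this

lemma hasDerivAt_phi_sub_const (hβ : 0 < β) {y : ℂ} (him : 0 < -y.im ∧ -y.im < β) (t : ℝ) :
    HasDerivAt (fun w : ℝ => phi β ((w : ℂ) - y)) (deriv (phi β) ((t : ℂ) - y)) t := by
  have := (hasDerivAt_phi hβ (theta_ne_zero_of_im_mem hβ (r := (t : ℂ) - y) (by simpa using him.1)
    (by simpa using him.2))).scomp t ((hasDerivAt_id t).ofReal_comp.sub_const y)
  simpa using! this

variable (β lam) in
/-- `(∂² Φ) / Φ` with respect to `x_j`, for `Φ` the product of `Psi0` and `kernel`. -/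
def secondLogDerivX (x : Fin N → ℝ) (xt : Fin Nt → ℝ) (y : ℂ) (j : Fin N) : ℂ :=
  (lam * (∑ k, if j = k then 0 else deriv (phi β) ((x j : ℂ) - x k)) -
      ∑ J, deriv (phi β) ((x j : ℂ) - xt J)) + -lam * deriv (phi β) ((x j : ℂ) - y) +
    ((lam * ∑ k, phi β ((x j : ℂ) - x k) - ∑ J, phi β ((x j : ℂ) - xt J)) +
      -lam * (phi β ((x j : ℂ) - y) + I / 2)) ^ 2

variable (β lam) in
/-- `(∂² Φ) / Φ` with respect to `x̃_J`, for `Φ` the product of `Psi0` and `kernel`. -/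
def secondLogDerivXt (x : Fin N → ℝ) (xt : Fin Nt → ℝ) (y : ℂ) (J : Fin Nt) : ℂ :=
  (1 / lam * (∑ K, if J = K then 0 else deriv (phi β) ((xt J : ℂ) - xt K)) -
      ∑ j, deriv (phi β) ((xt J : ℂ) - x j)) + deriv (phi β) ((xt J : ℂ) - y) +
    ((1 / lam * ∑ K, phi β ((xt J : ℂ) - xt K) - ∑ j, phi β ((xt J : ℂ) - x j)) +
      (phi β ((xt J : ℂ) - y) + I / 2)) ^ 2

variable (β lam) in
/-- `(∂² Φ) / Φ` with respect to `y`, for `Φ` the product of `Psi0` and `kernel`. -/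
def secondLogDerivY (x : Fin N → ℝ) (xt : Fin Nt → ℝ) (y : ℂ) : ℂ :=
  (-lam * ∑ j, deriv (phi β) ((x j : ℂ) - y) * (-1) + ∑ J, deriv (phi β) ((xt J : ℂ) - y) * (-1)) *
      (-1) +
    ((-lam * ∑ j, (phi β ((x j : ℂ) - y) + I / 2) + ∑ J, (phi β ((xt J : ℂ) - y) + I / 2)) *
      (-1)) ^ 2

lemma Psi_eq {R : ℝ} (hR : 0 < R) (n : ℤ) (x : Fin N → ℝ) (xt : Fin Nt → ℝ) :
    Psi β lam R n x xt = ((2 * Real.pi : ℂ)⁻¹ * R ^ n * Psi0 β lam x xt) *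
      ∫ s in (0 : ℝ)..2 * Real.pi,
        cexp (I * n * s) * kernel β lam x xt (s - I * Real.log R) := by
  rw [Psi, laurentCoeff_eq hR]
  ring

lemma im_shift (s η : ℝ) : ((s : ℂ) - I * η).im = -η := by simp

lemma contDiff_exp_mul_kernel (hβ : 0 < β) (lam : ℂ) (n : ℤ) {η : ℝ} (h0 : 0 < η) (h1 : η < β) :
    ContDiff ℝ 2 fun z : ((Fin N → ℝ) × (Fin Nt → ℝ)) × ℝ =>
      cexp (I * n * z.2) * kernel β lam z.1.1 z.1.2 (z.2 - I * η) := by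
  refine ContDiff.mul ?_ (contDiff_kernel hβ lam N Nt h0 h1)
  have : ContDiff ℝ 2 fun z : ((Fin N → ℝ) × (Fin Nt → ℝ)) × ℝ => (z.2 : ℂ) :=
    ofRealCLM.contDiff.comp contDiff_snd
  exact (contDiff_const.mul this).cexp

/-- `A` and `B` are the logarithmic derivatives in `x_j` of `Psi0` and of the kernel. The second
derivative of the integral is the integral of `A' + B' + (A + B)²` against the product. -/
lemma iteratedDeriv_two_Psi_update_left (hβ : 0 < β) (hlam : lam ≠ 0) {R : ℝ} (hR : 0 < R)
    (h0 : 0 < Real.log R) (h1 : Real.log R < β) (n : ℤ) {x : Fin N → ℝ} {xt : Fin Nt → ℝ}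
    (hns : NonSingular β x xt) (j : Fin N) :
    iteratedDeriv 2 (fun t => Psi β lam R n (Function.update x j t) xt) (x j) =
      ∫ s in (0 : ℝ)..2 * Real.pi, secondLogDerivX β lam x xt (s - I * Real.log R) j *
        (((2 * Real.pi : ℂ)⁻¹ * R ^ n * Psi0 β lam x xt) *
          (cexp (I * n * s) * kernel β lam x xt (s - I * Real.log R))) := by
  have him : ∀ s : ℝ, 0 < -((s : ℂ) - I * Real.log R).im ∧ -((s : ℂ) - I * Real.log R).im < β :=
    fun s => by rw [im_shift, neg_neg]; exact ⟨h0, h1⟩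
  have hc : ContinuousAt (fun w => Function.update x j w) (x j) :=
    (hasDerivAt_update x j (x j)).continuousAt
  have hev : ∀ᶠ w in 𝓝 (x j), NonSingular β (Function.update x j w) xt :=
    eventually_nonSingular hβ hc continuousAt_const (by simpa using hns)
  simp only [Psi_eq hR]
  rw [iteratedDeriv_two_mul_intervalIntegral
    (A := fun w => lam * ∑ k, phi β ((w : ℂ) - (Function.update x j w k : ℝ)) -
      ∑ J, phi β ((w : ℂ) - xt J))
    (A' := lam * (∑ k, if j = k then 0 else deriv (phi β) ((x j : ℂ) - x k)) -
      ∑ J, deriv (phi β) ((x j : ℂ) - xt J))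
    (f := fun w s => cexp (I * n * s) * kernel β lam (Function.update x j w) xt
      (s - I * Real.log R))
    (B := fun w s => -lam * (phi β ((w : ℂ) - (s - I * Real.log R)) + I / 2))
    (B' := fun s => -lam * deriv (phi β) ((x j : ℂ) - (s - I * Real.log R)))]
  · simp only [Function.update_eq_self]
    rfl
  · exact (contDiff_exp_mul_kernel hβ lam n h0 h1).comp
      (f := fun z : ℝ × ℝ => ((Function.update x j z.1, xt), z.2))
      ((((contDiff_update 2 x j).comp contDiff_fst).prodMk contDiff_const).prodMk contDiff_snd)
  · filter_upwards [hev] with w hw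
    have := (hasDerivAt_Psi0 hβ hlam (hasDerivAt_update x j w) (hasDerivAt_const w xt) hw).const_mul
      ((2 * Real.pi : ℂ)⁻¹ * R ^ n)
    refine this.congr_deriv ?_
    rw [Finset.sum_eq_single j (fun k _ hk => by simp [hk]) (by simp)]
    simp only [Pi.zero_apply, Pi.single_eq_same, Function.update_self, ofReal_zero, zero_mul,
      Finset.sum_const_zero, ofReal_one, add_zero]
    ring
  · exact ((hasDerivAt_sum_phi_sub_update hβ x j (hns.1 j)).const_mul lam).fun_sub
      (hasDerivAt_sum_phi_sub hβ xt (x j) (hns.2.2 j))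
  · intro w s
    have := (hasDerivAt_kernel hβ lam (hasDerivAt_update x j w) (hasDerivAt_const w xt)
      (hasDerivAt_const w ((s : ℂ) - I * Real.log R)) (him s)).const_mul (cexp (I * n * s))
    refine this.congr_deriv ?_
    rw [Finset.sum_eq_single j (fun k _ hk => by simp [hk]) (by simp)]
    simp only [Pi.zero_apply, Pi.single_eq_same, Function.update_self, ofReal_zero, sub_zero,
      mul_zero, Finset.sum_const_zero, ofReal_one, add_zero]
    ring
  · intro s
    exact ((hasDerivAt_phi_sub_const hβ (him s) (x j)).add_const (I / 2)).const_mul (-lam)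

lemma iteratedDeriv_two_Psi_update_right (hβ : 0 < β) (hlam : lam ≠ 0) {R : ℝ} (hR : 0 < R)
    (h0 : 0 < Real.log R) (h1 : Real.log R < β) (n : ℤ) {x : Fin N → ℝ} {xt : Fin Nt → ℝ}
    (hns : NonSingular β x xt) (J : Fin Nt) :
    iteratedDeriv 2 (fun t => Psi β lam R n x (Function.update xt J t)) (xt J) =
      ∫ s in (0 : ℝ)..2 * Real.pi, secondLogDerivXt β lam x xt (s - I * Real.log R) J *
        (((2 * Real.pi : ℂ)⁻¹ * R ^ n * Psi0 β lam x xt) *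
          (cexp (I * n * s) * kernel β lam x xt (s - I * Real.log R))) := by
  have him : ∀ s : ℝ, 0 < -((s : ℂ) - I * Real.log R).im ∧ -((s : ℂ) - I * Real.log R).im < β :=
    fun s => by rw [im_shift, neg_neg]; exact ⟨h0, h1⟩
  have hc : ContinuousAt (fun w => Function.update xt J w) (xt J) :=
    (hasDerivAt_update xt J (xt J)).continuousAt
  have hev : ∀ᶠ w in 𝓝 (xt J), NonSingular β x (Function.update xt J w) :=
    eventually_nonSingular hβ continuousAt_const hc (by simpa using hns)
  have hne : ∀ k, theta β ((xt J : ℂ) - x k) ≠ 0 := fun k => by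
    rw [← neg_sub, theta_neg, neg_ne_zero]
    exact hns.2.2 k J
  simp only [Psi_eq hR]
  rw [iteratedDeriv_two_mul_intervalIntegral
    (A := fun w => 1 / lam * ∑ k, phi β ((w : ℂ) - (Function.update xt J w k : ℝ)) -
      ∑ j, phi β ((w : ℂ) - x j))
    (A' := 1 / lam * (∑ k, if J = k then 0 else deriv (phi β) ((xt J : ℂ) - xt k)) -
      ∑ j, deriv (phi β) ((xt J : ℂ) - x j))
    (f := fun w s => cexp (I * n * s) * kernel β lam x (Function.update xt J w)
      (s - I * Real.log R))
    (B := fun w s => phi β ((w : ℂ) - (s - I * Real.log R)) + I / 2)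
    (B' := fun s => deriv (phi β) ((xt J : ℂ) - (s - I * Real.log R)))]
  · simp only [Function.update_eq_self]
    rfl
  · exact (contDiff_exp_mul_kernel hβ lam n h0 h1).comp
      (f := fun z : ℝ × ℝ => ((x, Function.update xt J z.1), z.2))
      ((contDiff_const.prodMk ((contDiff_update 2 xt J).comp contDiff_fst)).prodMk contDiff_snd)
  · filter_upwards [hev] with w hw
    have := (hasDerivAt_Psi0 hβ hlam (hasDerivAt_const w x) (hasDerivAt_update xt J w) hw).const_mul
      ((2 * Real.pi : ℂ)⁻¹ * R ^ n)
    refine this.congr_deriv ?_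
    rw [Finset.sum_eq_single (s := Finset.univ (α := Fin Nt)) J (fun k _ hk => by simp [hk])
      (by simp)]
    simp only [Pi.zero_apply, Pi.single_eq_same, Function.update_self, ofReal_zero, zero_mul,
      Finset.sum_const_zero, ofReal_one, zero_add]
    ring
  · exact ((hasDerivAt_sum_phi_sub_update hβ xt J (hns.2.1 J)).const_mul (1 / lam)).fun_sub
      (hasDerivAt_sum_phi_sub hβ x (xt J) hne)
  · intro w s
    have := (hasDerivAt_kernel hβ lam (hasDerivAt_const w x) (hasDerivAt_update xt J w)
      (hasDerivAt_const w ((s : ℂ) - I * Real.log R)) (him s)).const_mul (cexp (I * n * s))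
    refine this.congr_deriv ?_
    rw [Finset.sum_eq_single (s := Finset.univ (α := Fin Nt)) J (fun k _ hk => by simp [hk])
      (by simp)]
    simp only [Pi.zero_apply, Pi.single_eq_same, Function.update_self, ofReal_zero, sub_zero,
      mul_zero, Finset.sum_const_zero, ofReal_one, zero_add]
    ring
  · intro s
    exact (hasDerivAt_phi_sub_const hβ (him s) (xt J)).add_const (I / 2)

lemma hasDerivAt_phi_sub_shift (hβ : 0 < β) {η : ℝ} (h0 : 0 < η) (h1 : η < β) (r s : ℝ) :
    HasDerivAt (fun s : ℝ => phi β ((r : ℂ) - (s - I * η)))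
      (deriv (phi β) ((r : ℂ) - (s - I * η)) * (-1)) s := by
  have hd : HasDerivAt (fun s : ℝ => (r : ℂ) - (s - I * η)) (-1) s :=
    (((hasDerivAt_id s).ofReal_comp).sub_const _).const_sub _
  have := (hasDerivAt_phi hβ (theta_ne_zero_of_im_mem hβ (r := (r : ℂ) - (s - I * η))
    (by simpa using h0) (by simpa using h1))).scomp s hd
  exact this.congr_deriv (by rw [smul_eq_mul, mul_comm])

lemma continuous_deriv_phi_sub_shift (hβ : 0 < β) {η : ℝ} (h0 : 0 < η) (h1 : η < β) (r : ℝ) :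
    Continuous fun s : ℝ => deriv (phi β) ((r : ℂ) - (s - I * η)) := by
  refine continuous_iff_continuousAt.mpr fun s => ?_
  have := (analyticAt_phi hβ (theta_ne_zero_of_im_mem hβ (r := (r : ℂ) - (s - I * η))
    (by simpa using h0) (by simpa using h1))).deriv.continuousAt
  exact this.comp' (f := fun s : ℝ => (r : ℂ) - (s - I * η)) (by fun_prop)

lemma continuous_phi_sub_shift (hβ : 0 < β) {η : ℝ} (h0 : 0 < η) (h1 : η < β) (r : ℝ) :
    Continuous fun s : ℝ => phi β ((r : ℂ) - (s - I * η)) :=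
  continuous_iff_continuousAt.mpr fun s => (hasDerivAt_phi_sub_shift hβ h0 h1 r s).continuousAt

/-- Since `y = s - iη`, derivatives in `y` are derivatives along the contour, and integrating by
parts twice against `e^{ins}` gives `(in)² = -n²`. -/
lemma integral_secondLogDerivY (hβ : 0 < β) (lam : ℂ) {η : ℝ} (h0 : 0 < η) (h1 : η < β) (n : ℤ)
    (x : Fin N → ℝ) (xt : Fin Nt → ℝ) :
    ∫ s in (0 : ℝ)..2 * Real.pi, cexp (I * n * s) *
        (secondLogDerivY β lam x xt (s - I * η) * kernel β lam x xt (s - I * η)) =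
      -(n : ℂ) ^ 2 * ∫ s in (0 : ℝ)..2 * Real.pi,
        cexp (I * n * s) * kernel β lam x xt (s - I * η) := by
  have hd := fun r s => hasDerivAt_phi_sub_shift hβ h0 h1 r s
  have cd := fun r => continuous_deriv_phi_sub_shift hβ h0 h1 r
  have hp : ∀ r : ℝ, (r : ℂ) - ((2 * Real.pi : ℝ) - I * η) + 2 * Real.pi =
      (r : ℂ) - ((0 : ℝ) - I * η) := fun r => by push_cast; ring
  have key := integral_exp_mul_deriv_two (T := 2 * Real.pi) (c := I * n)
    (f := fun s : ℝ => kernel β lam x xt (s - I * η))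
    (B := fun s => (-lam * ∑ j, (phi β ((x j : ℂ) - (s - I * η)) + I / 2) +
      ∑ J, (phi β ((xt J : ℂ) - (s - I * η)) + I / 2)) * (-1))
    (B' := fun s => (-lam * ∑ j, deriv (phi β) ((x j : ℂ) - (s - I * η)) * (-1) +
      ∑ J, deriv (phi β) ((xt J : ℂ) - (s - I * η)) * (-1)) * (-1)) ?_ ?_ ?_ ?_ ?_
  · rw [mul_pow, I_sq, neg_one_mul] at key
    exact key
  · intro s
    have := hasDerivAt_kernel hβ lam (hasDerivAt_const s x) (hasDerivAt_const s xt)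
      (((hasDerivAt_id s).ofReal_comp).sub_const (I * η)) (by simpa using ⟨h0, h1⟩)
    refine this.congr_deriv ?_
    simp only [Pi.zero_apply, ofReal_zero, ofReal_one, zero_sub, ← Finset.sum_mul, ← Finset.mul_sum,
      id]
    ring
  · intro s
    refine ((HasDerivAt.const_mul (-lam) (HasDerivAt.fun_sum fun j _ => ?_)).fun_add
      (HasDerivAt.fun_sum fun J _ => ?_)).mul_const (-1)
    · exact (hd (x j) s).add_const _
    · exact (hd (xt J) s).add_const _
  · fun_prop
  · have e1 : I * (n : ℂ) * ((2 * Real.pi : ℝ) : ℂ) = n * (2 * Real.pi * I) := by push_cast; ring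
    have e2 : ((2 * Real.pi : ℝ) : ℂ) - I * η = ((0 : ℝ) - I * η) + 2 * Real.pi := by
      push_cast; ring
    rw [e1, Complex.exp_int_mul_two_pi_mul_I, mul_one, e2, kernel_add_two_pi]
  · simp only [← hp, phi_add_two_pi]

end SecondDerivatives

end EllipticCS
end

/-! ### The source identity and the eigenvalue equation. -/

noncomputable section

namespace EllipticCS

open Complex Filter Topology

variable {β : ℝ} {lam : ℂ} {N Nt : ℕ}

lemma sum_sum_ite_eq_sum_sum_Ioi {n : ℕ} (F : Fin n → Fin n → ℂ) (hF : ∀ j k, F k j = F j k) :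
    (∑ j, ∑ k, if j = k then 0 else F j k) = ∑ j, ∑ k ∈ Finset.Ioi j, 2 * F j k := by
  have h := Finset.sum_sum_Ioi_add_eq_sum_sum_off_diag fun j k => F k j
  have e : ∀ j k, F j k + F k j = 2 * F j k := fun j k => by rw [hF j k]; ring
  simp only [e] at h
  rw [h]
  refine Finset.sum_congr rfl fun j _ => ?_
  rw [← Finset.sum_compl_add_sum {j}]
  simp only [Finset.sum_singleton, if_true, add_zero]
  refine Finset.sum_congr rfl fun k hk => ?_
  rw [Finset.mem_compl, Finset.mem_singleton] at hk
  rw [if_neg (Ne.symm hk)]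

lemma sum_add_add {ι : Type*} (s : Finset ι) (f g h : ι → ℂ) :
    ∑ i ∈ s, (f i + g i + h i) = ∑ i ∈ s, f i + ∑ i ∈ s, g i + ∑ i ∈ s, h i := by
  rw [Finset.sum_add_distrib, Finset.sum_add_distrib]

lemma sum_sum_ite_const (n : ℕ) (c : ℂ) :
    (∑ j : Fin n, ∑ k : Fin n, if j = k then 0 else c) = c * (n * (n - 1)) := by
  have : ∀ j k : Fin n, (if j = k then 0 else c) = c - if j = k then c else 0 := fun j k => by
    split_ifs <;> simp
  simp only [this, Finset.sum_sub_distrib, Finset.sum_ite_eq, Finset.mem_univ, if_true,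
    Finset.sum_const, Finset.card_univ, Fintype.card_fin, nsmul_eq_mul]
  ring

/-- The masses of the three kinds of particles. -/
def mass (lam : ℂ) (N Nt : ℕ) : (Fin N ⊕ Fin Nt) ⊕ Unit → ℂ :=
  Sum.elim (Sum.elim (fun _ => 1) fun _ => -1 / lam) fun _ => -1

/-- The positions of the three kinds of particles. -/
def position (x : Fin N → ℝ) (xt : Fin Nt → ℝ) (y : ℂ) : (Fin N ⊕ Fin Nt) ⊕ Unit → ℂ :=
  Sum.elim (Sum.elim (fun j => x j) fun J => xt J) fun _ => y

lemma theta_position_sub_ne_zero (hβ : 0 < β) {x : Fin N → ℝ} {xt : Fin Nt → ℝ} {y : ℂ}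
    (hns : NonSingular β x xt) (him : 0 < -y.im ∧ -y.im < β) (a b : (Fin N ⊕ Fin Nt) ⊕ Unit)
    (hab : a ≠ b) : theta β (position x xt y a - position x xt y b) ≠ 0 := by
  have hy : ∀ r : ℝ, theta β ((r : ℂ) - y) ≠ 0 := fun r =>
    theta_ne_zero_of_im_mem hβ (by simpa using him.1) (by simpa using him.2)
  have hneg : ∀ r w : ℂ, theta β (r - w) ≠ 0 → theta β (w - r) ≠ 0 := fun r w h => by
    rwa [← neg_sub, theta_neg, neg_ne_zero]
  obtain ⟨h1, h2, h3⟩ := hns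
  rcases a with (j | J) | a <;> rcases b with (k | K) | b <;>
    simp only [position, Sum.elim_inl, Sum.elim_inr]
  · exact h1 j k fun h => hab (by rw [h])
  · exact h3 j K
  · exact hy _
  · exact hneg _ _ (h3 k J)
  · exact h2 J K fun h => hab (by rw [h])
  · exact hy _
  · exact hneg _ _ (hy _)
  · exact hneg _ _ (hy _)
  · exact absurd rfl hab

lemma phi_addition_cyclic (hβ : 0 < β) {a b c : ℂ} (hab : theta β (a - b) ≠ 0)
    (hbc : theta β (b - c) ≠ 0) (hac : theta β (a - c) ≠ 0) :
    (phi β (a - b) + phi β (b - c) + phi β (c - a)) ^ 2 =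
      3 * -(c0 β : ℂ) -
        (deriv (phi β) (a - b) + deriv (phi β) (b - c) + deriv (phi β) (c - a)) := by
  have e : a - b + (b - c) = a - c := by ring
  have h := phi_addition hβ hab hbc (by rwa [e])
  rw [e] at h
  rw [← neg_sub a c, phi_neg, deriv_phi_neg]
  linear_combination h

/-- The source identity: the second logarithmic derivatives weighted by inverse masses add up to
a constant plus the potential. -/
lemma sum_secondLogDeriv (hβ : 0 < β) (hlam : lam ≠ 0) (hmass : lam * (N - 1) = Nt)
    {x : Fin N → ℝ} {xt : Fin Nt → ℝ} {y : ℂ}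
    (hns : NonSingular β x xt) (him : 0 < -y.im ∧ -y.im < β) :
    ∑ j, secondLogDerivX β lam x xt y j - lam * ∑ J, secondLogDerivXt β lam x xt y J -
        secondLogDerivY β lam x xt y =
      -(c0 β : ℂ) * ((N - 1) * (1 - lam ^ 2)) +
        ∑ j, ∑ k ∈ Finset.Ioi j, 2 * lam * (lam - 1) * -deriv (phi β) ((x j : ℂ) - x k) +
        ∑ J, ∑ K ∈ Finset.Ioi J, 2 * (lam - 1) / lam * -deriv (phi β) ((xt J : ℂ) - xt K) +
        ∑ j, ∑ K, 2 * (1 - lam) * -deriv (phi β) ((x j : ℂ) - xt K) := by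
  have hθ := theta_position_sub_ne_zero hβ hns him
  have hm0 : ∀ a, mass lam N Nt a ≠ 0 := by
    rintro ((j | J) | a) <;> simp [mass, hlam]
  -- This is neutrality, `N - Ñ/λ - 1 = 0`; it is where the special value of `λ` enters.
  have hm : ∑ a, mass lam N Nt a = 0 := by
    simp only [mass, Fintype.sum_sum_type, Sum.elim_inl, Sum.elim_inr, Finset.sum_const,
      Finset.card_univ, Fintype.card_fin, Fintype.card_unit, nsmul_eq_mul, ← hmass]
    field_simp
    push_cast
    ring
  -- The plane-wave parameter `κ = -i/2` comes from the factor `e^{ir/2}` in `thetaCheck_exp`.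
  have key := sum_inv_mul_eq (mass lam N Nt) hm0 hm lam (-(I / 2))
    (fun a b => phi β (position x xt y a - position x xt y b))
    (fun a b => deriv (phi β) (position x xt y a - position x xt y b)) (-(c0 β : ℂ))
    (fun a b => by rw [← neg_sub, phi_neg]) (fun a b => by rw [← neg_sub, deriv_phi_neg])
    (fun a b c hab hbc hca => phi_addition_cyclic hβ (hθ a b hab) (hθ b c hbc)
      (hθ a c (Ne.symm hca)))
  have ex : ∀ j, secondLogDerivX β lam x xt y j = (1 : ℂ)⁻¹ *
      (lam * 1 * ((∑ k, if j = k then 0 else 1 * deriv (phi β) ((x j : ℂ) - x k)) +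
        (∑ J, -1 / lam * deriv (phi β) ((x j : ℂ) - xt J)) + -1 * deriv (phi β) ((x j : ℂ) - y)) +
      (lam * 1 * (∑ k, 1 * phi β ((x j : ℂ) - x k) + ∑ J, -1 / lam * phi β ((x j : ℂ) - xt J) +
        -1 * phi β ((x j : ℂ) - y) + -(I / 2))) ^ 2) := fun j => by
    simp only [secondLogDerivX, ← Finset.mul_sum, one_mul]
    generalize ∑ J, deriv (phi β) ((x j : ℂ) - xt J) = S1
    generalize ∑ J, phi β ((x j : ℂ) - xt J) = S2
    generalize ∑ k, phi β ((x j : ℂ) - x k) = S3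
    generalize (∑ k, if j = k then 0 else deriv (phi β) ((x j : ℂ) - x k)) = S4
    field_simp
    ring
  have et : ∀ J, -lam * secondLogDerivXt β lam x xt y J = (-1 / lam)⁻¹ *
      (lam * (-1 / lam) * ((∑ k, 1 * deriv (phi β) ((xt J : ℂ) - x k)) +
        (∑ K, if J = K then 0 else -1 / lam * deriv (phi β) ((xt J : ℂ) - xt K)) +
        -1 * deriv (phi β) ((xt J : ℂ) - y)) +
      (lam * (-1 / lam) * (∑ k, 1 * phi β ((xt J : ℂ) - x k) +
        ∑ K, -1 / lam * phi β ((xt J : ℂ) - xt K) +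
        -1 * phi β ((xt J : ℂ) - y) + -(I / 2))) ^ 2) := fun J => by
    have e : (∑ K, if J = K then 0 else -1 / lam * deriv (phi β) ((xt J : ℂ) - xt K)) =
        -1 / lam * ∑ K, if J = K then 0 else deriv (phi β) ((xt J : ℂ) - xt K) := by
      simp only [Finset.mul_sum, mul_ite, mul_zero]
    simp only [secondLogDerivXt, e, ← Finset.mul_sum, one_mul]
    generalize ∑ k, deriv (phi β) ((xt J : ℂ) - x k) = S1
    generalize ∑ k, phi β ((xt J : ℂ) - x k) = S2
    generalize ∑ k, phi β ((xt J : ℂ) - xt k) = S3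
    generalize (∑ k, if J = k then 0 else deriv (phi β) ((xt J : ℂ) - xt k)) = S4
    field_simp
    ring
  -- The kernel contributes `(λN - Ñ) i/2` here; by neutrality this is `λ i/2`, the same `κ` as for
  -- the other particles.
  have ey : -secondLogDerivY β lam x xt y = (-1 : ℂ)⁻¹ *
      (lam * (-1) * ((∑ k, 1 * deriv (phi β) (y - x k)) +
        (∑ K, -1 / lam * deriv (phi β) (y - xt K)) + 0) +
      (lam * (-1) * (∑ k, 1 * phi β (y - x k) + ∑ K, -1 / lam * phi β (y - xt K) +
        -1 * phi β (y - y) + -(I / 2))) ^ 2) := by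
    have e1 : ∀ r : ℂ, phi β (y - r) = -phi β (r - y) := fun r => by rw [← neg_sub, phi_neg]
    have e2 : ∀ r : ℂ, deriv (phi β) (y - r) = deriv (phi β) (r - y) := fun r => by
      rw [← neg_sub, deriv_phi_neg]
    simp only [secondLogDerivY, e1 (x _), e1 (xt _), e2, sub_self, phi_zero, Finset.sum_add_distrib,
      ← Finset.mul_sum, ← Finset.sum_mul, Finset.sum_const, Finset.card_univ, Fintype.card_fin,
      nsmul_eq_mul, Finset.sum_neg_distrib, ← hmass]
    generalize ∑ k, deriv (phi β) ((x k : ℂ) - y) = S1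
    generalize ∑ k, phi β ((x k : ℂ) - y) = S2
    generalize ∑ k, deriv (phi β) ((xt k : ℂ) - y) = S3
    generalize ∑ k, phi β ((xt k : ℂ) - y) = S4
    field_simp
    ring
  have hL : ∑ j, secondLogDerivX β lam x xt y j - lam * ∑ J, secondLogDerivXt β lam x xt y J -
        secondLogDerivY β lam x xt y =
      ∑ j, secondLogDerivX β lam x xt y j + ∑ J, -lam * secondLogDerivXt β lam x xt y J +
        -secondLogDerivY β lam x xt y := by
    rw [← Finset.mul_sum]
    ring
  simp only [mass, position, Fintype.sum_sum_type, Sum.elim_inl, Sum.elim_inr,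
    Finset.univ_unique, Finset.sum_singleton, Sum.inl.injEq, Sum.inr.injEq, reduceCtorEq, if_false,
    if_true] at key
  rw [hL]
  simp only [ex, et, ey]
  refine key.trans ?_
  have d : ∀ r w : ℂ, deriv (phi β) (r - w) = deriv (phi β) (w - r) := fun r w => by
    rw [← neg_sub, deriv_phi_neg]
  have p1 : (∑ j, ∑ k, if j = k then 0 else
      lam * 1 * deriv (phi β) ((x j : ℂ) - x k) + lam ^ 2 * 1 ^ 2 * 1 *
        (-(c0 β : ℂ) - deriv (phi β) ((x j : ℂ) - x k))) =
      -(c0 β : ℂ) * lam ^ 2 * (N * (N - 1)) +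
        ∑ j, ∑ k ∈ Finset.Ioi j, 2 * lam * (lam - 1) * -deriv (phi β) ((x j : ℂ) - x k) := by
    rw [← sum_sum_ite_const N, show (∑ j, ∑ k ∈ Finset.Ioi j, 2 * lam * (lam - 1) *
      -deriv (phi β) ((x j : ℂ) - x k)) = ∑ j, ∑ k ∈ Finset.Ioi j, 2 * (lam * (lam - 1) *
      -deriv (phi β) ((x j : ℂ) - x k)) by simp only [mul_assoc],
      ← sum_sum_ite_eq_sum_sum_Ioi _ fun j k => by rw [d]]
    simp only [← Finset.sum_add_distrib]
    refine Finset.sum_congr rfl fun j _ => Finset.sum_congr rfl fun k _ => ?_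
    split_ifs <;> ring
  have p2 : (∑ j, ∑ k, if j = k then 0 else
      lam * (-1 / lam) * deriv (phi β) ((xt j : ℂ) - xt k) + lam ^ 2 * (-1 / lam) ^ 2 * (-1 / lam) *
        (-(c0 β : ℂ) - deriv (phi β) ((xt j : ℂ) - xt k))) =
      (c0 β : ℂ) / lam * (Nt * (Nt - 1)) +
        ∑ j, ∑ k ∈ Finset.Ioi j, 2 * (lam - 1) / lam * -deriv (phi β) ((xt j : ℂ) - xt k) := by
    rw [← sum_sum_ite_const Nt, show (∑ j, ∑ k ∈ Finset.Ioi j, 2 * (lam - 1) / lam *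
      -deriv (phi β) ((xt j : ℂ) - xt k)) = ∑ j, ∑ k ∈ Finset.Ioi j, 2 * ((lam - 1) / lam *
      -deriv (phi β) ((xt j : ℂ) - xt k)) by simp only [mul_assoc, mul_div_assoc],
      ← sum_sum_ite_eq_sum_sum_Ioi _ fun j k => by rw [d]]
    simp only [← Finset.sum_add_distrib]
    refine Finset.sum_congr rfl fun j _ => Finset.sum_congr rfl fun k _ => ?_
    split_ifs
    · ring
    · field_simp
      ring
  have hxt_x : (∑ J, ∑ j, (lam * 1 * deriv (phi β) ((xt J : ℂ) - x j) +
      lam ^ 2 * (-1 / lam) ^ 2 * 1 * (-(c0 β : ℂ) - deriv (phi β) ((xt J : ℂ) - x j)))) =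
      ∑ j, ∑ J, (lam * 1 * deriv (phi β) ((x j : ℂ) - xt J) +
        lam ^ 2 * (-1 / lam) ^ 2 * 1 * (-(c0 β : ℂ) - deriv (phi β) ((x j : ℂ) - xt J))) := by
    rw [Finset.sum_comm]
    simp only [d (xt _)]
  have p3 : (∑ j, ∑ J, (lam * (-1 / lam) * deriv (phi β) ((x j : ℂ) - xt J) +
        lam ^ 2 * 1 ^ 2 * (-1 / lam) * (-(c0 β : ℂ) - deriv (phi β) ((x j : ℂ) - xt J)))) +
      (∑ j, ∑ J, (lam * 1 * deriv (phi β) ((x j : ℂ) - xt J) +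
        lam ^ 2 * (-1 / lam) ^ 2 * 1 * (-(c0 β : ℂ) - deriv (phi β) ((x j : ℂ) - xt J)))) =
      -(c0 β : ℂ) * (1 - lam) * (N * Nt) +
        ∑ j, ∑ K, 2 * (1 - lam) * -deriv (phi β) ((x j : ℂ) - xt K) := by
    have : -(c0 β : ℂ) * (1 - lam) * (N * Nt) =
        ∑ _j : Fin N, ∑ _K : Fin Nt, -(c0 β : ℂ) * (1 - lam) := by
      simp
      ring
    rw [this]
    simp only [← Finset.sum_add_distrib]
    refine Finset.sum_congr rfl fun j _ => Finset.sum_congr rfl fun k _ => ?_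
    field_simp
    ring
  -- The masses `1` and `-1` are opposite, so the interaction of `x_j` with the auxiliary particle
  -- cancels entirely.
  have p4 : (∑ j, (lam * -1 * deriv (phi β) ((x j : ℂ) - y) +
        lam ^ 2 * 1 ^ 2 * -1 * (-(c0 β : ℂ) - deriv (phi β) ((x j : ℂ) - y)))) +
      (∑ j, (lam * 1 * deriv (phi β) (y - x j) +
        lam ^ 2 * (-1) ^ 2 * 1 * (-(c0 β : ℂ) - deriv (phi β) (y - x j)))) = 0 := by
    rw [← Finset.sum_add_distrib]
    refine Finset.sum_eq_zero fun j _ => ?_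
    rw [d y]
    ring
  -- Here `λ m_a m_b = 1`, so the `φ'` terms cancel and only a multiple of `c₀` is left.
  have p5 : (∑ J, (lam * -1 * deriv (phi β) ((xt J : ℂ) - y) +
        lam ^ 2 * (-1 / lam) ^ 2 * -1 * (-(c0 β : ℂ) - deriv (phi β) ((xt J : ℂ) - y)))) +
      (∑ J, (lam * (-1 / lam) * deriv (phi β) (y - xt J) +
        lam ^ 2 * (-1) ^ 2 * (-1 / lam) * (-(c0 β : ℂ) - deriv (phi β) (y - xt J)))) =
      (c0 β : ℂ) * (1 + lam) * Nt := by
    have : (c0 β : ℂ) * (1 + lam) * Nt = ∑ _J : Fin Nt, (c0 β : ℂ) * (1 + lam) := by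
      simp
      ring
    rw [this, ← Finset.sum_add_distrib]
    refine Finset.sum_congr rfl fun j _ => ?_
    rw [d y]
    field_simp
    ring
  have fin : -(c0 β : ℂ) * lam ^ 2 * (N * (N - 1)) + (c0 β : ℂ) / lam * (Nt * (Nt - 1)) +
      -(c0 β : ℂ) * (1 - lam) * (N * Nt) + (c0 β : ℂ) * (1 + lam) * Nt =
      -(c0 β : ℂ) * ((N - 1) * (1 - lam ^ 2)) := by
    rw [← hmass]
    field_simp
    ring
  rw [sum_add_add, sum_add_add, p1, p2, hxt_x]
  linear_combination p3 + p4 + p5 + fin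

lemma V_sub_eq (hβ : 0 < β) {r w : ℝ} (h : theta β ((r : ℂ) - w) ≠ 0) :
    V β ((r : ℂ) - w) = -deriv (phi β) ((r : ℂ) - w) := by
  refine V_eq_neg_deriv_phi hβ ?_ fun h0 => h (by rw [theta_eq, h0, zero_mul])
  rw [← ofReal_sub]
  exact ofReal_mem_strip hβ _

lemma continuous_secondLogDeriv (hβ : 0 < β) (lam : ℂ) {η : ℝ} (h0 : 0 < η) (h1 : η < β)
    (x : Fin N → ℝ) (xt : Fin Nt → ℝ) :
    (∀ j, Continuous fun s : ℝ => secondLogDerivX β lam x xt (s - I * η) j) ∧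
      (∀ J, Continuous fun s : ℝ => secondLogDerivXt β lam x xt (s - I * η) J) ∧
      Continuous fun s : ℝ => secondLogDerivY β lam x xt (s - I * η) := by
  have c1 := fun r => continuous_deriv_phi_sub_shift hβ h0 h1 r
  have c2 := fun r => continuous_phi_sub_shift hβ h0 h1 r
  unfold secondLogDerivX secondLogDerivXt secondLogDerivY
  refine ⟨fun j => ?_, fun J => ?_, ?_⟩ <;> fun_prop

/-- The eigenvalue equation. -/
lemma H_Psi (hβ : 0 < β) (hlam : lam ≠ 0) (hmass : lam * (N - 1) = Nt) {R : ℝ} (hR : 0 < R)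
    (h0 : 0 < Real.log R) (h1 : Real.log R < β) (n : ℤ) {x : Fin N → ℝ} {xt : Fin Nt → ℝ}
    (hns : NonSingular β x xt) :
    H β lam (Psi β lam R n) x xt =
      ((n : ℂ) ^ 2 + (N - 1) * (1 - lam ^ 2) * c0 β) * Psi β lam R n x xt := by
  have him : ∀ s : ℝ, 0 < -((s : ℂ) - I * Real.log R).im ∧ -((s : ℂ) - I * Real.log R).im < β :=
    fun s => by rw [im_shift, neg_neg]; exact ⟨h0, h1⟩
  obtain ⟨cx, ct, cy⟩ := continuous_secondLogDeriv hβ lam h0 h1 x xt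
  set C : ℂ := (2 * Real.pi : ℂ)⁻¹ * R ^ n * Psi0 β lam x xt with hC
  set g : ℝ → ℂ := fun s => cexp (I * n * s) * kernel β lam x xt (s - I * Real.log R) with hg
  have cg : Continuous g := (contDiff_exp_mul_kernel hβ lam n h0 h1).continuous.comp
    (f := fun s : ℝ => ((x, xt), s)) (by fun_prop)
  have hPsi : Psi β lam R n x xt = C * ∫ s in (0 : ℝ)..2 * Real.pi, g s := Psi_eq hR n x xt
  have hx : ∀ j, iteratedDeriv 2 (fun t => Psi β lam R n (Function.update x j t) xt) (x j) =
      ∫ s in (0 : ℝ)..2 * Real.pi,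
        secondLogDerivX β lam x xt (s - I * Real.log R) j * (C * g s) :=
    iteratedDeriv_two_Psi_update_left hβ hlam hR h0 h1 n hns
  have ht : ∀ J, iteratedDeriv 2 (fun t => Psi β lam R n x (Function.update xt J t)) (xt J) =
      ∫ s in (0 : ℝ)..2 * Real.pi,
        secondLogDerivXt β lam x xt (s - I * Real.log R) J * (C * g s) :=
    iteratedDeriv_two_Psi_update_right hβ hlam hR h0 h1 n hns
  have hy : ∫ s in (0 : ℝ)..2 * Real.pi,
      secondLogDerivY β lam x xt (s - I * Real.log R) * (C * g s) =
        -(n : ℂ) ^ 2 * Psi β lam R n x xt := by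
    have := integral_secondLogDerivY hβ lam h0 h1 n x xt
    rw [hPsi, mul_left_comm, ← this, ← intervalIntegral.integral_const_mul]
    refine intervalIntegral.integral_congr fun s _ => ?_
    simp only [hg]
    ring
  have V1 : ∀ j, ∀ k ∈ Finset.Ioi j, 2 * lam * (lam - 1) * V β ((x j : ℂ) - x k) =
      2 * lam * (lam - 1) * -deriv (phi β) ((x j : ℂ) - x k) := fun j k hk => by
    rw [V_sub_eq hβ (hns.1 j k (Finset.mem_Ioi.mp hk).ne)]
  have V2 : ∀ j, ∀ k ∈ Finset.Ioi j, 2 * (lam - 1) / lam * V β ((xt j : ℂ) - xt k) =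
      2 * (lam - 1) / lam * -deriv (phi β) ((xt j : ℂ) - xt k) := fun j k hk => by
    rw [V_sub_eq hβ (hns.2.1 j k (Finset.mem_Ioi.mp hk).ne)]
  have V3 : ∀ j k, 2 * (1 - lam) * V β ((x j : ℂ) - xt k) =
      2 * (1 - lam) * -deriv (phi β) ((x j : ℂ) - xt k) := fun j k => by
    rw [V_sub_eq hβ (hns.2.2 j k)]
  have key := fun s : ℝ => sum_secondLogDeriv hβ hlam hmass hns (him s)
  unfold H
  rw [Finset.sum_congr rfl fun j _ => Finset.sum_congr rfl (V1 j),
    Finset.sum_congr rfl fun j _ => Finset.sum_congr rfl (V2 j),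
    Finset.sum_congr rfl fun j _ => Finset.sum_congr rfl fun k _ => V3 j k]
  generalize (∑ j, ∑ k ∈ Finset.Ioi j, 2 * lam * (lam - 1) * -deriv (phi β) ((x j : ℂ) - x k)) = S1
    at key ⊢
  generalize (∑ J, ∑ K ∈ Finset.Ioi J, 2 * (lam - 1) / lam * -deriv (phi β) ((xt J : ℂ) - xt K)) =
    S2 at key ⊢
  generalize (∑ j, ∑ K, 2 * (1 - lam) * -deriv (phi β) ((x j : ℂ) - xt K)) = S3 at key ⊢
  simp only [hx, ht]
  have ix : ∀ j ∈ Finset.univ, IntervalIntegrable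
      (fun s : ℝ => secondLogDerivX β lam x xt (s - I * Real.log R) j * (C * g s))
      MeasureTheory.volume 0 (2 * Real.pi) := fun j _ =>
    ((cx j).mul (continuous_const.mul cg)).intervalIntegrable _ _
  have it : ∀ J ∈ Finset.univ, IntervalIntegrable
      (fun s : ℝ => secondLogDerivXt β lam x xt (s - I * Real.log R) J * (C * g s))
      MeasureTheory.volume 0 (2 * Real.pi) := fun J _ =>
    ((ct J).mul (continuous_const.mul cg)).intervalIntegrable _ _
  have iy : IntervalIntegrable
      (fun s : ℝ => secondLogDerivY β lam x xt (s - I * Real.log R) * (C * g s))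
      MeasureTheory.volume 0 (2 * Real.pi) :=
    (cy.mul (continuous_const.mul cg)).intervalIntegrable _ _
  -- The source identity is integrated against `C * g`; its right-hand side no longer depends on
  -- `s`, so it leaves the integral.
  have e : ∫ s in (0 : ℝ)..2 * Real.pi,
      (∑ j, secondLogDerivX β lam x xt (s - I * Real.log R) j * (C * g s) -
        lam * ∑ J, secondLogDerivXt β lam x xt (s - I * Real.log R) J * (C * g s) -
        secondLogDerivY β lam x xt (s - I * Real.log R) * (C * g s)) =
      (-(c0 β : ℂ) * ((N - 1) * (1 - lam ^ 2)) + S1 + S2 + S3) * Psi β lam R n x xt := by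
    rw [hPsi, ← mul_assoc, ← intervalIntegral.integral_const_mul]
    refine intervalIntegral.integral_congr fun s _ => ?_
    simp only [← key s, ← Finset.sum_mul]
    ring
  have sx : IntervalIntegrable
      (fun s : ℝ => ∑ j, secondLogDerivX β lam x xt (s - I * Real.log R) j * (C * g s))
      MeasureTheory.volume 0 (2 * Real.pi) :=
    (continuous_finsetSum _ fun j _ => (cx j).mul (continuous_const.mul cg)).intervalIntegrable _ _
  have st : IntervalIntegrable
      (fun s : ℝ => lam * ∑ J, secondLogDerivXt β lam x xt (s - I * Real.log R) J * (C * g s))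
      MeasureTheory.volume 0 (2 * Real.pi) := (continuous_const.mul
    (continuous_finsetSum _ fun J _ => (ct J).mul (continuous_const.mul cg))).intervalIntegrable _ _
  rw [intervalIntegral.integral_sub (sx.sub st) iy,
    intervalIntegral.integral_sub sx st, intervalIntegral.integral_const_mul,
    intervalIntegral.integral_finsetSum ix, intervalIntegral.integral_finsetSum it, hy] at e
  linear_combination -e

lemma contDiffAt_Psi (hβ : 0 < β) (lam : ℂ) {R : ℝ} (hR : 0 < R)
    (h0 : 0 < Real.log R) (h1 : Real.log R < β) (n : ℤ) {p : (Fin N → ℝ) × (Fin Nt → ℝ)}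
    (hns : NonSingular β p.1 p.2) :
    ContDiffAt ℝ 2 (fun p : (Fin N → ℝ) × (Fin Nt → ℝ) => Psi β lam R n p.1 p.2) p := by
  simp only [Psi_eq hR]
  exact (contDiffAt_const.mul (contDiffAt_Psi0 hβ lam hns)).mul
    (contDiff_intervalIntegral 2 (contDiff_exp_mul_kernel hβ lam n h0 h1) 0
      (2 * Real.pi)).contDiffAt

end EllipticCS
end

/-! ### Independence of the contour, and injectivity of convolution with `θ̌`. -/

noncomputable section

namespace EllipticCS

open Complex Filter Topology

variable {β : ℝ}

lemma one_div_nome_sq (β : ℝ) : 1 / nome β ^ 2 = Real.exp β := by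
  rw [nome_sq_eq_exp, Real.exp_neg, one_div, inv_inv]

/-- For `1 < |ξ| < q⁻²` the arguments `e^{ix}/ξ` lie in the annulus `q² < |z| < 1` where the powers
are holomorphic. -/
lemma differentiableAt_genFun (hβ : 0 < β) (lam : ℂ) {N Nt : ℕ} (x : Fin N → ℝ) (xt : Fin Nt → ℝ)
    {ξ : ℂ} (h1 : 1 < ‖ξ‖) (h2 : ‖ξ‖ < 1 / nome β ^ 2) :
    DifferentiableAt ℂ (genFun β lam x xt) ξ := by
  have hξ : ξ ≠ 0 := norm_pos_iff.mp (one_pos.trans h1)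
  have hq : 0 < nome β ^ 2 := by have := nome_pos β; positivity
  have hn : ∀ r : ℝ, ‖cexp (I * (r : ℂ)) / ξ‖ = ‖ξ‖⁻¹ := fun r => by
    rw [norm_div, mul_comm, norm_exp_ofReal_mul_I, one_div]
  have b1 : ∀ r : ℝ, nome β ^ 2 < ‖cexp (I * (r : ℂ)) / ξ‖ := fun r => by
    rw [hn, lt_inv_comm₀ hq (by linarith), ← one_div]
    exact h2
  have b2 : ∀ r : ℝ, ‖cexp (I * (r : ℂ)) / ξ‖ < 1 := fun r => by
    rw [hn]
    exact inv_lt_one_of_one_lt₀ h1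
  have d : ∀ r : ℝ, DifferentiableAt ℂ (fun ξ => cexp (I * (r : ℂ)) / ξ) ξ := fun r => by
    fun_prop (disch := assumption)
  have d1 : ∀ r : ℝ, DifferentiableAt ℂ
      (fun ξ => thetaCheckPow β (-lam) (cexp (I * (r : ℂ)) / ξ)) ξ := fun r => by
    have := (differentiableAt_logThetaCheck hβ (b1 r) (b2 r)).fun_comp' ξ (d r)
    unfold thetaCheckPow
    fun_prop
  have d2 : ∀ r : ℝ, DifferentiableAt ℂ
      (fun ξ => thetaCheck β (cexp (I * (r : ℂ)) / ξ)) ξ := fun r => by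
    refine DifferentiableAt.fun_comp' (g := thetaCheck β) ξ ?_ (d r)
    refine (differentiableAt_logThetaCheck hβ (b1 r) (b2 r)).cexp.congr_of_eventuallyEq ?_
    have hU : IsOpen {w : ℂ | nome β ^ 2 < ‖w‖ ∧ ‖w‖ < 1} :=
      (isOpen_lt continuous_const continuous_norm).inter
        (isOpen_lt continuous_norm continuous_const)
    filter_upwards [hU.mem_nhds ⟨b1 r, b2 r⟩] with w hw
    exact (exp_logThetaCheck hβ hw.1 hw.2).symm
  unfold genFun
  fun_prop

/-- The Laurent coefficient does not depend on the contour. -/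
lemma laurentCoeff_eq_of_le (hβ : 0 < β) (lam : ℂ) (n : ℤ) {R R' : ℝ} (h1 : 1 < R) (hle : R ≤ R')
    (h2 : R' < 1 / nome β ^ 2) {N Nt : ℕ} (x : Fin N → ℝ) (xt : Fin Nt → ℝ) :
    laurentCoeff β lam R n x xt = laurentCoeff β lam R' n x xt := by
  have hd : ∀ ξ : ℂ, R ≤ ‖ξ‖ → ‖ξ‖ ≤ R' →
      DifferentiableAt ℂ (fun ξ => ξ⁻¹ * ξ ^ n * genFun β lam x xt ξ) ξ := fun ξ ha hb => by
    have hξ : ξ ≠ 0 := norm_pos_iff.mp (by linarith)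
    have g := differentiableAt_genFun hβ lam x xt (h1.trans_le ha) (hb.trans_lt h2)
    exact ((differentiableAt_inv hξ).fun_mul (differentiableAt_zpow.mpr (Or.inl hξ))).fun_mul g
  unfold laurentCoeff
  congr 1
  refine (circleIntegral_eq_of_differentiable_on_annulus_off_countable (by linarith) hle
    Set.countable_empty (fun ξ hξ => ?_) fun ξ hξ => ?_).symm
  · refine (hd ξ ?_ ?_).continuousAt.continuousWithinAt
    · simpa using hξ.2
    · simpa using hξ.1
  · refine hd ξ ?_ ?_
    · have := hξ.1.2
      simp at this
      exact this.le
    · have := hξ.1.1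
      simp at this
      exact this.le

/-- A continuous periodic function with vanishing Fourier coefficients vanishes. -/
lemma eq_zero_of_fourier_integral_eq_zero {F : ℝ → ℂ} (hF : Continuous F)
    (hp : Function.Periodic F (2 * Real.pi))
    (h : ∀ l : ℤ, ∫ s in (0 : ℝ)..2 * Real.pi, cexp (-(I * l * s)) * F s = 0) (s : ℝ) : F s = 0 := by
  have : Fact (0 < 2 * Real.pi) := ⟨Real.two_pi_pos⟩
  let G : C(AddCircle (2 * Real.pi), ℂ) := ⟨hp.lift, hF.quotient_liftOn' _⟩
  have hG : fourierCoeff G = 0 := by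
    funext l
    rw [fourierCoeff_eq_intervalIntegral _ _ 0, zero_add]
    have e : ∀ s : ℝ, fourier (-l) (s : AddCircle (2 * Real.pi)) • G s =
        cexp (-(I * l * s)) * F s := fun s => by
      rw [fourier_coe_apply, smul_eq_mul]
      congr 2
      have : (Real.pi : ℂ) ≠ 0 := by exact_mod_cast Real.pi_ne_zero
      push_cast
      field_simp
    simp only [e, h l, smul_zero, Pi.zero_apply]
  -- Zero coefficients are summable, so the Fourier series converges to the continuous function
  -- itself.
  have hs : HasSum (fun i => fourierCoeff G i • fourier i) G :=
    hasSum_fourier_series_of_summable (by rw [hG]; exact summable_zero)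
  have hG0 : G = 0 := by
    refine hs.unique ?_
    simp only [hG, Pi.zero_apply, zero_smul]
    exact hasSum_zero
  exact congrArg (fun G : C(AddCircle (2 * Real.pi), ℂ) => G s) hG0

lemma differentiable_thetaCheck_exp (hβ : 0 < β) :
    Differentiable ℂ fun r => thetaCheck β (cexp (I * r)) := by
  have := differentiable_theta hβ
  simp only [thetaCheck_exp]
  fun_prop

lemma thetaCheck_exp_add_two_pi (β : ℝ) (r : ℂ) :
    thetaCheck β (cexp (I * (r + 2 * Real.pi))) = thetaCheck β (cexp (I * r)) := by
  rw [mul_add, show I * (2 * Real.pi : ℂ) = 2 * Real.pi * I by ring, Complex.exp_periodic]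

lemma thetaCheck_exp_add_I_mul (hβ : 0 < β) (r : ℂ) :
    thetaCheck β (cexp (I * (r + I * β))) =
      -cexp (-(I * r)) * thetaCheck β (cexp (I * r)) := by
  have h1 : cexp (I * (r + I * β)) = (nome β : ℂ) ^ 2 * cexp (I * r) := by
    have := ofReal_nome_pow_eq_exp β 1
    rw [mul_one] at this
    rw [this, ← Complex.exp_add]
    congr 1
    linear_combination (β : ℂ) * I_mul_I
  rw [h1, thetaCheck_nome_sq_mul hβ (Complex.exp_ne_zero _), Complex.exp_neg]
  ring

/-- The Fourier integrals of `θ̌` on a horizontal line. -/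
def thetaFourier (β η : ℝ) (l : ℤ) : ℂ :=
  ∫ s in (0 : ℝ)..2 * Real.pi,
    cexp (-(I * l * (s + η * I))) * thetaCheck β (cexp (I * (s + η * I)))

/-- Cauchy's theorem is applied to a rectangle one period wide and `β` high. The vertical sides
cancel by periodicity, and the multiplier `-e^{-ir}` on the top side raises the Fourier index by
one. -/
lemma thetaFourier_add (hβ : 0 < β) (η : ℝ) (l : ℤ) :
    thetaFourier β η l = -cexp (l * β) * thetaFourier β η (l + 1) := by
  set f : ℂ → ℂ := fun r => cexp (-(I * l * r)) * thetaCheck β (cexp (I * r)) with hf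
  have hd : Differentiable ℂ f := by
    have := differentiable_thetaCheck_exp hβ
    fun_prop
  have hper : ∀ r, f (r + 2 * Real.pi) = f r := fun r => by
    simp only [hf]
    rw [thetaCheck_exp_add_two_pi, show -(I * l * (r + 2 * Real.pi)) =
      -(I * l * r) + (-l : ℤ) * (2 * Real.pi * I) by push_cast; ring, Complex.exp_add,
      Complex.exp_int_mul_two_pi_mul_I, mul_one]
  have hrect := Complex.integral_boundary_rect_eq_zero_of_differentiableOn f (η * I)
    (2 * Real.pi + (η + β) * I) hd.differentiableOn
  simp only [add_re, add_im, mul_re, mul_im, ofReal_re, ofReal_im, I_re, I_im, re_ofNat, im_ofNat,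
    mul_zero, mul_one, zero_mul, sub_zero, add_zero, zero_add, sub_self, ofReal_add, ofReal_zero,
    ofReal_mul, ofReal_ofNat] at hrect
  have hv : ∀ y : ℝ, f (2 * Real.pi + y * I) = f (y * I) := fun y => by
    rw [add_comm]
    exact hper _
  simp only [hv, add_sub_cancel_right, sub_eq_zero] at hrect
  have hshift : ∀ s : ℝ, f (s + (η + β) * I) = -cexp (l * β) *
      (cexp (-(I * (l + 1 : ℤ) * (s + η * I))) * thetaCheck β (cexp (I * (s + η * I)))) := fun s => by
    have e1 : (s + (η + β) * I : ℂ) = (s + η * I) + I * β := by ring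
    simp only [hf]
    rw [e1, thetaCheck_exp_add_I_mul hβ]
    have e2 : -(I * l * ((s + η * I) + I * β)) = l * β + -(I * l * (s + η * I)) := by
      linear_combination (-(l : ℂ) * β) * I_mul_I
    have e3 : -(I * ((l + 1 : ℤ) : ℂ) * (s + η * I)) =
        -(I * l * (s + η * I)) + -(I * (s + η * I)) := by push_cast; ring
    rw [e2, e3, Complex.exp_add, Complex.exp_add]
    ring
  simp only [hshift, intervalIntegral.integral_const_mul] at hrect
  exact hrect

/-- By the recursion, one vanishing coefficient forces all to vanish. Then `θ̌` would be zero on the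
whole line, where it has no zeros. -/
lemma thetaFourier_ne_zero (hβ : 0 < β) {η : ℝ} (h0 : 0 < η) (h1 : η < β) (l : ℤ) :
    thetaFourier β η l ≠ 0 := by
  intro hl
  have hup : ∀ k, thetaFourier β η k = 0 → thetaFourier β η (k + 1) = 0 := fun k hk => by
    rw [thetaFourier_add hβ, mul_eq_zero] at hk
    exact hk.resolve_left (neg_ne_zero.mpr (Complex.exp_ne_zero _))
  have hdown : ∀ k, thetaFourier β η k = 0 → thetaFourier β η (k - 1) = 0 := fun k hk => by
    rw [thetaFourier_add hβ, sub_add_cancel, hk, mul_zero]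
  have hall : ∀ k, thetaFourier β η k = 0 := fun k =>
    Int.inductionOn' k l hl (fun k _ => hup k) fun k _ => hdown k
  have hc := (differentiable_thetaCheck_exp hβ).continuous
  have hz := eq_zero_of_fourier_integral_eq_zero
    (F := fun s : ℝ => thetaCheck β (cexp (I * (s + η * I))))
    (hc.comp' (f := fun s : ℝ => (s + η * I : ℂ)) (by fun_prop)) (fun s => by
      have : ((s + 2 * Real.pi : ℝ) : ℂ) + η * I = (s + η * I) + 2 * Real.pi := by push_cast; ring
      simp only [this, thetaCheck_exp_add_two_pi]) (fun k => by
      have h := hall k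
      have e : ∀ s : ℝ, cexp (-(I * k * (s + η * I))) * thetaCheck β (cexp (I * (s + η * I))) =
          cexp (k * η) * (cexp (-(I * k * s)) * thetaCheck β (cexp (I * (s + η * I)))) := fun s => by
        rw [← mul_assoc, ← Complex.exp_add]
        congr 2
        linear_combination (-(k : ℂ) * η) * I_mul_I
      simp only [thetaFourier, e, intervalIntegral.integral_const_mul] at h
      exact (mul_eq_zero.mp h).resolve_left (Complex.exp_ne_zero _)) 0
  simp only [thetaCheck_exp, mul_eq_zero, neg_eq_zero, OfNat.ofNat_ne_zero, I_ne_zero,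
    Complex.exp_ne_zero, false_or] at hz
  exact theta_ne_zero_of_im_mem hβ (by simpa using h0) (by simpa using h1) hz

/-- Convolution with `θ̌` on a horizontal line is injective. -/
lemma eq_zero_of_integral_mul_thetaCheck_eq_zero (hβ : 0 < β) {η : ℝ} (h0 : 0 < η) (h1 : η < β)
    {F : ℝ → ℂ} (hF : Continuous F) (hp : Function.Periodic F (2 * Real.pi))
    (h : ∀ t : ℝ, ∫ s in (0 : ℝ)..2 * Real.pi,
      F s * thetaCheck β (cexp (I * ((t - s : ℝ) + η * I))) = 0) (s : ℝ) : F s = 0 := by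
  have hc := (differentiable_thetaCheck_exp hβ).continuous
  have hT : Continuous fun u : ℝ => thetaCheck β (cexp (I * (u + η * I))) :=
    hc.comp' (f := fun s : ℝ => (s + η * I : ℂ)) (by fun_prop)
  refine eq_zero_of_fourier_integral_eq_zero hF hp (fun l => ?_) s
  -- The `l`-th Fourier coefficient of the convolution, computed in the other order, is that of `F`
  -- times a nonzero multiple of `thetaFourier β η l`.
  have hswap : ∫ t in (0 : ℝ)..2 * Real.pi, ∫ s in (0 : ℝ)..2 * Real.pi,
      cexp (-(I * l * t)) * (F s * thetaCheck β (cexp (I * ((t - s : ℝ) + η * I)))) = 0 := by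
    simp only [intervalIntegral.integral_const_mul, h, mul_zero, intervalIntegral.integral_zero]
  rw [MeasureTheory.intervalIntegral_intervalIntegral_swap] at hswap
  · have hinner : ∀ s : ℝ, ∫ t in (0 : ℝ)..2 * Real.pi,
        cexp (-(I * l * t)) * (F s * thetaCheck β (cexp (I * ((t - s : ℝ) + η * I)))) =
        cexp (-(I * l * s)) * F s * (cexp (-(l * η)) * thetaFourier β η l) := fun s => by
      let g : ℝ → ℂ := fun u =>
        cexp (-(I * l * (u + η * I))) * thetaCheck β (cexp (I * (u + η * I)))
      have hg : Function.Periodic g (2 * Real.pi) := fun u => by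
        have e : ((u + 2 * Real.pi : ℝ) : ℂ) + η * I = (u + η * I) + 2 * Real.pi := by
          push_cast; ring
        simp only [g, e, thetaCheck_exp_add_two_pi]
        rw [show -(I * l * ((u + η * I) + 2 * Real.pi)) =
          -(I * l * (u + η * I)) + (-l : ℤ) * (2 * Real.pi * I) by push_cast; ring, Complex.exp_add,
          Complex.exp_int_mul_two_pi_mul_I, mul_one]
      have e : ∀ t : ℝ,
          cexp (-(I * l * t)) * (F s * thetaCheck β (cexp (I * ((t - s : ℝ) + η * I)))) =
          cexp (-(I * l * s)) * F s * (cexp (-(l * η)) * g (t - s)) := fun t => by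
        have : cexp (-(I * l * t)) = cexp (-(I * l * s)) * (cexp (-(l * η)) *
            cexp (-(I * l * ((t - s : ℝ) + η * I)))) := by
          rw [← Complex.exp_add, ← Complex.exp_add]
          congr 1
          push_cast
          linear_combination ((l : ℂ) * η) * I_mul_I
        rw [this]
        simp only [g]
        ring
      simp only [e, intervalIntegral.integral_const_mul]
      congr 2
      rw [intervalIntegral.integral_comp_sub_right, show 2 * Real.pi - s = (0 - s) + 2 * Real.pi by
        ring, hg.intervalIntegral_add_eq (0 - s) 0, zero_add]
      rfl
    simp only [hinner, intervalIntegral.integral_mul_const] at hswap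
    exact (mul_eq_zero.mp hswap).resolve_right
      (mul_ne_zero (Complex.exp_ne_zero _) (thetaFourier_ne_zero hβ h0 h1 l))
  · have hcont : Continuous (Function.uncurry fun t s : ℝ =>
        cexp (-(I * l * t)) * (F s * thetaCheck β (cexp (I * ((t - s : ℝ) + η * I))))) := by
      have := hT.comp (f := fun z : ℝ × ℝ => z.1 - z.2) (by fun_prop)
      simp only [Function.comp_def] at this
      unfold Function.uncurry
      fun_prop
    exact (hcont.continuousOn.integrableOn_compact (isCompact_uIcc.prod isCompact_uIcc)).mono_set
      (Set.prod_mono Set.uIoc_subset_uIcc Set.uIoc_subset_uIcc)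

end EllipticCS
end

/-! ### The eigenfunctions are not identically zero. -/

noncomputable section

namespace EllipticCS

open Complex Filter Topology

variable {β : ℝ} {lam : ℂ} {N Nt : ℕ}

/-- Since `π` is irrational, distinct integers are never congruent modulo `2π`; integer positions
thus give an explicit regular configuration. -/
lemma natCast_sub_ne {i k : ℕ} (h : i ≠ k) (m : ℤ) : (i : ℝ) - k ≠ 2 * Real.pi * m := by
  intro he
  by_cases hm : m = 0
  · subst hm
    apply h
    have : (i : ℝ) = k := by simpa [sub_eq_zero] using he
    exact_mod_cast this
  · refine irrational_pi ⟨((i : ℚ) - k) / (2 * m), ?_⟩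
    have : (m : ℝ) ≠ 0 := by exact_mod_cast hm
    push_cast
    rw [he]
    field_simp

/-- Moving one coordinate of a nonsingular configuration, the other coordinates being fixed, one
meets singular configurations only in a countable set. -/
lemma exists_countable_update_mem_regularSet {x : Fin N → ℝ} {xt : Fin Nt → ℝ}
    (h : (x, xt) ∈ regularSet N Nt) (J₀ : Fin Nt) :
    ∃ S : Set ℝ, S.Countable ∧ ∀ t ∉ S, (x, Function.update xt J₀ t) ∈ regularSet N Nt := by
  obtain ⟨h1, h2, h3⟩ := h
  refine ⟨(⋃ j, Set.range fun m : ℤ => x j - 2 * Real.pi * m) ∪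
    ⋃ J, Set.range fun m : ℤ => xt J - 2 * Real.pi * m,
    (Set.countable_iUnion fun j => Set.countable_range _).union
      (Set.countable_iUnion fun j => Set.countable_range _), fun t ht => ⟨h1, ?_, ?_⟩⟩
  · simp only [Set.mem_union, Set.mem_iUnion, Set.mem_range, not_or, not_exists] at ht
    intro J K hJK m
    simp only
    by_cases hJ : J = J₀
    · subst hJ
      rw [Function.update_self, Function.update_of_ne (Ne.symm hJK)]
      intro he
      refine ht.2 K (-m) ?_
      push_cast
      linarith
    · rw [Function.update_of_ne hJ]
      by_cases hK : K = J₀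
      · subst hK
        rw [Function.update_self]
        intro he
        refine ht.2 J m ?_
        linarith
      · rw [Function.update_of_ne hK]
        exact h2 J K hJK m
  · simp only [Set.mem_union, Set.mem_iUnion, Set.mem_range, not_or, not_exists] at ht
    intro j J m
    simp only
    by_cases hJ : J = J₀
    · subst hJ
      rw [Function.update_self]
      intro he
      refine ht.1 j m ?_
      linarith
    · rw [Function.update_of_ne hJ]
      exact h3 j J m

lemma natCast_mem_regularSet (N Nt : ℕ) :
    ((fun j => ((j : ℕ) : ℝ), fun J => ((N + (J : ℕ) : ℕ) : ℝ)) :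
      (Fin N → ℝ) × (Fin Nt → ℝ)) ∈ regularSet N Nt := by
  refine ⟨fun j k hjk m => natCast_sub_ne ?_ m, fun j k hjk m => natCast_sub_ne ?_ m,
    fun j k m => natCast_sub_ne ?_ m⟩
  · exact fun h => hjk (Fin.ext h)
  · exact fun h => hjk (Fin.ext (by omega))
  · have := j.isLt
    omega

/-- If `Psi` vanished on the regular set, letting only `x̃_{J₀} = t` move would annihilate a
convolution with `θ̌`, forcing a nowhere zero function `F` to be zero. -/
lemma exists_Psi_ne_zero (hβ : 0 < β) (lam : ℂ) {R : ℝ} (hR : 0 < R)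
    (h0 : 0 < Real.log R) (h1 : Real.log R < β) (n : ℤ) (J₀ : Fin Nt) :
    ∃ p ∈ regularSet N Nt, Psi β lam R n p.1 p.2 ≠ 0 := by
  by_contra! hzero
  set x : Fin N → ℝ := fun j => ((j : ℕ) : ℝ)
  set xt : Fin Nt → ℝ := fun J => ((N + (J : ℕ) : ℕ) : ℝ)
  obtain ⟨S, hS, hreg⟩ := exists_countable_update_mem_regularSet (natCast_mem_regularSet N Nt) J₀
  set η := Real.log R
  set f : ℝ → ℝ → ℂ := fun t s =>
    cexp (I * n * s) * kernel β lam x (Function.update xt J₀ t) (s - I * η) with hf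
  have hcd := contDiff_exp_mul_kernel (N := N) (Nt := Nt) hβ lam n h0 h1
  have hupd : Continuous fun z : ℝ × ℝ => Function.update xt J₀ z.1 :=
    continuous_const.update J₀ continuous_fst
  have hcont : Continuous (Function.uncurry f) := hcd.continuous.comp
    (f := fun z : ℝ × ℝ => ((x, Function.update xt J₀ z.1), z.2))
    (by fun_prop)
  -- `Psi0` can be divided out only at regular `t`. The exceptional `t` are countable, so the rest
  -- are dense and continuity fills the gaps.
  have hint : ∀ t, ∫ s in (0 : ℝ)..2 * Real.pi, f t s = 0 := by
    have hc : Continuous fun t => ∫ s in (0 : ℝ)..2 * Real.pi, f t s :=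
      intervalIntegral.continuous_parametric_intervalIntegral_of_continuous' hcont _ _
    have hd := hS.dense_compl ℝ
    refine fun t => congrFun (hc.ext_on hd continuous_const fun t ht => ?_) t
    have hp := hzero _ (hreg t ht)
    rw [Psi_eq hR] at hp
    have hR' : (R : ℂ) ≠ 0 := by exact_mod_cast hR.ne'
    refine (mul_eq_zero.mp hp).resolve_left (mul_ne_zero (mul_ne_zero ?_ (zpow_ne_zero _ hR'))
      (Psi0_ne_zero (nonSingular_of_mem_regularSet hβ (hreg t ht))))
    have : (Real.pi : ℂ) ≠ 0 := by exact_mod_cast Real.pi_ne_zero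
    simp [this]
  have hadd : ∀ u s : ℝ, (u : ℂ) - ((s + 2 * Real.pi : ℝ) - I * η) + 2 * Real.pi =
      (u : ℂ) - (s - I * η) := fun u s => by push_cast; ring
  -- All factors of the integrand not depending on `t` are collected here; the remaining one is `θ̌`
  -- at `t - s + iη`.
  set F : ℝ → ℂ := fun s => cexp (I * n * s) *
    ((∏ j, thetaCheckPow β (-lam) (cexp (I * (x j - (s - I * η))))) *
      ∏ J ∈ Finset.univ.erase J₀, thetaCheck β (cexp (I * (xt J - (s - I * η))))) with hF
  have hfF : ∀ t s, f t s = F s * thetaCheck β (cexp (I * ((t - s : ℝ) + η * I))) := fun t s => by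
    simp only [hf, hF, kernel_eq]
    rw [← Finset.mul_prod_erase _ _ (Finset.mem_univ J₀), Function.update_self,
      show ((t - s : ℝ) : ℂ) + η * I = (t : ℂ) - (s - I * η) by push_cast; ring]
    have : ∀ J ∈ Finset.univ.erase J₀,
        thetaCheck β (cexp (I * ((Function.update xt J₀ t J : ℝ) - (s - I * η)))) =
        thetaCheck β (cexp (I * (xt J - (s - I * η)))) := fun J hJ => by
      rw [Function.update_of_ne (Finset.ne_of_mem_erase hJ)]
    rw [Finset.prod_congr rfl this]
    ring
  have him : ∀ u s : ℝ, 0 < ((u : ℂ) - (s - I * η)).im ∧ ((u : ℂ) - (s - I * η)).im < β :=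
    fun u s => by simpa using ⟨h0, h1⟩
  have hper : ∀ u s : ℝ, cexp (I * ((u : ℂ) - ((s + 2 * Real.pi : ℝ) - I * η))) =
      cexp (I * ((u : ℂ) - (s - I * η))) := fun u s => by
    rw [← hadd u s, mul_add, show I * (2 * Real.pi : ℂ) = 2 * Real.pi * I by ring, Complex.exp_periodic]
  have hFc : Continuous F := by
    have c1 : ∀ u : ℝ, Continuous fun s : ℝ =>
        thetaCheckPow β (-lam) (cexp (I * (u - (s - I * η)))) := fun u =>
      continuous_iff_continuousAt.mpr fun s =>
        (hasDerivAt_thetaCheckPow_exp hβ (-lam) (him u s)).continuousAt.comp'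
          (f := fun s : ℝ => (u - (s - I * η) : ℂ)) (by fun_prop)
    have c2 : ∀ u : ℝ, Continuous fun s : ℝ => thetaCheck β (cexp (I * (u - (s - I * η)))) :=
      fun u => (differentiable_thetaCheck_exp hβ).continuous.comp'
        (f := fun s : ℝ => (u - (s - I * η) : ℂ)) (by fun_prop)
    fun_prop
  have hFp : Function.Periodic F (2 * Real.pi) := fun s => by
    simp only [hF, hper]
    congr 1
    rw [show I * (n : ℂ) * ((s + 2 * Real.pi : ℝ) : ℂ) = I * n * s + n * (2 * Real.pi * I) by
      push_cast; ring, Complex.exp_add, Complex.exp_int_mul_two_pi_mul_I, mul_one]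
  have hF0 := eq_zero_of_integral_mul_thetaCheck_eq_zero hβ h0 h1 hFc hFp
    (fun t => by simpa only [hfF] using hint t) 0
  refine absurd hF0 (mul_ne_zero (Complex.exp_ne_zero _) (mul_ne_zero ?_ ?_))
  · exact Finset.prod_ne_zero_iff.mpr fun j _ => Complex.exp_ne_zero _
  · refine Finset.prod_ne_zero_iff.mpr fun J _ => ?_
    have hn := norm_exp_I_mul_mem (him (xt J) 0)
    rw [← exp_logThetaCheck hβ hn.1 hn.2]
    exact Complex.exp_ne_zero _

end EllipticCS
end

/-! ### The main theorem. -/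

theorem corollary3 (β : ℝ) (hβ : 0 < β) (N Nt : ℕ) (hN : 2 ≤ N) (hNt : 1 ≤ Nt)
    (lam : ℂ) (hlam : lam = (Nt : ℂ) / ((N : ℂ) - 1)) :
    (∀ (n : ℤ) (R R' : ℝ), 1 < R → R < 1 / EllipticCS.nome β ^ 2 →
      1 < R' → R' < 1 / EllipticCS.nome β ^ 2 → ∀ (x : Fin N → ℝ) (xt : Fin Nt → ℝ),
      EllipticCS.laurentCoeff β lam R n x xt = EllipticCS.laurentCoeff β lam R' n x xt) ∧
    (∀ (n : ℤ) (R : ℝ), 1 < R → R < 1 / EllipticCS.nome β ^ 2 →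
      EllipticCS.IsEigenfunction (N := N) (Nt := Nt) β lam (EllipticCS.Psi β lam R n)
        ((n : ℂ) ^ 2 +
          ((N : ℂ) - 1 - (Nt : ℂ) ^ 2 / ((N : ℂ) - 1)) * (EllipticCS.c0 β : ℂ))) := by
  refine ⟨fun n R R' h1 h2 h1' h2' x xt => ?_, fun n R h1 h2 => ?_⟩
  · rcases le_total R R' with h | h
    · exact EllipticCS.laurentCoeff_eq_of_le hβ lam n h1 h h2' x xt
    · exact (EllipticCS.laurentCoeff_eq_of_le hβ lam n h1' h h2 x xt).symm
  · have hR : 0 < R := by linarith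
    have hl0 : 0 < Real.log R := Real.log_pos h1
    have hl1 : Real.log R < β := by
      rwa [Real.log_lt_iff_lt_exp hR, ← EllipticCS.one_div_nome_sq]
    have hN1 : (N : ℂ) - 1 ≠ 0 := by
      rw [sub_ne_zero]
      exact_mod_cast (by omega : N ≠ 1)
    have hNt0 : (Nt : ℂ) ≠ 0 := by exact_mod_cast (by omega : Nt ≠ 0)
    have hlam0 : lam ≠ 0 := by
      rw [hlam]
      exact div_ne_zero hNt0 hN1
    have hmass : lam * (N - 1) = Nt := by
      rw [hlam]
      field_simp
    have hE : (N : ℂ) - 1 - (Nt : ℂ) ^ 2 / ((N : ℂ) - 1) = (N - 1) * (1 - lam ^ 2) := by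
      rw [hlam]
      field_simp
    refine ⟨fun p hp => ?_, ?_, fun p hp => ?_⟩
    · exact (EllipticCS.contDiffAt_Psi hβ lam hR hl0 hl1 n
        (EllipticCS.nonSingular_of_mem_regularSet hβ hp)).contDiffWithinAt
    -- The coordinate that moves exists because `Ñ ≥ 1`.
    · exact EllipticCS.exists_Psi_ne_zero hβ lam hR hl0 hl1 n ⟨0, by omega⟩
    · rw [hE]
      exact EllipticCS.H_Psi hβ hlam0 hmass hR hl0 hl1 n
        (EllipticCS.nonSingular_of_mem_regularSet hβ hp)
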